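/- Let $F$ be a field. An $F$-variety is an integral separated $F$-scheme of finite type. Let $\mathcal R$ be the category of locally ringed spaces whose structure sheaf is a sheaf of $F$-algebras (equivalently, locally ringed spaces over $\operatorname{Spec} F$), with morphisms the $F$-morphisms of locally ringed spaces, and let $\widehat{\mathbf{Var}}$ be the full subcategory of $\mathcal R$ whose objects are the inverse limits in $\mathcal R$ of cofiltered systems of $F$-varieties with birational transition morphisms (dominant morphisms inducing isomorphisms of function fields). A place $\lambda : K \rightsquigarrow L$ between fields is a map $K\cup\{\infty\}\to L\cup\{\infty\}$ with $\lambda(1)=1$ which preserves sums and products whenever they are defined ($\infty+\infty$, $0\cdot\infty$ and $\infty\cdot 0$ being undefined); if $K$ and $L$ are extensions of $F$, it is an $F$-place if $\lambda|_F=\mathrm{Id}$. Let $\mathbf{place}$ be the category of finitely generated field extensions of $F$ with the $F$-places as morphisms, and $\mathbf{field}$ the category with the same objects and with the $F$-homomorphisms of fields as morphisms. For a finitely generated extension $K/F$, the Riemann variety $\Sigma_K$ is the set of valuation rings $\mathcal O_v$ of $K$ containing $F$ (including $K$ itself), with the topology having as basis the sets $E(R)=\{v : R\subseteq \mathcal O_v\}$,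 where $R$ runs through the finitely generated $F$-subalgebras of $K$, and with the structure sheaf whose sections over a nonempty open set $U$ are $\bigcap_{v\in U}\mathcal O_v$. An $F$-place $\lambda : K\rightsquigarrow L$ induces a morphism $\lambda^*:\Sigma_L\to\Sigma_K$, which sends the valuation ring $\mathcal O_w$ to $\{x\in K : \lambda(x)\ne\infty,\ \lambda(x)\in\mathcal O_w\}$ and is given on sections by $x\mapsto\lambda(x)$. Let $\eta_L:\operatorname{Spec} L\to\Sigma_L$ be the morphism whose image is the trivial valuation and which is the identity of $L$ on stalks. Then $K\mapsto\operatorname{Spec} K$ and $K\mapsto\Sigma_K$, $\lambda\mapsto\lambda^*$ define functors $$\operatorname{Spec}:\mathbf{field}^{\mathrm{op}}\to\widehat{\mathbf{Var}},\qquad \Sigma:\mathbf{place}^{\mathrm{op}}\to\widehat{\mathbf{Var}},$$ and both are fully faithful. Moreover, for all finitely generated extensions $K$, $L$ of $F$, the map $$\widehat{\mathbf{Var}}(\Sigma_L,\Sigma_K)\xrightarrow{\ \eta_L^*\ }\widehat{\mathbf{Var}}(\operatorname{Spec} L,\Sigma_K),\qquad \psi\mapsto\psi\circ\eta_L,$$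 is bijective. -/

import Mathlib

open CategoryTheory AlgebraicGeometry TopologicalSpace Opposite
open scoped OnePoint

universe u

noncomputable section

namespace RiemannVariety

/-! ### Places -/

section Places

variable {K L M : Type*} [Field K] [Field L] [Field M]

/-- The partially defined addition of `K ∪ {∞}`: the sum `∞ + ∞` is undefined (`none`). -/
def extAdd : OnePoint K → OnePoint K → Option (OnePoint K)
  | OnePoint.some a, OnePoint.some b => some ((a + b : K) : OnePoint K)
  | OnePoint.some _, ∞ => some ∞
  | ∞, OnePoint.some _ => some ∞
  | ∞, ∞ => none

open Classical in
/-- The partially defined multiplication of `K ∪ {∞}`: the products `0 * ∞` and `∞ * 0` are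
undefined (`none`), and `∞ * ∞ = ∞`. -/
def extMul : OnePoint K → OnePoint K → Option (OnePoint K)
  | OnePoint.some a, OnePoint.some b => some ((a * b : K) : OnePoint K)
  | OnePoint.some a, ∞ => if a = 0 then none else some ∞
  | ∞, OnePoint.some b => if b = 0 then none else some ∞
  | ∞, ∞ => some ∞

/-- A place from `K` to `L`: a map `K ∪ {∞} → L ∪ {∞}` which sends `1` to `1` and preserves sums
and products whenever they are defined. -/
@[ext]
structure Place (K L : Type*) [Field K] [Field L] where
  toFun : OnePoint K → OnePoint L
  map_one' : toFun ((1 : K) : OnePoint K) = ((1 : L) : OnePoint L)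
  map_add' : ∀ x y z w, extAdd x y = some z → extAdd (toFun x) (toFun y) = some w → toFun z = w
  map_mul' : ∀ x y z w, extMul x y = some z → extMul (toFun x) (toFun y) = some w → toFun z = w

namespace Place

instance : CoeFun (Place K L) fun _ => OnePoint K → OnePoint L := ⟨Place.toFun⟩

variable (f : Place K L)

theorem map_one : f ((1 : K) : OnePoint K) = ((1 : L) : OnePoint L) := f.map_one'

theorem map_add_of {x y : K} {a b : L} (hx : f x = a) (hy : f y = b) :
    f ((x + y : K) : OnePoint K) = ((a + b : L) : OnePoint L) :=
  f.map_add' x y _ _ rfl (by rw [hx, hy]; rfl)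

theorem map_mul_of {x y : K} {a b : L} (hx : f x = a) (hy : f y = b) :
    f ((x * y : K) : OnePoint K) = ((a * b : L) : OnePoint L) :=
  f.map_mul' x y _ _ rfl (by rw [hx, hy]; rfl)

theorem map_zero : f ((0 : K) : OnePoint K) = ((0 : L) : OnePoint L) := by
  rcases h : f ((0 : K) : OnePoint K) with _ | a
  · have := f.map_add' ((0 : K) : OnePoint K) ((1 : K) : OnePoint K) _ ∞ rfl
      (by rw [f.map_one, h]; rfl)
    rw [zero_add, f.map_one] at this
    exact absurd this (OnePoint.coe_ne_infty _)
  · have := f.map_add_of (x := 0) (y := 1) (a := a) h f.map_one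
    rw [zero_add, f.map_one, OnePoint.coe_eq_coe] at this
    have h0 : a = 0 := by simpa using this.symm
    rw [h0]; rfl

theorem map_infty : f ∞ = ∞ := by
  rcases h : f ∞ with _ | a
  · rfl
  · exfalso
    rcases h1 : f ((1 : K) : OnePoint K) with _ | b
    · rw [f.map_one] at h1; exact OnePoint.coe_ne_infty _ h1
    · rw [f.map_one] at h1
      have := f.map_add' ((1 : K) : OnePoint K) ∞ ∞ ((1 + a : L) : OnePoint L) rfl
        (by rw [f.map_one, h]; rfl)
      rw [h] at this
      have : a = 1 + a := OnePoint.coe_injective this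
      simp at this

theorem map_neg_one : f ((-1 : K) : OnePoint K) = ((-1 : L) : OnePoint L) := by
  rcases h : f ((-1 : K) : OnePoint K) with _ | a
  · have := f.map_mul' ((-1 : K) : OnePoint K) ((-1 : K) : OnePoint K) _ ∞ rfl (by rw [h]; rfl)
    rw [neg_one_mul, neg_neg, f.map_one] at this
    exact absurd this (OnePoint.coe_ne_infty _)
  · have := f.map_add_of (x := -1) (y := 1) (a := a) h f.map_one
    rw [neg_add_cancel, f.map_zero, OnePoint.coe_eq_coe] at this
    have h0 : a = -1 := eq_neg_of_add_eq_zero_left this.symm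
    rw [h0]; rfl

theorem map_neg_of {x : K} {a : L} (hx : f x = a) :
    f ((-x : K) : OnePoint K) = ((-a : L) : OnePoint L) := by
  simpa using f.map_mul_of f.map_neg_one hx

theorem map_inv_of_ne {x : K} {a : L} (hx : f x = a) (ha : a ≠ 0) :
    f ((x⁻¹ : K) : OnePoint K) = ((a⁻¹ : L) : OnePoint L) := by
  have hx0 : x ≠ 0 := by
    rintro rfl
    rw [f.map_zero, OnePoint.coe_eq_coe] at hx
    exact ha hx.symm
  rcases h : f ((x⁻¹ : K) : OnePoint K) with _ | b
  · have := f.map_mul' (x : OnePoint K) ((x⁻¹ : K) : OnePoint K) _ ∞ rfl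
      (by rw [h, hx]; exact if_neg ha)
    rw [mul_inv_cancel₀ hx0, f.map_one] at this
    exact absurd this (OnePoint.coe_ne_infty _)
  · have := f.map_mul_of hx (b := b) h
    rw [mul_inv_cancel₀ hx0, f.map_one, OnePoint.coe_eq_coe] at this
    rw [eq_inv_of_mul_eq_one_right this.symm]
    rfl

theorem map_inv_of_infty {x : K} (hx : f x = ∞) :
    f ((x⁻¹ : K) : OnePoint K) = ((0 : L) : OnePoint L) := by
  have hx0 : x ≠ 0 := by
    rintro rfl
    rw [f.map_zero] at hx
    exact OnePoint.coe_ne_infty _ hx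
  by_contra h
  have h2 : extMul (f x) (f ((x⁻¹ : K) : OnePoint K)) = some ∞ := by
    rw [hx]
    rcases h' : f ((x⁻¹ : K) : OnePoint K) with _ | b
    · rfl
    · exact if_neg (fun hb => h (by rw [h', hb]; rfl))
  have := f.map_mul' (x : OnePoint K) ((x⁻¹ : K) : OnePoint K) _ ∞ rfl h2
  rw [mul_inv_cancel₀ hx0, f.map_one] at this
  exact OnePoint.coe_ne_infty _ this

/-- The identity place. -/
protected def id (K : Type*) [Field K] : Place K K where
  toFun x := x
  map_one' := rfl
  map_add' _ _ _ _ h h' := Option.some_injective _ (h.symm.trans h')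
  map_mul' _ _ _ _ h h' := Option.some_injective _ (h.symm.trans h')

/-- The composite of two places is their composite as maps. -/
protected def comp (g : Place L M) (f : Place K L) : Place K M where
  toFun x := g (f x)
  map_one' := by rw [f.map_one, g.map_one]
  map_add' x y z w h h' := by
    rcases hs : extAdd (f x) (f y) with _ | s
    · have : f x = ∞ ∧ f y = ∞ := by
        rcases hx : f x with _ | a <;> rcases hy : f y with _ | b <;>
          rw [hx, hy] at hs <;> first | exact ⟨rfl, rfl⟩ | exact absurd hs (Option.some_ne_none _)
      rw [this.1, this.2, g.map_infty] at h'
      exact absurd h'.symm (Option.some_ne_none _)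
    · rw [f.map_add' x y z s h hs]
      exact g.map_add' _ _ _ _ hs h'
  map_mul' x y z w h h' := by
    rcases hs : extMul (f x) (f y) with _ | s
    · have h0 : (f x = ((0 : L) : OnePoint L) ∧ f y = ∞) ∨
          (f x = ∞ ∧ f y = ((0 : L) : OnePoint L)) := by
        rcases hx : f x with _ | a <;> rcases hy : f y with _ | b <;> rw [hx, hy] at hs
        · exact absurd hs (Option.some_ne_none _)
        · right
          refine ⟨rfl, ?_⟩
          by_contra hb
          have hb' : b ≠ 0 := fun hb0 => hb (by rw [hb0]; rfl)
          exact absurd ((if_neg hb').symm.trans hs) (Option.some_ne_none _)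
        · left
          refine ⟨?_, rfl⟩
          by_contra hb
          have hb' : a ≠ 0 := fun hb0 => hb (by rw [hb0]; rfl)
          exact absurd ((if_neg hb').symm.trans hs) (Option.some_ne_none _)
        · exact absurd hs (Option.some_ne_none _)
      rcases h0 with ⟨h1, h2⟩ | ⟨h1, h2⟩
      · rw [h1, h2, g.map_infty, g.map_zero] at h'
        exact absurd (h'.symm.trans (if_pos rfl)) (Option.some_ne_none _)
      · rw [h1, h2, g.map_infty, g.map_zero] at h'
        exact absurd (h'.symm.trans (if_pos rfl)) (Option.some_ne_none _)
    · rw [f.map_mul' x y z s h hs]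
      exact g.map_mul' _ _ _ _ hs h'

/-- The valuation ring of `K` underlying the composite of a place `f : K ⇝ L` with the canonical
place `L ⇝ κ(w)` attached to a valuation ring `w` of `L`: it consists of the `x` such that
`f x ≠ ∞` and `f x ∈ w`. -/
def comap (w : ValuationSubring L) : ValuationSubring K where
  carrier := {x | ∃ y ∈ w, f (x : OnePoint K) = (y : OnePoint L)}
  mul_mem' := by
    rintro x y ⟨a, ha, hx⟩ ⟨b, hb, hy⟩
    exact ⟨a * b, mul_mem ha hb, f.map_mul_of hx hy⟩
  one_mem' := ⟨1, one_mem _, f.map_one⟩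
  add_mem' := by
    rintro x y ⟨a, ha, hx⟩ ⟨b, hb, hy⟩
    exact ⟨a + b, add_mem ha hb, f.map_add_of hx hy⟩
  zero_mem' := ⟨0, zero_mem _, f.map_zero⟩
  neg_mem' := by
    rintro x ⟨a, ha, hx⟩
    exact ⟨-a, neg_mem ha, f.map_neg_of hx⟩
  mem_or_inv_mem' x := by
    rcases h : f (x : OnePoint K) with _ | a
    · exact Or.inr ⟨0, zero_mem _, f.map_inv_of_infty h⟩
    · by_cases h0 : a = 0
      · exact Or.inl ⟨0, zero_mem _, by rw [h, h0]; rfl⟩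
      · rcases w.mem_or_inv_mem a with ha | ha
        · exact Or.inl ⟨a, ha, h⟩
        · exact Or.inr ⟨a⁻¹, ha, f.map_inv_of_ne h h0⟩

end Place
end Places
/-! ### The Riemann variety -/

section Sigma

variable (F K : Type u) [Field F] [Field K] [Algebra F K]

/-- The points of the Riemann variety of `K/F`: the valuations of `K` trivial on `F`, that is, the
valuation rings of `K` containing `F`, the trivial one (`K` itself) included. -/
def SigmaPts : Type u := {v : ValuationSubring K // ∀ a : F, algebraMap F K a ∈ v}

variable {F K} in
/-- The set `E(R)` of the valuations whose ring contains `R`. -/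
def basicSet (R : Subalgebra F K) : Set (SigmaPts F K) := {v | ∀ x ∈ R, x ∈ v.1}

/-- The topology generated by the sets `E(R)`, for `R` a finitely generated subalgebra. -/
instance : TopologicalSpace (SigmaPts F K) :=
  TopologicalSpace.generateFrom {U | ∃ R : Subalgebra F K, R.FG ∧ U = basicSet R}

/-- The generic point: the trivial valuation. -/
def genPt : SigmaPts F K := ⟨⊤, fun _ => trivial⟩

variable {F K}

theorem isOpen_basicSet {R : Subalgebra F K} (hR : R.FG) : IsOpen (basicSet R) :=
  TopologicalSpace.isOpen_generateFrom_of_mem ⟨R, hR, rfl⟩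

theorem genPt_mem {U : Set (SigmaPts F K)} (hU : IsOpen U) {v : SigmaPts F K} (hv : v ∈ U) :
    genPt F K ∈ U := by
  induction hU with
  | basic s hs =>
    obtain ⟨R, _, rfl⟩ := hs
    exact fun _ _ => trivial
  | univ => trivial
  | inter s t _ _ hs ht => exact ⟨hs hv.1, ht hv.2⟩
  | sUnion S _ ih =>
    obtain ⟨s, hs, hvs⟩ := hv
    exact ⟨s, hs, ih s hs hvs⟩

variable (F K)

/-- The underlying topological space of the Riemann variety. -/
def sigmaTop : TopCat.{u} := TopCat.of (SigmaPts F K)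

/-- The sections over `U`: the elements of `⋂ v ∈ U, O_v`, written as the constant functions
`U → K` whose value at each `v` lies in `O_v` (so there is only the zero section over `∅`). -/
def sigmaPred : TopCat.LocalPredicate (X := sigmaTop F K) (fun _ => K) where
  pred {U} f := (∀ x y : U, f x = f y) ∧ ∀ x : U, f x ∈ x.1.1
  res i _ h := ⟨fun x y => h.1 (i x) (i y), fun x => h.2 (i x)⟩
  locality {U} f h := by
    refine ⟨fun x y => ?_, fun x => ?_⟩
    · have key : ∀ x : U, f x = f ⟨genPt F K, genPt_mem U.2 x.2⟩ := by
        intro x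
        obtain ⟨V, hxV, i, hV⟩ := h x
        exact hV.1 ⟨x.1, hxV⟩ ⟨genPt F K, genPt_mem V.2 hxV⟩
      rw [key x, key y]
    · obtain ⟨V, hxV, i, hV⟩ := h x
      exact hV.2 ⟨x.1, hxV⟩

/-- The ring of sections over `U`. -/
def sigmaSections (U : Opens (sigmaTop F K)) : Subring (U → K) where
  carrier := {f | (sigmaPred F K).pred f}
  mul_mem' ha hb :=
    ⟨fun x y => congrArg₂ (· * ·) (ha.1 x y) (hb.1 x y), fun x => mul_mem (ha.2 x) (hb.2 x)⟩
  one_mem' := ⟨fun _ _ => rfl, fun x => one_mem x.1.1⟩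
  add_mem' ha hb :=
    ⟨fun x y => congrArg₂ (· + ·) (ha.1 x y) (hb.1 x y), fun x => add_mem (ha.2 x) (hb.2 x)⟩
  zero_mem' := ⟨fun _ _ => rfl, fun x => zero_mem x.1.1⟩
  neg_mem' ha := ⟨fun x y => congrArg (- ·) (ha.1 x y), fun x => neg_mem (ha.2 x)⟩

/-- The structure presheaf of the Riemann variety. -/
def sigmaPresheaf : TopCat.Presheaf CommRingCat.{u} (sigmaTop F K) where
  obj U := CommRingCat.of (sigmaSections F K U.unop)
  map i := CommRingCat.ofHom
    { toFun := fun s => ⟨fun x => s.1 (i.unop x), (sigmaPred F K).res i.unop s.1 s.2⟩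
      map_one' := rfl
      map_mul' := fun _ _ => rfl
      map_zero' := rfl
      map_add' := fun _ _ => rfl }

theorem sigmaPresheaf_isSheaf : (sigmaPresheaf F K).IsSheaf := by
  refine (TopCat.Presheaf.isSheaf_iff_isSheaf_comp (forget CommRingCat) _).mpr ?_
  refine TopCat.Presheaf.isSheaf_of_iso ?_
    (TopCat.subpresheafToTypes.isSheaf (sigmaPred F K))
  exact NatIso.ofComponents (fun _ => Iso.refl _) (fun _ => rfl)

/-- The Riemann variety as a sheafed space. -/
def sigmaSheafed : SheafedSpace CommRingCat.{u} where
  carrier := sigmaTop F K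
  presheaf := sigmaPresheaf F K
  IsSheaf := sigmaPresheaf_isSheaf F K

variable {F K}

/-- The evaluation of sections at a point `v`, with values in `O_v`. -/
def sectionEval (U : Opens (sigmaTop F K)) (v : sigmaTop F K) (hv : v ∈ U) :
    (sigmaPresheaf F K).obj (op U) ⟶ CommRingCat.of v.1 :=
  CommRingCat.ofHom
    { toFun := fun s => ⟨s.1 ⟨v, hv⟩, s.2.2 ⟨v, hv⟩⟩
      map_one' := rfl
      map_mul' := fun _ _ => rfl
      map_zero' := rfl
      map_add' := fun _ _ => rfl }

/-- The evaluation of germs at a point `v`, with values in `O_v`. -/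
def stalkEval (v : sigmaTop F K) :
    (sigmaPresheaf F K).stalk v ⟶ CommRingCat.of v.1 :=
  Limits.colimit.desc ((OpenNhds.inclusion v).op ⋙ sigmaPresheaf F K)
    { pt := CommRingCat.of v.1
      ι := { app := fun U => sectionEval U.unop.1 v U.unop.2, naturality := fun _ _ _ => rfl } }

theorem germ_stalkEval (U : Opens (sigmaTop F K)) (v : sigmaTop F K) (hv : v ∈ U) :
    (sigmaPresheaf F K).germ U v hv ≫ stalkEval v = sectionEval U v hv :=
  Limits.colimit.ι_desc (F := (OpenNhds.inclusion v).op ⋙ sigmaPresheaf F K) _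
    (op (⟨U, hv⟩ : OpenNhds v))

theorem stalkEval_germ_apply (U : Opens (sigmaTop F K)) (v : sigmaTop F K) (hv : v ∈ U)
    (s : (sigmaPresheaf F K).obj (op U)) :
    (stalkEval v ((sigmaPresheaf F K).germ U v hv s) : K) = s.1 ⟨v, hv⟩ :=
  congrArg Subtype.val (ConcreteCategory.congr_hom (germ_stalkEval U v hv) s)

/-- The open set of the valuations whose ring contains a given element. -/
def openOfElem (x : K) : Opens (sigmaTop F K) where
  carrier := {v | x ∈ v.1}
  is_open' := by
    have : {v : SigmaPts F K | x ∈ v.1} = basicSet (Algebra.adjoin F {x}) := by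
      ext v
      refine ⟨fun hv y hy => ?_, fun hv => hv x (Algebra.self_mem_adjoin_singleton F x)⟩
      induction hy using Algebra.adjoin_induction with
      | mem z hz => rw [Set.mem_singleton_iff.mp hz]; exact hv
      | algebraMap r => exact v.2 r
      | add a b _ _ ha hb => exact add_mem ha hb
      | mul a b _ _ ha hb => exact mul_mem ha hb
    change IsOpen {v : SigmaPts F K | x ∈ v.1}
    rw [this]
    exact isOpen_basicSet ⟨{x}, by simp⟩

instance isLocalHom_stalkEval (v : sigmaTop F K) : IsLocalHom (stalkEval v).hom where
  map_nonunit t ht := by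
    obtain ⟨U, hv, s, rfl⟩ := (sigmaPresheaf F K).exists_germ_eq t
    obtain ⟨y, hy⟩ := ht.exists_right_inv
    have hxy : s.1 ⟨v, hv⟩ * (y : K) = 1 := by
      rw [← stalkEval_germ_apply U v hv s]
      exact congrArg Subtype.val hy
    let W : Opens (sigmaTop F K) := U ⊓ openOfElem (y : K)
    have hvW : v ∈ W := ⟨hv, y.2⟩
    let r : (sigmaPresheaf F K).obj (op W) := ⟨fun _ => y, fun _ _ => rfl, fun w => w.2.2⟩
    have h1 : (sigmaPresheaf F K).map (homOfLE inf_le_left : W ⟶ U).op s * r = 1 :=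
      Subtype.ext (funext fun w => by
        change s.1 ⟨w.1, w.2.1⟩ * (y : K) = 1
        rw [s.2.1 ⟨w.1, w.2.1⟩ ⟨v, hv⟩, hxy])
    have h2 := congrArg ((sigmaPresheaf F K).germ W v hvW) h1
    rw [map_mul, map_one, TopCat.Presheaf.germ_res_apply] at h2
    exact IsUnit.of_mul_eq_one _ h2

variable (F K)

/-- The Riemann variety as a locally ringed space. -/
def sigmaLRS : LocallyRingedSpace.{u} where
  toSheafedSpace := sigmaSheafed F K
  isLocalRing v :=
    @RingHom.domain_isLocalRing _ _ _ _ _ (stalkEval (F := F) (K := K) v).hom (isLocalHom_stalkEval v)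

/-- The constants `F → Γ(Σ_K, O)`. -/
def sigmaConst : CommRingCat.of F ⟶ LocallyRingedSpace.Γ.obj (op (sigmaLRS F K)) :=
  CommRingCat.ofHom (S := (sigmaPresheaf F K).obj (op ⊤))
    { toFun := fun a => ⟨fun _ => algebraMap F K a, fun _ _ => rfl, fun w => w.1.2 a⟩
      map_one' := Subtype.ext (funext fun _ => map_one _)
      map_mul' := fun _ _ => Subtype.ext (funext fun _ => map_mul _ _ _)
      map_zero' := Subtype.ext (funext fun _ => map_zero _)
      map_add' := fun _ _ => Subtype.ext (funext fun _ => map_add _ _ _) }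

/-- The Riemann variety over `F`: the structure morphism is the one given by the constants. -/
def sigmaOver : Over (Spec (CommRingCat.of F)).toLocallyRingedSpace :=
  Over.mk ((sigmaLRS F K).toΓSpec ≫ Spec.locallyRingedSpaceMap (sigmaConst F K))

end Sigma

/-! ### Functoriality of the Riemann variety for places -/

section Pullback

variable (F : Type u) [Field F]

/-- An `F`-place from `K` to `L`: a place which is the identity on `F`. -/
@[ext]
structure FPlace (K L : Type u) [Field K] [Field L] [Algebra F K] [Algebra F L]
    extends Place K L where
  map_algebraMap' : ∀ a : F,
    toFun ((algebraMap F K a : K) : OnePoint K) = ((algebraMap F L a : L) : OnePoint L)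

variable {F} {K L M : Type u} [Field K] [Field L] [Field M] [Algebra F K] [Algebra F L] [Algebra F M]

namespace FPlace

/-- The identity `F`-place. -/
protected def id (K : Type u) [Field K] [Algebra F K] : FPlace F K K where
  toPlace := Place.id K
  map_algebraMap' _ := rfl

/-- The composite of two `F`-places. -/
protected def comp (g : FPlace F L M) (f : FPlace F K L) : FPlace F K M where
  toPlace := g.toPlace.comp f.toPlace
  map_algebraMap' a := by
    change g.toPlace (f.toPlace _) = _
    rw [f.map_algebraMap' a, g.map_algebraMap' a]

/-- The value of a place at an element where it is finite. -/
def value (f : FPlace F K L) (x : K) (hx : x ∈ f.toPlace.comap ⊤) : L := hx.choose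

theorem value_spec (f : FPlace F K L) (x : K) (hx : x ∈ f.toPlace.comap ⊤) :
    f.toPlace (x : OnePoint K) = (f.value x hx : OnePoint L) := hx.choose_spec.2

theorem value_eq (f : FPlace F K L) (x : K) (hx : x ∈ f.toPlace.comap ⊤) {a : L}
    (h : f.toPlace (x : OnePoint K) = (a : OnePoint L)) : f.value x hx = a :=
  OnePoint.coe_injective ((f.value_spec x hx).symm.trans h)

theorem comap_le_top (f : FPlace F K L) (w : ValuationSubring L) {x : K}
    (hx : x ∈ f.toPlace.comap w) : x ∈ f.toPlace.comap ⊤ := by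
  obtain ⟨a, _, ha⟩ := hx
  exact ⟨a, trivial, ha⟩

theorem value_mem (f : FPlace F K L) (w : ValuationSubring L) {x : K}
    (hx : x ∈ f.toPlace.comap w) : f.value x (f.comap_le_top w hx) ∈ w := by
  have h := hx
  obtain ⟨a, ha, hxa⟩ := h
  rw [f.value_eq x _ hxa]
  exact ha

/-- The map `Σ_L → Σ_K` on points induced by an `F`-place `K ⇝ L`. -/
def pullPt (f : FPlace F K L) (w : SigmaPts F L) : SigmaPts F K :=
  ⟨f.toPlace.comap w.1, fun a => ⟨algebraMap F L a, w.2 a, f.map_algebraMap' a⟩⟩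

theorem continuous_pullPt (f : FPlace F K L) : Continuous f.pullPt := by
  refine continuous_generateFrom_iff.mpr ?_
  rintro _ ⟨R, ⟨t, rfl⟩, rfl⟩
  have : f.pullPt ⁻¹' basicSet (Algebra.adjoin F (t : Set K)) =
      ⋂ x ∈ t, {w : SigmaPts F L | x ∈ (f.pullPt w).1} := by
    ext w
    simp only [Set.mem_preimage, Set.mem_iInter]
    refine ⟨fun h x hx => h x (Algebra.subset_adjoin hx), fun h x hx => ?_⟩
    induction hx using Algebra.adjoin_induction with
    | mem z hz => exact h z hz
    | algebraMap r => exact (f.pullPt w).2 r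
    | add a b _ _ ha hb => exact add_mem ha hb
    | mul a b _ _ ha hb => exact mul_mem ha hb
  rw [this]
  refine isOpen_biInter_finset fun x _ => ?_
  rcases h : f.toPlace (x : OnePoint K) with _ | a
  · have : {w : SigmaPts F L | x ∈ (f.pullPt w).1} = ∅ := by
      ext w
      refine ⟨?_, fun h => h.elim⟩
      rintro ⟨a, _, ha⟩
      rw [h] at ha
      exact OnePoint.infty_ne_coe _ ha
    rw [this]
    exact isOpen_empty
  · have : {w : SigmaPts F L | x ∈ (f.pullPt w).1} = {w : SigmaPts F L | a ∈ w.1} := by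
      ext w
      refine ⟨?_, fun hw => ⟨a, hw, h⟩⟩
      rintro ⟨b, hb, hxb⟩
      have : a = b := OnePoint.coe_injective (h.symm.trans hxb)
      rw [this]
      exact hb
    rw [this]
    exact (openOfElem (F := F) a).2

/-- The continuous map underlying `λ^*`. -/
def pullBase (f : FPlace F K L) : sigmaTop F L ⟶ sigmaTop F K :=
  TopCat.ofHom ⟨f.pullPt, f.continuous_pullPt⟩

/-- The pull-back of sections: it sends the constant function `x ∈ K` to `λ(x) ∈ L`. -/
def pullSection (f : FPlace F K L) (U : Opens (sigmaTop F K)) :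
    sigmaSections F K U →+* sigmaSections F L ((Opens.map f.pullBase).obj U) where
  toFun s :=
    ⟨fun w => f.value (s.1 ⟨f.pullPt w.1, w.2⟩)
        (f.comap_le_top w.1.1 (s.2.2 ⟨f.pullPt w.1, w.2⟩)),
      fun w w' => f.value_eq _ _ (by
        rw [s.2.1 ⟨f.pullPt w.1, w.2⟩ ⟨f.pullPt w'.1, w'.2⟩]
        exact f.value_spec _ _),
      fun w => f.value_mem w.1.1 (s.2.2 ⟨f.pullPt w.1, w.2⟩)⟩
  map_one' := Subtype.ext (funext fun w => f.value_eq _ _ f.map_one)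
  map_mul' s t := Subtype.ext (funext fun w =>
    f.value_eq _ _ (f.map_mul_of (f.value_spec _ _) (f.value_spec _ _)))
  map_zero' := Subtype.ext (funext fun w => f.value_eq _ _ f.map_zero)
  map_add' s t := Subtype.ext (funext fun w =>
    f.value_eq _ _ (f.map_add_of (f.value_spec _ _) (f.value_spec _ _)))

/-- `λ^*` as a morphism of presheafed spaces. -/
def pullPresheafed (f : FPlace F K L) :
    (sigmaSheafed F L).toPresheafedSpace.Hom (sigmaSheafed F K).toPresheafedSpace where
  base := f.pullBase
  c :=
    { app := fun U => CommRingCat.ofHom (f.pullSection U.unop)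
      naturality := fun _ _ _ => CommRingCat.hom_ext (RingHom.ext fun _ => rfl) }

theorem stalkMap_pull (f : FPlace F K L) (w : sigmaTop F L)
    (t : ((sigmaPresheaf F K).stalk (f.pullPt w : sigmaTop F K) : CommRingCat.{u})) :
    f.toPlace ((stalkEval (F := F) (K := K) (f.pullPt w : sigmaTop F K) t : K) : OnePoint K) =
      ((stalkEval w (PresheafedSpace.Hom.stalkMap f.pullPresheafed w t) : L) : OnePoint L) := by
  obtain ⟨U, hU, s, rfl⟩ := (sigmaPresheaf F K).exists_germ_eq t
  have h : PresheafedSpace.Hom.stalkMap f.pullPresheafed w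
        ((sigmaPresheaf F K).germ U (f.pullPt w : sigmaTop F K) hU s) =
      (sigmaPresheaf F L).germ ((Opens.map f.pullBase).obj U) w hU (f.pullSection U s) :=
    ConcreteCategory.congr_hom (PresheafedSpace.stalkMap_germ f.pullPresheafed U w hU) s
  have h1 : (stalkEval w (PresheafedSpace.Hom.stalkMap f.pullPresheafed w
        ((sigmaPresheaf F K).germ U (f.pullPt w : sigmaTop F K) hU s)) : L) =
      (f.pullSection U s).1 ⟨w, hU⟩ :=
    (congrArg (fun z => (stalkEval w z : L)) h).trans
      (stalkEval_germ_apply ((Opens.map f.pullBase).obj U) w hU (f.pullSection U s))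
  refine Eq.trans ?_ (congrArg OnePoint.some h1).symm
  refine (congrArg (fun z : K => f.toPlace (z : OnePoint K))
    (stalkEval_germ_apply U (f.pullPt w : sigmaTop F K) hU s)).trans ?_
  exact f.value_spec _ _

/-- `λ^*` as a morphism of locally ringed spaces. -/
def pullLRS (f : FPlace F K L) : sigmaLRS F L ⟶ sigmaLRS F K where
  toHom := f.pullPresheafed
  prop w :=
    { map_nonunit := fun t ht => by
        have ht' : IsUnit (stalkEval (F := F) (K := L) w
            (PresheafedSpace.Hom.stalkMap f.pullPresheafed w t)) :=
          ht.map (stalkEval (F := F) (K := L) w).hom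
        refine (isLocalHom_stalkEval (F := F) (K := K) (f.pullPt w)).map_nonunit t ?_
        obtain ⟨y, hy⟩ := ht'.exists_right_inv
        have hy' := congrArg Subtype.val hy
        have h0 := f.stalkMap_pull w t
        have hne : (stalkEval (F := F) (K := L) w
            (PresheafedSpace.Hom.stalkMap f.pullPresheafed w t) : L) ≠ 0 :=
          left_ne_zero_of_mul_eq_one hy'
        have hinv := f.map_inv_of_ne h0 hne
        rw [← eq_inv_of_mul_eq_one_right hy'] at hinv
        have hK : ((stalkEval (F := F) (K := K) (f.pullPt w : sigmaTop F K) t : K)) ≠ 0 := by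
          intro hz
          rw [hz, f.map_zero] at h0
          exact hne (OnePoint.coe_injective h0).symm
        exact IsUnit.of_mul_eq_one (⟨_, ⟨_, y.2, hinv⟩⟩ : (f.pullPt w).1)
          (Subtype.ext (mul_inv_cancel₀ hK)) }

theorem sigmaConst_pull (f : FPlace F K L) :
    sigmaConst F K ≫ LocallyRingedSpace.Γ.map f.pullLRS.op = sigmaConst F L :=
  CommRingCat.hom_ext (RingHom.ext fun a => Subtype.ext (funext fun _ =>
    f.value_eq _ _ (f.map_algebraMap' a)))

end FPlace

/-- A morphism of locally ringed spaces compatible with two given homomorphisms from `F` to the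
rings of global sections is compatible with the corresponding morphisms to `Spec F`. -/
theorem comp_toΓSpec {R : CommRingCat.{u}} {X Y : LocallyRingedSpace.{u}} (g : X ⟶ Y)
    (a : R ⟶ LocallyRingedSpace.Γ.obj (op X)) (b : R ⟶ LocallyRingedSpace.Γ.obj (op Y))
    (h : b ≫ LocallyRingedSpace.Γ.map g.op = a) :
    g ≫ Y.toΓSpec ≫ Spec.locallyRingedSpaceMap b = X.toΓSpec ≫ Spec.locallyRingedSpaceMap a := by
  have hn : g ≫ Y.toΓSpec = X.toΓSpec ≫ Spec.locallyRingedSpaceMap (LocallyRingedSpace.Γ.map g.op) :=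
    identityToΓSpec.naturality g
  rw [← Category.assoc, hn, Category.assoc, ← Spec.locallyRingedSpaceMap_comp, h]

/-- Morphisms of Riemann varieties are equal when they agree on points and on sections. -/
theorem sigmaLRS_hom_ext (g g' : sigmaLRS F L ⟶ sigmaLRS F K)
    (hb : ∀ w : sigmaTop F L, g.toHom.base w = g'.toHom.base w)
    (hc : ∀ (U : Opens (sigmaTop F K)) (s : sigmaSections F K U) (w : sigmaTop F L)
      (h : g.toHom.base w ∈ U) (h' : g'.toHom.base w ∈ U),
      (show sigmaSections F L ((Opens.map g.toHom.base).obj U) from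
        g.toHom.c.app (op U) s).1 ⟨w, h⟩ =
      (show sigmaSections F L ((Opens.map g'.toHom.base).obj U) from
        g'.toHom.c.app (op U) s).1 ⟨w, h'⟩) : g = g' := by
  obtain ⟨⟨b, c⟩, p⟩ := g
  obtain ⟨⟨b', c'⟩, p'⟩ := g'
  obtain rfl : b = b' := TopCat.hom_ext (ContinuousMap.ext hb)
  obtain rfl : c = c' := by
    refine NatTrans.ext (funext fun U => CommRingCat.hom_ext (RingHom.ext fun s => ?_))
    exact Subtype.ext (funext fun w => hc U.unop s w.1 w.2 w.2)
  rfl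

theorem FPlace.pullLRS_id : (FPlace.id (F := F) K).pullLRS = 𝟙 _ := by
  refine sigmaLRS_hom_ext _ _ (fun w => ?_) (fun U s w h h' => ?_)
  · refine Subtype.ext (SetLike.ext fun x => ?_)
    exact ⟨fun ⟨y, hy, hxy⟩ => by rw [OnePoint.coe_injective hxy]; exact hy,
      fun hx => ⟨x, hx, rfl⟩⟩
  · refine FPlace.value_eq _ _ _ ?_
    exact congrArg OnePoint.some (s.2.1 _ _)

theorem FPlace.pullLRS_comp (g : FPlace F L M) (f : FPlace F K L) :
    (g.comp f).pullLRS = g.pullLRS ≫ f.pullLRS := by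
  refine sigmaLRS_hom_ext _ _ (fun w => ?_) (fun U s w h h' => ?_)
  · refine Subtype.ext (SetLike.ext fun x => ?_)
    constructor
    · rintro ⟨z, hz, hxz⟩
      rcases hx : f.toPlace (x : OnePoint K) with _ | y
      · exfalso
        change g.toPlace (f.toPlace _) = _ at hxz
        exact OnePoint.infty_ne_coe _
          (g.map_infty.symm.trans ((congrArg g.toPlace hx).symm.trans hxz))
      · refine ⟨y, ⟨z, hz, ?_⟩, hx⟩
        change g.toPlace (f.toPlace _) = _ at hxz
        rw [hx] at hxz
        exact hxz
    · rintro ⟨y, ⟨z, hz, hyz⟩, hxy⟩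
      refine ⟨z, hz, ?_⟩
      change g.toPlace (f.toPlace _) = _
      rw [hxy, hyz]
  · refine FPlace.value_eq _ _ _ ?_
    change g.toPlace (f.toPlace _) = _
    have e : s.1 ⟨(g.comp f).pullPt w, h⟩ = s.1 ⟨f.pullPt (g.pullPt w), h'⟩ := s.2.1 _ _
    rw [e, f.value_spec _ (f.comap_le_top _ (s.2.2 ⟨f.pullPt (g.pullPt w), h'⟩))]
    exact g.value_spec _ _

/-- `λ^* : Σ_L → Σ_K` as an `F`-morphism. -/
def FPlace.pull (f : FPlace F K L) : sigmaOver F L ⟶ sigmaOver F K :=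
  Over.homMk f.pullLRS (comp_toΓSpec _ _ _ f.sigmaConst_pull)

end Pullback

/-! ### The generic point as a morphism -/

section Generic

variable (F L : Type u) [Field F] [Field L] [Algebra F L]

open Classical in
/-- The value of a section at the generic point (zero on the empty open set). -/
def genValue {U : Opens (sigmaTop F L)} (s : sigmaSections F L U) : L :=
  if h : genPt F L ∈ U then s.1 ⟨genPt F L, h⟩ else 0

variable {F L} in
theorem genValue_eq {U : Opens (sigmaTop F L)} (h : genPt F L ∈ U) (s : sigmaSections F L U) :
    genValue F L s = s.1 ⟨genPt F L, h⟩ := dif_pos h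

/-- The constant map from the underlying space of `Spec L` to the generic point of `Σ_L`. -/
def genBase : (Spec.locallyRingedSpaceObj (CommRingCat.of L)).toTopCat ⟶ sigmaTop F L :=
  TopCat.ofHom ⟨fun _ => genPt F L, continuous_const⟩

theorem subsingleton_of_notMem {U : Opens (sigmaTop F L)} (h : genPt F L ∉ U) :
    Subsingleton ((structureSheafInType L L).obj.obj (op ((Opens.map (genBase F L)).obj U))) :=
  ⟨fun _ _ => Subtype.ext (funext fun p => absurd p.2 h)⟩

/-- On sections, `η_L` is the value at the generic point. -/
def genSection (U : Opens (sigmaTop F L)) :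
    sigmaSections F L U →+*
      (structureSheafInType L L).obj.obj (op ((Opens.map (genBase F L)).obj U)) where
  toFun s := algebraMap L _ (genValue F L s)
  map_one' := by
    by_cases h : genPt F L ∈ U
    · rw [genValue_eq h]; exact map_one _
    · exact @Subsingleton.elim _ (subsingleton_of_notMem F L h) _ _
  map_mul' s t := by
    by_cases h : genPt F L ∈ U
    · simp only [genValue_eq h]; exact map_mul _ _ _
    · exact @Subsingleton.elim _ (subsingleton_of_notMem F L h) _ _
  map_zero' := by
    by_cases h : genPt F L ∈ U
    · rw [genValue_eq h]; exact map_zero _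
    · exact @Subsingleton.elim _ (subsingleton_of_notMem F L h) _ _
  map_add' s t := by
    by_cases h : genPt F L ∈ U
    · simp only [genValue_eq h]; exact map_add _ _ _
    · exact @Subsingleton.elim _ (subsingleton_of_notMem F L h) _ _

/-- `η_L` as a morphism of presheafed spaces. -/
def genPresheafed : (Spec.locallyRingedSpaceObj (CommRingCat.of L)).toPresheafedSpace.Hom
    (sigmaSheafed F L).toPresheafedSpace where
  base := genBase F L
  c :=
    { app := fun U => show CommRingCat.of (sigmaSections F L U.unop) ⟶ CommRingCat.of
          ((structureSheafInType L L).obj.obj (op ((Opens.map (genBase F L)).obj U.unop))) from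
        CommRingCat.ofHom (genSection F L U.unop)
      naturality := fun U V i => CommRingCat.hom_ext (RingHom.ext fun s => by
        by_cases h : genPt F L ∈ V.unop
        · have e : genValue F L (U := V.unop) ((sigmaPresheaf F L).map i s) =
              genValue F L (U := U.unop) s :=
            (genValue_eq (U := V.unop) h _).trans
              (genValue_eq (U := U.unop) (i.unop.le h) s).symm
          exact congrArg (algebraMap L ((structureSheafInType L L).obj.obj
            (op ((Opens.map (genBase F L)).obj V.unop)))) e
        · exact @Subsingleton.elim _ (subsingleton_of_notMem F L h) _ _) }

/-- The morphism `η_L : Spec L ⟶ Σ_L` of locally ringed spaces whose image is the trivial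
valuation, given by the identity of `L` on stalks. -/
def genLRS : Spec.locallyRingedSpaceObj (CommRingCat.of L) ⟶ sigmaLRS F L where
  toHom := genPresheafed F L
  prop p :=
    { map_nonunit := fun t ht => by
        obtain ⟨U, hU, s, rfl⟩ := (sigmaPresheaf F L).exists_germ_eq
          (x := (genPt F L : sigmaTop F L)) t
        have hU' : genPt F L ∈ U := hU
        have h := ConcreteCategory.congr_hom
          (PresheafedSpace.stalkMap_germ (genPresheafed F L) U p hU) s
        refine (isLocalHom_stalkEval (F := F) (K := L) (genPt F L)).map_nonunit _ ?_
        by_cases h0 : s.1 ⟨genPt F L, hU'⟩ = 0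
        · exfalso
          have hz : genSection F L U s = 0 := by
            refine (congrArg (algebraMap L ((structureSheafInType L L).obj.obj
              (op ((Opens.map (genBase F L)).obj U)))) ((genValue_eq hU' s).trans h0)).trans ?_
            exact map_zero _
          have h1 := h.trans ((congrArg ((Spec.locallyRingedSpaceObj
            (CommRingCat.of L)).presheaf.germ ((Opens.map (genBase F L)).obj U) p hU) hz).trans
              (map_zero _))
          exact not_isUnit_zero (h1 ▸ ht)
        · refine IsUnit.of_mul_eq_one
            (⟨(s.1 ⟨genPt F L, hU'⟩)⁻¹, trivial⟩ : (genPt F L).1) (Subtype.ext ?_)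
          refine Eq.trans ?_ (mul_inv_cancel₀ h0)
          exact congrArg (· * (s.1 ⟨genPt F L, hU'⟩)⁻¹)
            (stalkEval_germ_apply U (genPt F L : sigmaTop F L) hU s) }

/-- `η_L : Spec L ⟶ Σ_L` as an `F`-morphism. -/
def genOver : Over.mk (Spec.locallyRingedSpaceMap (CommRingCat.ofHom (algebraMap F L))) ⟶
    sigmaOver F L :=
  Over.homMk (genLRS F L) (by
    have h : sigmaConst F L ≫ LocallyRingedSpace.Γ.map (genLRS F L).op =
        CommRingCat.ofHom (algebraMap F L) ≫ toSpecΓ (CommRingCat.of L) :=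
      CommRingCat.hom_ext (RingHom.ext fun a => congrArg (algebraMap L
        ((structureSheafInType L L).obj.obj (op ((Opens.map (genBase F L)).obj ⊤))))
        (genValue_eq (U := ⊤) trivial
          (show sigmaSections F L ⊤ from sigmaConst F L a)))
    refine (comp_toΓSpec (genLRS F L) _ _ h).trans ?_
    refine (congrArg ((Spec.locallyRingedSpaceObj (CommRingCat.of L)).toΓSpec ≫ ·)
      (Spec.locallyRingedSpaceMap_comp (CommRingCat.ofHom (algebraMap F L))
        (toSpecΓ (CommRingCat.of L)))).trans ?_
    refine (Category.assoc _ _ _).symm.trans ?_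
    exact (congrArg (· ≫ Spec.locallyRingedSpaceMap (CommRingCat.ofHom (algebraMap F L)))
      (ΓSpec.right_triangle (CommRingCat.of L))).trans (Category.id_comp _))

end Generic

/-! ### The categories of function fields -/

section Categories

variable (F : Type u) [Field F]

/-- A finitely generated field extension of `F`. -/
structure FunctionField where
  carrier : Type u
  [field : Field carrier]
  [algebra : Algebra F carrier]
  fg : (⊤ : IntermediateField F carrier).FG

attribute [instance] FunctionField.field FunctionField.algebra

instance : CoeSort (FunctionField F) (Type u) := ⟨FunctionField.carrier⟩

/-- The objects of the category `field(F)`: the finitely generated extensions of `F`. -/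
structure FieldCat where
  /-- The underlying finitely generated extension of `F`. -/
  ext : FunctionField F

/-- The objects of the category `place(F)`: the finitely generated extensions of `F`. -/
structure PlaceCat where
  /-- The underlying finitely generated extension of `F`. -/
  ext : FunctionField F

/-- The morphisms of `field(F)` are the homomorphisms of extensions of `F`. -/
instance : Category (FieldCat F) where
  Hom K L := K.ext →ₐ[F] L.ext
  id K := AlgHom.id F K.ext
  comp f g := g.comp f

/-- The morphisms of `place(F)` are the `F`-places. -/
instance : Category (PlaceCat F) where
  Hom K L := FPlace F K.ext L.ext
  id K := FPlace.id K.ext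
  comp f g := g.comp f

/-- The functor `K ↦ Spec K`, with values in the locally ringed spaces over `F`. -/
def specFunctor : (FieldCat F)ᵒᵖ ⥤ Over (Spec (CommRingCat.of F)).toLocallyRingedSpace where
  obj K := Over.mk (Spec.locallyRingedSpaceMap (CommRingCat.ofHom (algebraMap F K.unop.ext)))
  map {K L} f :=
    let φ : L.unop.ext →ₐ[F] K.unop.ext := f.unop
    Over.homMk (Spec.locallyRingedSpaceMap (CommRingCat.ofHom φ.toRingHom)) (by
      refine (Spec.locallyRingedSpaceMap_comp _ _).symm.trans ?_
      exact congrArg Spec.locallyRingedSpaceMap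
        (CommRingCat.hom_ext (RingHom.ext fun a => φ.commutes a)))
  map_id K := Over.OverMorphism.ext (Spec.locallyRingedSpaceMap_id _)
  map_comp {K L M} f g :=
    let φ : L.unop.ext →ₐ[F] K.unop.ext := f.unop
    let ψ : M.unop.ext →ₐ[F] L.unop.ext := g.unop
    Over.OverMorphism.ext (Spec.locallyRingedSpaceMap_comp (CommRingCat.ofHom ψ.toRingHom)
      (CommRingCat.ofHom φ.toRingHom))

/-- The functor `K ↦ Σ_K`, with values in the locally ringed spaces over `F`. -/
def sigmaFunctor : (PlaceCat F)ᵒᵖ ⥤ Over (Spec (CommRingCat.of F)).toLocallyRingedSpace where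
  obj K := sigmaOver F K.unop.ext
  map f := FPlace.pull f.unop
  map_id _ := Over.OverMorphism.ext FPlace.pullLRS_id
  map_comp f g := Over.OverMorphism.ext (FPlace.pullLRS_comp f.unop g.unop)

/-- The generic point `η_K : Spec K ⟶ Σ_K`, between the values at `K` of the two functors. -/
def eta (K : FunctionField F) :
    (specFunctor F).obj (op ⟨K⟩) ⟶ (sigmaFunctor F).obj (op ⟨K⟩) :=
  genOver F K

end Categories

/-! ### Varieties and their inverse limits -/

section Varieties

variable (F : Type u) [Field F]

/-- The `F`-varieties: the integral separated `F`-schemes of finite type. -/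
def isVariety : ObjectProperty (Over (Spec (CommRingCat.of F))) := fun X =>
  IsIntegral X.left ∧ IsSeparated X.hom ∧ LocallyOfFiniteType X.hom ∧ QuasiCompact X.hom

/-- The category of `F`-varieties and `F`-morphisms. -/
abbrev Var := (isVariety F).FullSubcategory

instance (X : Var F) : IsIntegral X.obj.left := X.property.1

/-- A birational morphism of varieties: a dominant morphism which induces an isomorphism of
function fields. -/
def IsBirationalHom {F : Type u} [Field F] {X Y : Var F} (f : X ⟶ Y) : Prop :=
  IsDominant f.hom.left ∧ IsIso (f.hom.left.stalkMap (genericPoint X.obj.left))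

/-- A variety viewed as a locally ringed space over `F`. -/
def varToLRS : Var F ⥤ Over (Spec (CommRingCat.of F)).toLocallyRingedSpace :=
  (isVariety F).ι ⋙ Over.post Scheme.forgetToLocallyRingedSpace

/-- The property of being a limit, in the category of locally ringed spaces over `F`, of a
cofiltered system of varieties whose transition morphisms are birational. -/
def isProVariety : ObjectProperty (Over (Spec (CommRingCat.of F)).toLocallyRingedSpace) := fun X =>
  ∃ (J : Type u) (_ : SmallCategory J) (_ : IsCofiltered J) (D : J ⥤ Var F)
    (c : Limits.Cone (D ⋙ varToLRS F)),
    (∀ ⦃i j : J⦄ (f : i ⟶ j), IsBirationalHom (D.map f)) ∧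
      Nonempty (Limits.IsLimit c) ∧ Nonempty (c.pt ≅ X)

/-- The category of cofiltered inverse limits of varieties along birational morphisms, as a full
subcategory of the locally ringed spaces over `F`. -/
abbrev VarHat := (isProVariety F).FullSubcategory

end Varieties

end RiemannVariety

end

/-!
All the spaces occurring in the statement (affine schemes, varieties with function field `K`, the
Riemann variety of `K`) are *modelled on a field* `K`: their stalks are local subrings of `K`, a
section is a constant element of `K` lying in the stalks over its domain, the topology is generated
by conditions `x ∈ 𝒪_z`, and a point is determined by its stalk (`FieldModel`). If `Z` is such a
space and `g : Y ⟶ Z` is a morphism, then over each point `y` of `Y` the pull-back of germs is a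
partial map from `K` to the stalk `𝒪_{Y,y}`, whose graph is a subring of `K × 𝒪_{Y,y}`. These
graphs determine `g` (`FieldModel.hom_ext`), and conversely a family of subrings with the evident
local properties is the family of graphs of a morphism (`FieldModel.IsGraph.lift`). This reduces
every construction of morphisms to algebra in `K`. The order on `LocalSubring K` is domination,
and a morphism compatible with the inclusions of stalks into `K` sends `y` to a point whose local
ring is dominated by that of `y`.

*Both functors take values in limits of varieties.* A finite family of finitely generated
subalgebras of `K` with fraction field `K`, such that each local subring of `K` dominates at most
one of the localizations of the members, glues to a variety `AffineCharts.variety`: uniqueness in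
the valuative criterion is the uniqueness of the dominated localization. If `J` is a codirected
set of such families and `Z` is modelled on `K` in such a way that its points are exactly the
unions of the compatible systems of points of the members of `J`, then `Z` is the limit of the
varieties (`IsDominatedLimit.isProVariety`): the graph of the morphism to `Z` defined by a cone
is the union of the graphs of the legs. For `Spec K`, take for `J` all finitely generated
subalgebras with fraction field `K`. For `Σ_K`, take the projective models: a finite set `S` of
nonzero elements of `K` gives the charts `F[S/s]`, for `s ∈ S`. Every valuation ring contains one of
them, products of sets `S` give common refinements, and `S · {1, x}` gives a model each of whose
local rings contains `x` or `x⁻¹`, so that the unions of compatible systems are valuation rings.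

*Full faithfulness.* For `Spec` this is the affine case. A morphism `Spec L ⟶ Σ_K` is determined
by its graph, a subring of `K × L`, and the subrings which occur are exactly the graphs of places
(`IsPlaceGraph.exists_place`); the graph of `λ^* ∘ η_L` is the graph of `λ`. So
`λ ↦ λ^* ∘ η_L` is a bijection from places to `F`-morphisms `Spec L ⟶ Σ_K`
(`genOver_pull_bijective`). A morphism `ψ : Σ_L ⟶ Σ_K` is determined by `ψ ∘ η_L`: if
`ψ ∘ η_L = λ^* ∘ η_L`, then the graph of `ψ` is contained in the graph of `λ^*` at each point `w`,
so the valuation ring `λ^*(w)` dominates the valuation ring `ψ(w)`; since valuation rings are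
maximal for domination, the graphs are equal (`sigma_graph_eq_of_le`). The two remaining
bijectivity statements follow.
-/

noncomputable section

namespace RiemannVariety

/-! ### Local subrings of a field -/

section LocalSubrings

variable {K : Type*} [Field K]

theorem isLocalRing_of_inv_mem (A : Subring K)
    (h : ∀ x ∈ A, x⁻¹ ∈ A ∨ (1 - x)⁻¹ ∈ A) : IsLocalRing A := by
  refine IsLocalRing.of_isUnit_or_isUnit_one_sub_self fun x => ?_
  have key : ∀ y : A, (y : K) ≠ 0 → (y : K)⁻¹ ∈ A → IsUnit y := fun y hy hy' =>
    IsUnit.of_mul_eq_one ⟨_, hy'⟩ (Subtype.ext (mul_inv_cancel₀ hy))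
  by_cases h0 : (x : K) = 0
  · exact Or.inr (by rw [show x = 0 from Subtype.ext h0, sub_zero]; exact isUnit_one)
  by_cases h1 : 1 - (x : K) = 0
  · exact Or.inl (by
      rw [show x = 1 from Subtype.ext (sub_eq_zero.mp h1).symm]; exact isUnit_one)
  exact (h x x.2).imp (key x h0) (key (1 - x) h1)

/-- Domination of local subrings of a field, in terms of elements: a nonunit of `A` stays a nonunit
in `B`. -/
theorem localSubring_le_iff {A B : LocalSubring K} :
    A ≤ B ↔ A.toSubring ≤ B.toSubring ∧ ∀ x ∈ A.toSubring, x⁻¹ ∈ B.toSubring → x⁻¹ ∈ A.toSubring := by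
  constructor
  · rintro ⟨h, hl⟩
    refine ⟨h, fun x hx hx' => ?_⟩
    by_cases h0 : x = 0
    · rw [h0, inv_zero]; exact zero_mem _
    have hu : IsUnit (Subring.inclusion h ⟨x, hx⟩) :=
      IsUnit.of_mul_eq_one ⟨_, hx'⟩ (Subtype.ext (mul_inv_cancel₀ h0))
    obtain ⟨z, hz⟩ := (hl.map_nonunit _ hu).exists_right_inv
    rw [← eq_inv_of_mul_eq_one_right (congrArg Subtype.val hz)]
    exact z.2
  · rintro ⟨h, hl⟩
    refine ⟨h, ⟨fun x hx => ?_⟩⟩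
    obtain ⟨z, hz⟩ := hx.exists_right_inv
    have hz' : (x : K) * (z : K) = 1 := congrArg Subtype.val hz
    refine IsUnit.of_mul_eq_one ⟨(x : K)⁻¹, hl x x.2 ?_⟩
      (Subtype.ext (mul_inv_cancel₀ (left_ne_zero_of_mul_eq_one hz')))
    rw [← eq_inv_of_mul_eq_one_right hz']
    exact z.2

end LocalSubrings

/-! ### Sections with prescribed germs -/

section Gluing

/-- Germs which are locally those of a section are the germs of a unique section. -/
theorem exists_section_of_germs (Y : LocallyRingedSpace.{u}) (V : Opens Y)
    (t : ∀ y ∈ V, (Y.presheaf.stalk y : CommRingCat.{u}))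
    (h : ∀ y (_ : y ∈ V), ∃ (W : Opens Y) (_ : y ∈ W) (hWV : W ≤ V) (σ : Y.presheaf.obj (op W)),
      ∀ z (hz : z ∈ W), Y.presheaf.germ W z hz σ = t z (hWV hz)) :
    ∃ τ : Y.presheaf.obj (op V), ∀ y (hy : y ∈ V), Y.presheaf.germ V y hy τ = t y hy := by
  choose W hW hWV σ hσ using h
  obtain ⟨τ, hτ, -⟩ := TopCat.Sheaf.existsUnique_gluing' Y.sheaf (fun y : V => W y.1 y.2) V
    (fun y => homOfLE (hWV y.1 y.2)) (fun y hy => Opens.mem_iSup.mpr ⟨⟨y, hy⟩, hW y hy⟩)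
    (fun y => σ y.1 y.2) (fun y y' => by
      refine TopCat.Presheaf.section_ext Y.sheaf _ _ _ fun z hz => ?_
      refine (TopCat.Presheaf.germ_res_apply Y.presheaf _ z hz _).trans ?_
      refine Eq.trans ?_ (TopCat.Presheaf.germ_res_apply Y.presheaf _ z hz _).symm
      exact (hσ y.1 y.2 z hz.1).trans (hσ y'.1 y'.2 z hz.2).symm)
  refine ⟨τ, fun y hy => ?_⟩
  rw [← hσ y hy y (hW y hy)]
  refine (TopCat.Presheaf.germ_res_apply Y.presheaf (homOfLE (hWV y hy)) y (hW y hy) τ).symm.trans ?_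
  exact congrArg (Y.presheaf.germ (W y hy) y (hW y hy)) (hτ ⟨y, hy⟩)

end Gluing

/-! ### Spaces modelled on a field, and graphs of morphisms to them -/

/-- A presentation of `Z` as a space of local subrings of the field `K`: the stalks are embedded into
`K` in such a way that each section has one and the same value at all points of its domain, the
sets `{z' | t ⊆ 𝒪_{z'}}`, for `t ⊆ 𝒪_z` finite, form a neighbourhood basis of `z` (that they are
open follows, see `FieldModel.isOpen_mem`), and a point is determined by its stalk. -/
structure FieldModel (K : Type u) [Field K] (Z : LocallyRingedSpace.{u}) where
  /-- The inclusion of a stalk into `K`. -/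
  ev : ∀ z : Z, (Z.presheaf.stalk z : CommRingCat.{u}) →+* K
  ev_injective : ∀ z, Function.Injective (ev z)
  ev_germ : ∀ (U : Opens Z) (s : Z.presheaf.obj (op U)) (z z' : Z) (hz : z ∈ U) (hz' : z' ∈ U),
    ev z (Z.presheaf.germ U z hz s) = ev z' (Z.presheaf.germ U z' hz' s)
  exists_finset : ∀ (U : Opens Z) (z : Z), z ∈ U → ∃ t : Finset K, (∀ x ∈ t, x ∈ (ev z).range) ∧
    ∀ z', (∀ x ∈ t, x ∈ (ev z').range) → z' ∈ U
  separates : ∀ z z', (ev z).range = (ev z').range → z = z'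

namespace FieldModel

variable {K : Type u} [Field K] {X Y Z : LocallyRingedSpace.{u}} (M : FieldModel K Z)

/-- The stalk at a point, as a local subring of `K`. -/
def pt (z : Z) : LocalSubring K := LocalSubring.range (M.ev z)

theorem pt_injective : Function.Injective M.pt := fun z z' h =>
  M.separates z z' (congrArg LocalSubring.toSubring h)

theorem ev_mem_pt (z : Z) (t) : M.ev z t ∈ (M.pt z).toSubring := ⟨t, rfl⟩

theorem isUnit_of_inv_mem {z : Z} {t : Z.presheaf.stalk z} (h0 : M.ev z t ≠ 0)
    (h : (M.ev z t)⁻¹ ∈ (M.pt z).toSubring) : IsUnit t := by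
  obtain ⟨t', ht'⟩ := h
  refine IsUnit.of_mul_eq_one t' (M.ev_injective z ?_)
  rw [map_mul, ht', map_one, mul_inv_cancel₀ h0]

theorem exists_section {z : Z} {x : K} (hx : x ∈ (M.pt z).toSubring) :
    ∃ (U : Opens Z) (_ : z ∈ U) (s : Z.presheaf.obj (op U)),
      ∀ z' (hz' : z' ∈ U), M.ev z' (Z.presheaf.germ U z' hz' s) = x := by
  obtain ⟨t, rfl⟩ := hx
  obtain ⟨U, hU, s, rfl⟩ := Z.presheaf.exists_germ_eq t
  exact ⟨U, hU, s, fun z' hz' => M.ev_germ U s z' z hz' hU⟩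

theorem isOpen_mem (x : K) : IsOpen {z : Z | x ∈ (M.pt z).toSubring} := by
  refine isOpen_iff_forall_mem_open.mpr fun z hz => ?_
  obtain ⟨U, hzU, s, hs⟩ := M.exists_section hz
  exact ⟨U, fun z' hz' => ⟨_, hs z' hz'⟩, U.2, hzU⟩

theorem section_ext {U : Opens Z} (s s' : Z.presheaf.obj (op U))
    (h : ∀ z (hz : z ∈ U), M.ev z (Z.presheaf.germ U z hz s) = M.ev z (Z.presheaf.germ U z hz s')) :
    s = s' :=
  TopCat.Presheaf.section_ext Z.sheaf _ _ _ fun z hz => M.ev_injective z (h z hz)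

/-- The graph, at the point `y`, of the pull-back of germs by `g`, viewed as a partial map from `K` to
the stalk at `y`. -/
def graph (g : Y ⟶ Z) (y : Y) : Subring (K × (Y.presheaf.stalk y : CommRingCat.{u})) :=
  ((M.ev (g.base y)).prod (g.stalkMap y).hom).range

theorem mem_graph {g : Y ⟶ Z} {y : Y} {x : K} {t} :
    (x, t) ∈ M.graph g y ↔ ∃ a, M.ev (g.base y) a = x ∧ g.stalkMap y a = t :=
  ⟨fun ⟨a, ha⟩ => ⟨a, congrArg Prod.fst ha, congrArg Prod.snd ha⟩,
    fun ⟨a, h1, h2⟩ => ⟨a, Prod.ext h1 h2⟩⟩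

theorem mem_pt_iff_graph {g : Y ⟶ Z} {y : Y} {x : K} :
    x ∈ (M.pt (g.base y)).toSubring ↔ ∃ t, (x, t) ∈ M.graph g y :=
  ⟨fun ⟨a, ha⟩ => ⟨_, M.mem_graph.mpr ⟨a, ha, rfl⟩⟩,
    fun ⟨_, ht⟩ => let ⟨a, ha, _⟩ := M.mem_graph.mp ht; ⟨a, ha⟩⟩

theorem graph_functional {g : Y ⟶ Z} {y : Y} {x : K} {t t'} (h : (x, t) ∈ M.graph g y)
    (h' : (x, t') ∈ M.graph g y) : t = t' := by
  obtain ⟨a, ha, rfl⟩ := M.mem_graph.mp h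
  obtain ⟨a', ha', rfl⟩ := M.mem_graph.mp h'
  rw [M.ev_injective _ (ha.trans ha'.symm)]

/-- The homomorphisms of stalks are local. -/
theorem graph_local {g : Y ⟶ Z} {y : Y} {x : K} {t} (h : (x, t) ∈ M.graph g y) (ht : IsUnit t) :
    x ≠ 0 ∧ ∃ t', (x⁻¹, t') ∈ M.graph g y := by
  obtain ⟨a, rfl, rfl⟩ := M.mem_graph.mp h
  have hu : IsUnit a := (LocallyRingedSpace.isLocalHomStalkMap g y).map_nonunit a ht
  obtain ⟨b, hb⟩ := hu.exists_right_inv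
  have hb' : M.ev _ a * M.ev _ b = 1 := by rw [← map_mul, hb, map_one]
  refine ⟨left_ne_zero_of_mul_eq_one hb', _, M.mem_graph.mpr ⟨b, ?_, rfl⟩⟩
  exact eq_inv_of_mul_eq_one_right hb'

theorem graph_open {g : Y ⟶ Z} {y : Y} {x : K} {t} (h : (x, t) ∈ M.graph g y) :
    ∃ (V : Opens Y) (hy : y ∈ V) (σ : Y.presheaf.obj (op V)), Y.presheaf.germ V y hy σ = t ∧
      ∀ z (hz : z ∈ V), (x, Y.presheaf.germ V z hz σ) ∈ M.graph g z := by
  obtain ⟨a, rfl, rfl⟩ := M.mem_graph.mp h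
  obtain ⟨U, hU, s, rfl⟩ := Z.presheaf.exists_germ_eq a
  refine ⟨(Opens.map g.base).obj U, hU, g.c.app (op U) s,
    (LocallyRingedSpace.stalkMap_germ_apply g U y hU s).symm, fun z hz => ?_⟩
  exact M.mem_graph.mpr ⟨_, M.ev_germ U s _ _ hz hU, LocallyRingedSpace.stalkMap_germ_apply g U z hz s⟩

theorem graph_comp (h : X ⟶ Y) (g : Y ⟶ Z) (w : X) {x : K} {t} :
    (x, t) ∈ M.graph (h ≫ g) w ↔
      ∃ t', (x, t') ∈ M.graph g (h.base w) ∧ h.stalkMap w t' = t := by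
  have e : ∀ a, (h ≫ g).stalkMap w a = h.stalkMap w (g.stalkMap (h.base w) a) := fun a =>
    ConcreteCategory.congr_hom (LocallyRingedSpace.stalkMap_comp h g w) a
  constructor
  · intro hx
    obtain ⟨a, ha, rfl⟩ := M.mem_graph.mp hx
    exact ⟨_, M.mem_graph.mpr ⟨a, ha, rfl⟩, (e a).symm⟩
  · rintro ⟨t', ht', rfl⟩
    obtain ⟨a, ha, rfl⟩ := M.mem_graph.mp ht'
    exact M.mem_graph.mpr ⟨a, ha, e a⟩

/-- The graph of `g` at `y` determines the point `g y`, since its first projection is the stalk of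
`Z` at `g y`. -/
theorem base_eq_of_graph_eq {g g' : Y ⟶ Z} {y : Y} (h : M.graph g y = M.graph g' y) :
    g.base y = g'.base y := by
  refine M.separates _ _ (Subring.ext fun x => ?_)
  exact M.mem_pt_iff_graph.trans ((by rw [h] : _ ↔ _).trans M.mem_pt_iff_graph.symm)

theorem hom_ext {g g' : Y ⟶ Z} (h : ∀ y, M.graph g y = M.graph g' y) : g = g' := by
  have hb : ∀ y, g.base y = g'.base y := fun y => M.base_eq_of_graph_eq (h y)
  have hc : ∀ (U : Opens Z) (s : Z.presheaf.obj (op U)) (y : Y) (hy : g.base y ∈ U)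
      (hy' : g'.base y ∈ U), Y.presheaf.germ ((Opens.map g.base).obj U) y hy (g.c.app (op U) s) =
        Y.presheaf.germ ((Opens.map g'.base).obj U) y hy' (g'.c.app (op U) s) := by
    intro U s y hy hy'
    have h1 : (M.ev _ (Z.presheaf.germ U (g.base y) hy s), _) ∈ M.graph g y :=
      M.mem_graph.mpr ⟨_, rfl, LocallyRingedSpace.stalkMap_germ_apply g U y hy s⟩
    have h2 : (M.ev _ (Z.presheaf.germ U (g'.base y) hy' s), _) ∈ M.graph g' y :=
      M.mem_graph.mpr ⟨_, rfl, LocallyRingedSpace.stalkMap_germ_apply g' U y hy' s⟩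
    rw [M.ev_germ U s _ _ hy' hy, ← h y] at h2
    exact M.graph_functional h1 h2
  obtain ⟨⟨b, c⟩, p⟩ := g
  obtain ⟨⟨b', c'⟩, p'⟩ := g'
  obtain rfl : b = b' := TopCat.hom_ext (ContinuousMap.ext hb)
  obtain rfl : c = c' := by
    refine NatTrans.ext (funext fun U => CommRingCat.hom_ext (RingHom.ext fun s => ?_))
    exact TopCat.Presheaf.section_ext Y.sheaf _ _ _ fun y hy => hc U.unop s y hy hy
  rfl

/-! ### Morphisms from graphs -/

section Lift

variable (f : Y → Z) (R : ∀ y : Y, Subring (K × (Y.presheaf.stalk y : CommRingCat.{u})))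

/-- The subrings `R y` of `K × 𝒪_{Y,y}` have the properties of the graphs of a morphism whose
underlying map is `f`. -/
structure IsGraph : Prop where
  mem_pt_iff : ∀ y x, x ∈ (M.pt (f y)).toSubring ↔ ∃ t, (x, t) ∈ R y
  eq_zero : ∀ y t, ((0 : K), t) ∈ R y → t = 0
  inv_mem : ∀ y x t, (x, t) ∈ R y → IsUnit t → ∃ t', (x⁻¹, t') ∈ R y
  isOpen : ∀ y x t, (x, t) ∈ R y → ∃ (V : Opens Y) (hy : y ∈ V) (σ : Y.presheaf.obj (op V)),
    Y.presheaf.germ V y hy σ = t ∧ ∀ z (hz : z ∈ V), (x, Y.presheaf.germ V z hz σ) ∈ R z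

namespace IsGraph

variable {M f R} (h : M.IsGraph f R)
include h

theorem functional {y : Y} {x : K} {t t'} (ht : (x, t) ∈ R y) (ht' : (x, t') ∈ R y) : t = t' := by
  have := sub_mem ht ht'
  rw [Prod.mk_sub_mk, sub_self] at this
  exact sub_eq_zero.mp (h.eq_zero y _ this)

theorem ne_zero {y : Y} {x : K} {t} (ht : (x, t) ∈ R y) (hu : IsUnit t) : x ≠ 0 := by
  rintro rfl
  rw [h.eq_zero y t ht] at hu
  exact not_isUnit_zero hu

theorem continuous : Continuous f := by
  refine continuous_def.mpr fun U hU => isOpen_iff_forall_mem_open.mpr fun y hy => ?_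
  obtain ⟨s, hs, hsU⟩ := M.exists_finset ⟨U, hU⟩ (f y) hy
  refine ⟨⋂ x ∈ s, {z | x ∈ (M.pt (f z)).toSubring}, fun z hz => ?_, ?_, ?_⟩
  · exact hsU _ fun x hx => Set.mem_iInter₂.mp hz x hx
  · refine isOpen_biInter_finset fun x _ => isOpen_iff_forall_mem_open.mpr fun z hz => ?_
    obtain ⟨t, ht⟩ := (h.mem_pt_iff z x).mp hz
    obtain ⟨V, hzV, σ, -, hσ⟩ := h.isOpen z x t ht
    exact ⟨V, fun w hw => (h.mem_pt_iff w x).mpr ⟨_, hσ w hw⟩, V.2, hzV⟩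
  · exact Set.mem_iInter₂.mpr fun x hx => hs x hx

/-- The map `f`, which is continuous because of `exists_finset` and of the openness of `R`. -/
def base : Y.toTopCat ⟶ Z.toTopCat := TopCat.ofHom ⟨f, h.continuous⟩

/-- The germs assigned by `R` to the value of a section `s` are locally the germs of a section, hence
glue to the pull-back of `s`. -/
theorem exists_pullback (U : Opens Z) (s : Z.presheaf.obj (op U)) :
    ∃ τ : Y.presheaf.obj (op ((Opens.map h.base).obj U)), ∀ y (hy : f y ∈ U),
      (M.ev (f y) (Z.presheaf.germ U (f y) hy s),
        Y.presheaf.germ ((Opens.map h.base).obj U) y hy τ) ∈ R y := by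
  have h1 : ∀ y (hy : f y ∈ U), ∃ t, (M.ev (f y) (Z.presheaf.germ U (f y) hy s), t) ∈ R y :=
    fun y hy => (h.mem_pt_iff y _).mp (M.ev_mem_pt _ _)
  choose t ht using h1
  obtain ⟨τ, hτ⟩ := exists_section_of_germs Y ((Opens.map h.base).obj U) t (fun y hy => by
    obtain ⟨V, hyV, σ, hσ, hV⟩ := h.isOpen y _ _ (ht y hy)
    refine ⟨V ⊓ (Opens.map h.base).obj U, ⟨hyV, hy⟩, inf_le_right,
      Y.presheaf.map (homOfLE inf_le_left).op σ, fun z hz => ?_⟩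
    refine (TopCat.Presheaf.germ_res_apply Y.presheaf _ z hz σ).trans ?_
    refine h.functional (hV z hz.1) ?_
    rw [M.ev_germ U s (f y) (f z) hy hz.2]
    exact ht z hz.2)
  exact ⟨τ, fun y hy => by rw [hτ y hy]; exact ht y hy⟩

/-- The pull-back of a section. -/
def pullback (U : Opens Z) (s : Z.presheaf.obj (op U)) :
    Y.presheaf.obj (op ((Opens.map h.base).obj U)) := (h.exists_pullback U s).choose

theorem pullback_mem (U : Opens Z) (s : Z.presheaf.obj (op U)) (y : Y) (hy : f y ∈ U) :
    (M.ev (f y) (Z.presheaf.germ U (f y) hy s),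
      Y.presheaf.germ ((Opens.map h.base).obj U) y hy (h.pullback U s)) ∈ R y :=
  (h.exists_pullback U s).choose_spec y hy

theorem pullback_eq (U : Opens Z) (s : Z.presheaf.obj (op U))
    (τ : Y.presheaf.obj (op ((Opens.map h.base).obj U)))
    (hτ : ∀ y (hy : f y ∈ U), (M.ev (f y) (Z.presheaf.germ U (f y) hy s),
      Y.presheaf.germ ((Opens.map h.base).obj U) y hy τ) ∈ R y) : h.pullback U s = τ :=
  TopCat.Presheaf.section_ext Y.sheaf _ _ _ fun y hy =>
    h.functional (h.pullback_mem U s y hy) (hτ y hy)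

/-- The pull-back of sections, as a ring homomorphism. -/
def pullbackHom (U : Opens Z) :
    (Z.presheaf.obj (op U) : CommRingCat.{u}) →+* Y.presheaf.obj (op ((Opens.map h.base).obj U)) where
  toFun := h.pullback U
  map_one' := h.pullback_eq U _ _ fun y hy => by
    simp only [map_one]; exact one_mem (R y)
  map_mul' s s' := h.pullback_eq U _ _ fun y hy => by
    simp only [map_mul]; exact mul_mem (h.pullback_mem U s y hy) (h.pullback_mem U s' y hy)
  map_zero' := h.pullback_eq U _ _ fun y hy => by
    simp only [map_zero]; exact zero_mem (R y)
  map_add' s s' := h.pullback_eq U _ _ fun y hy => by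
    simp only [map_add]; exact add_mem (h.pullback_mem U s y hy) (h.pullback_mem U s' y hy)

/-- The morphism of presheafed spaces with graphs `R`. -/
def presheafedHom : Y.toPresheafedSpace.Hom Z.toPresheafedSpace where
  base := h.base
  c :=
    { app := fun U => CommRingCat.ofHom (h.pullbackHom U.unop)
      naturality := fun U V i => CommRingCat.hom_ext (RingHom.ext fun s =>
        h.pullback_eq V.unop _ _ fun y hy => by
          have h1 := h.pullback_mem U.unop s y (i.unop.le hy)
          have h2 := TopCat.Presheaf.germ_res_apply Z.presheaf i.unop (f y) hy s
          have h3 := TopCat.Presheaf.germ_res_apply Y.presheaf ((Opens.map h.base).map i.unop) y hy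
            (h.pullback U.unop s)
          refine (congrArg (· ∈ R y) (Prod.ext (congrArg (M.ev (f y)) h2) ?_)).mpr h1
          exact h3) }

theorem stalkMap_mem (y : Y) (a : Z.presheaf.stalk (f y)) :
    (M.ev (f y) a, PresheafedSpace.Hom.stalkMap h.presheafedHom y a) ∈ R y := by
  obtain ⟨U, hU, s, rfl⟩ := Z.presheaf.exists_germ_eq a
  have h1 := ConcreteCategory.congr_hom (PresheafedSpace.stalkMap_germ h.presheafedHom U y hU) s
  exact (congrArg (fun t => (M.ev (f y) (Z.presheaf.germ U (f y) hU s), t) ∈ R y) h1).mpr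
    (h.pullback_mem U s y hU)

/-- The morphism of locally ringed spaces with graphs `R`. -/
def lift : Y ⟶ Z where
  toHom := h.presheafedHom
  prop y :=
    { map_nonunit := fun a ha => by
        obtain ⟨t', ht'⟩ := h.inv_mem y _ _ (h.stalkMap_mem y a) ha
        exact M.isUnit_of_inv_mem (h.ne_zero (h.stalkMap_mem y a) ha)
          ((h.mem_pt_iff y _).mpr ⟨t', ht'⟩) }

theorem graph_lift (y : Y) : M.graph h.lift y = R y := by
  refine le_antisymm ?_ ?_
  · rintro ⟨x, t⟩ hx
    obtain ⟨a, rfl, rfl⟩ := M.mem_graph.mp hx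
    exact h.stalkMap_mem y a
  · rintro ⟨x, t⟩ hx
    obtain ⟨a, rfl⟩ := (h.mem_pt_iff y x).mpr ⟨t, hx⟩
    exact M.mem_graph.mpr ⟨a, rfl, h.functional (h.stalkMap_mem y a) hx⟩

end IsGraph

end Lift

/-! ### Birational morphisms between spaces modelled on the same field -/

/-- A morphism compatible with the inclusions of the stalks into `K`. -/
def IsBirational (M' : FieldModel K Y) (M : FieldModel K Z) (g : Y ⟶ Z) : Prop :=
  ∀ y a, M'.ev y (g.stalkMap y a) = M.ev (g.base y) a

variable {M} {M' : FieldModel K Y} {M'' : FieldModel K X}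

theorem isBirational_iff {g : Y ⟶ Z} :
    IsBirational M' M g ↔ ∀ y x t, (x, t) ∈ M.graph g y → M'.ev y t = x := by
  refine ⟨fun h y x t hx => ?_, fun h y a => h y _ _ (M.mem_graph.mpr ⟨a, rfl, rfl⟩)⟩
  obtain ⟨a, rfl, rfl⟩ := M.mem_graph.mp hx
  exact h y a

theorem IsBirational.comp {g : Y ⟶ Z} {h : X ⟶ Y} (hg : IsBirational M' M g)
    (hh : IsBirational M'' M' h) : IsBirational M'' M (h ≫ g) := by
  refine isBirational_iff.mpr fun w x t hx => ?_
  obtain ⟨t', ht', rfl⟩ := (M.graph_comp h g w).mp hx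
  rw [hh w t', isBirational_iff.mp hg _ _ _ ht']

theorem isBirational_id : IsBirational M M (𝟙 Z) := fun z a => by
  rw [LocallyRingedSpace.stalkMap_id]; rfl

theorem IsBirational.mem_graph {g : Y ⟶ Z} (hg : IsBirational M' M g) {y : Y} {x : K} {t} :
    (x, t) ∈ M.graph g y ↔ M'.ev y t = x ∧ x ∈ (M.pt (g.base y)).toSubring := by
  constructor
  · intro h
    exact ⟨isBirational_iff.mp hg y x t h, M.mem_pt_iff_graph.mpr ⟨t, h⟩⟩
  · rintro ⟨h, a, ha⟩
    refine M.mem_graph.mpr ⟨a, ha, M'.ev_injective y ?_⟩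
    rw [hg, ha, h]

theorem IsBirational.pt_le {g : Y ⟶ Z} (hg : IsBirational M' M g) (y : Y) :
    M.pt (g.base y) ≤ M'.pt y := by
  refine localSubring_le_iff.mpr ⟨?_, ?_⟩
  · rintro x ⟨a, rfl⟩
    exact ⟨_, hg y a⟩
  · rintro x ⟨a, rfl⟩ hx
    by_cases h0 : M.ev _ a = 0
    · rw [h0, inv_zero]; exact zero_mem _
    have hu : IsUnit (g.stalkMap y a) := M'.isUnit_of_inv_mem (z := y) (by rwa [hg]) (by rwa [hg])
    obtain ⟨b, hb⟩ := ((LocallyRingedSpace.isLocalHomStalkMap g y).map_nonunit a hu).exists_right_inv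
    refine ⟨b, eq_inv_of_mul_eq_one_right ?_⟩
    rw [← map_mul, hb, map_one]

theorem IsBirational.hom_ext {g g' : Y ⟶ Z} (hg : IsBirational M' M g)
    (hg' : IsBirational M' M g') (h : ∀ y, g.base y = g'.base y) : g = g' :=
  M.hom_ext fun y => Subring.ext fun ⟨x, t⟩ => by
    rw [hg.mem_graph, hg'.mem_graph, h]

/-- A map `f` such that the local ring at `y` dominates the one at `f y` underlies a birational
morphism, provided that it is compatible with the topologies. -/
theorem exists_isBirational (M' : FieldModel K Y) (M : FieldModel K Z) (f : Y → Z)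
    (hf : ∀ y, M.pt (f y) ≤ M'.pt y) (hopen : ∀ x, IsOpen {y | x ∈ (M.pt (f y)).toSubring}) :
    ∃ g : Y ⟶ Z, IsBirational M' M g ∧ ∀ y, g.base y = f y := by
  let R : ∀ y : Y, Subring (K × (Y.presheaf.stalk y : CommRingCat.{u})) := fun y =>
    ((M.pt (f y)).toSubring.comap (RingHom.fst K _)) ⊓
      ((M'.ev y).comp (RingHom.snd K _)).eqLocus (RingHom.fst K _)
  have hR : ∀ y x t, (x, t) ∈ R y ↔ x ∈ (M.pt (f y)).toSubring ∧ M'.ev y t = x := fun _ _ _ => Iff.rfl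
  have h : M.IsGraph f R :=
    { mem_pt_iff := fun y x => by
        simp only [hR]
        refine ⟨fun hx => ?_, fun ⟨_, hx, _⟩ => hx⟩
        obtain ⟨t, ht⟩ := (hf y).1 hx
        exact ⟨t, hx, ht⟩
      eq_zero := fun y t ht => M'.ev_injective y (ht.2.trans (map_zero _).symm)
      inv_mem := fun y x t ht hu => by
        obtain ⟨b, hb⟩ := hu.exists_right_inv
        have hx := ((hR y x t).mp ht)
        have hxb : x * M'.ev y b = 1 := by rw [← hx.2, ← map_mul, hb, map_one]
        have hxi : M'.ev y b = x⁻¹ := eq_inv_of_mul_eq_one_right hxb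
        exact ⟨b, (localSubring_le_iff.mp (hf y)).2 x hx.1 (hxi ▸ M'.ev_mem_pt y b), hxi⟩
      isOpen := fun y x t ht => by
        have hx := (hR y x t).mp ht
        obtain ⟨V, hV, σ, rfl⟩ := Y.presheaf.exists_germ_eq t
        let W : Opens Y := V ⊓ ⟨_, hopen x⟩
        refine ⟨W, ⟨hV, hx.1⟩, Y.presheaf.map (homOfLE inf_le_left : W ⟶ V).op σ,
          TopCat.Presheaf.germ_res_apply Y.presheaf _ y _ σ, fun z hz => (hR _ _ _).mpr ⟨hz.2, ?_⟩⟩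
        refine (congrArg (M'.ev z) (TopCat.Presheaf.germ_res_apply Y.presheaf _ z hz σ)).trans ?_
        rw [M'.ev_germ V σ z y hz.1 hV, hx.2] }
  refine ⟨h.lift, isBirational_iff.mpr fun y x t hx => ?_, fun y => rfl⟩
  rw [h.graph_lift] at hx
  exact hx.2

end FieldModel

/-! ### The locally ringed space of a set of local subrings -/

section LocalSpace

/-- The field `K`, as a local subring of itself. -/
def wholeField (K : Type*) [Field K] : LocalSubring K where
  toSubring := ⊤
  isLocalRing := isLocalRing_of_inv_mem _ fun _ _ => Or.inl trivial

variable {K : Type u} [Field K] (S : Set (LocalSubring K))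

/-- The members of `S`, as a type, to be given the topology generated by the sets `{A | x ∈ A}`. -/
def LocalPts : Type u := {A : LocalSubring K // A ∈ S}

instance : TopologicalSpace (LocalPts S) :=
  TopologicalSpace.generateFrom {U | ∃ x : K, U = {A | x ∈ A.1.toSubring}}

variable {S}

theorem isOpen_mem_localPts (x : K) : IsOpen {A : LocalPts S | x ∈ A.1.toSubring} :=
  TopologicalSpace.isOpen_generateFrom_of_mem ⟨x, rfl⟩

theorem exists_finset_localPts {U : Set (LocalPts S)} (hU : IsOpen U) {A : LocalPts S} (hA : A ∈ U) :
    ∃ t : Finset K, (∀ x ∈ t, x ∈ A.1.toSubring) ∧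
      ∀ B : LocalPts S, (∀ x ∈ t, x ∈ B.1.toSubring) → B ∈ U := by
  classical
  induction hU with
  | basic s hs =>
    obtain ⟨x, rfl⟩ := hs
    exact ⟨{x}, fun y hy => by rwa [Finset.mem_singleton.mp hy],
      fun B hB => hB x (Finset.mem_singleton_self x)⟩
  | univ => exact ⟨∅, fun _ h => absurd h (Finset.notMem_empty _), fun _ _ => trivial⟩
  | inter s t _ _ hs ht =>
    obtain ⟨a, ha, ha'⟩ := hs hA.1
    obtain ⟨b, hb, hb'⟩ := ht hA.2
    exact ⟨a ∪ b, fun x hx => (Finset.mem_union.mp hx).elim (ha x) (hb x), fun B hB =>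
      ⟨ha' B fun x hx => hB x (Finset.mem_union_left _ hx),
        hb' B fun x hx => hB x (Finset.mem_union_right _ hx)⟩⟩
  | sUnion T _ ih =>
    obtain ⟨s, hs, hAs⟩ := hA
    obtain ⟨a, ha, ha'⟩ := ih s hs hAs
    exact ⟨a, ha, fun B hB => ⟨s, hs, ha' B hB⟩⟩

variable (hS : wholeField K ∈ S)

variable (S) in
/-- The topological space of the members of `S`. -/
def localTop : TopCat.{u} := TopCat.of (LocalPts S)

include hS in
/-- The field `K` is a generic point of the space of local subrings. -/
theorem wholeField_mem {U : Set (LocalPts S)} (hU : IsOpen U) {A : LocalPts S} (hA : A ∈ U) :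
    (⟨wholeField K, hS⟩ : LocalPts S) ∈ U := by
  obtain ⟨t, -, ht⟩ := exists_finset_localPts hU hA
  exact ht _ fun _ _ => trivial

/-- The functions which are sections: the constant functions with value at `A` in `A`. On a nonempty
open set constancy is a local condition, because every nonempty open set contains `K`. -/
def localPred : TopCat.LocalPredicate (X := localTop S) (fun _ => K) where
  pred {U} f := (∀ x y : U, f x = f y) ∧ ∀ x : U, f x ∈ x.1.1.toSubring
  res i _ h := ⟨fun x y => h.1 (i x) (i y), fun x => h.2 (i x)⟩
  locality {U} f h := by
    have key : ∀ x : U, f x = f ⟨⟨wholeField K, hS⟩, wholeField_mem hS U.2 x.2⟩ := by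
      intro x
      obtain ⟨V, hxV, i, hV⟩ := h x
      exact hV.1 ⟨x.1, hxV⟩ ⟨⟨wholeField K, hS⟩, wholeField_mem hS V.2 hxV⟩
    refine ⟨fun x y => (key x).trans (key y).symm, fun x => ?_⟩
    obtain ⟨V, hxV, i, hV⟩ := h x
    exact hV.2 ⟨x.1, hxV⟩

/-- The ring of sections over `U`; it is the zero ring over the empty set. -/
def localSections (U : Opens (localTop S)) : Subring (U → K) where
  carrier := {f | (∀ x y : U, f x = f y) ∧ ∀ x : U, f x ∈ x.1.1.toSubring}
  mul_mem' ha hb :=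
    ⟨fun x y => congrArg₂ (· * ·) (ha.1 x y) (hb.1 x y), fun x => mul_mem (ha.2 x) (hb.2 x)⟩
  one_mem' := ⟨fun _ _ => rfl, fun x => one_mem x.1.1.toSubring⟩
  add_mem' ha hb :=
    ⟨fun x y => congrArg₂ (· + ·) (ha.1 x y) (hb.1 x y), fun x => add_mem (ha.2 x) (hb.2 x)⟩
  zero_mem' := ⟨fun _ _ => rfl, fun x => zero_mem x.1.1.toSubring⟩
  neg_mem' ha := ⟨fun x y => congrArg (- ·) (ha.1 x y), fun x => neg_mem (ha.2 x)⟩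

variable (S) in
/-- The structure presheaf. -/
def localPresheaf : TopCat.Presheaf CommRingCat.{u} (localTop S) where
  obj U := CommRingCat.of (localSections U.unop)
  map i := CommRingCat.ofHom
    { toFun := fun s => ⟨fun x => s.1 (i.unop x),
        fun x y => s.2.1 (i.unop x) (i.unop y), fun x => s.2.2 (i.unop x)⟩
      map_one' := rfl
      map_mul' := fun _ _ => rfl
      map_zero' := rfl
      map_add' := fun _ _ => rfl }

include hS in
theorem localPresheaf_isSheaf : (localPresheaf S).IsSheaf := by
  refine (TopCat.Presheaf.isSheaf_iff_isSheaf_comp (forget CommRingCat) _).mpr ?_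
  refine TopCat.Presheaf.isSheaf_of_iso ?_
    (TopCat.subpresheafToTypes.isSheaf (localPred hS))
  exact NatIso.ofComponents (fun _ => Iso.refl _) (fun _ => rfl)

/-- The value of a germ, an element of `K`. -/
def localStalkEval (A : localTop S) :
    (localPresheaf S).stalk A ⟶ CommRingCat.of K :=
  Limits.colimit.desc ((OpenNhds.inclusion A).op ⋙ localPresheaf S)
    { pt := CommRingCat.of K
      ι := { app := fun U => CommRingCat.ofHom
              { toFun := fun s => s.1 ⟨A, U.unop.2⟩
                map_one' := rfl
                map_mul' := fun _ _ => rfl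
                map_zero' := rfl
                map_add' := fun _ _ => rfl }
             naturality := fun _ _ _ => rfl } }

theorem localStalkEval_germ (U : Opens (localTop S)) (A : localTop S) (hA : A ∈ U)
    (s : localSections U) :
    localStalkEval A ((localPresheaf S).germ U A hA s) = s.1 ⟨A, hA⟩ :=
  ConcreteCategory.congr_hom (Limits.colimit.ι_desc
    (F := (OpenNhds.inclusion A).op ⋙ localPresheaf S) _ (op (⟨U, hA⟩ : OpenNhds A))) s

theorem localStalkEval_injective (A : localTop S) :
    Function.Injective (localStalkEval A) := by
  intro a b h
  obtain ⟨U, hU, s, rfl⟩ := (localPresheaf S).exists_germ_eq a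
  obtain ⟨V, hV, t, rfl⟩ := (localPresheaf S).exists_germ_eq b
  have h' : s.1 ⟨A, hU⟩ = t.1 ⟨A, hV⟩ :=
    (localStalkEval_germ U A hU s).symm.trans (h.trans (localStalkEval_germ V A hV t))
  refine TopCat.Presheaf.germ_ext (localPresheaf S) (U ⊓ V) ⟨hU, hV⟩ (homOfLE inf_le_left)
    (homOfLE inf_le_right) (Subtype.ext (funext fun B => ?_))
  exact (s.2.1 ⟨B.1, B.2.1⟩ ⟨A, hU⟩).trans (h'.trans (t.2.1 ⟨A, hV⟩ ⟨B.1, B.2.2⟩))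

theorem range_localStalkEval (A : localTop S) :
    (localStalkEval A).hom.range = A.1.toSubring := by
  refine le_antisymm ?_ fun x hx => ?_
  · rintro _ ⟨a, rfl⟩
    obtain ⟨U, hU, s, rfl⟩ := (localPresheaf S).exists_germ_eq a
    exact (congrArg (· ∈ A.1.toSubring) (localStalkEval_germ U A hU s)).mpr (s.2.2 ⟨A, hU⟩)
  · exact ⟨_, localStalkEval_germ ⟨_, isOpen_mem_localPts x⟩ A hx
      ⟨fun _ => x, fun _ _ => rfl, fun B => B.2⟩⟩

/-- The locally ringed space whose points are the members of `S`, each of which is the stalk at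
itself. -/
def localSpace : LocallyRingedSpace.{u} where
  carrier := localTop S
  presheaf := localPresheaf S
  IsSheaf := localPresheaf_isSheaf hS
  isLocalRing A := by
    let e := RingEquiv.ofBijective (localStalkEval A).hom.rangeRestrict
      ⟨fun a b h => localStalkEval_injective A (congrArg Subtype.val h),
        (localStalkEval A).hom.rangeRestrict_surjective⟩
    have : IsLocalRing (localStalkEval A).hom.range := by
      rw [range_localStalkEval]; exact A.1.isLocalRing
    exact e.symm.isLocalRing

/-- The space of the members of `S` is modelled on `K`. -/
def localModel : FieldModel K (localSpace hS) where
  ev A := (localStalkEval (S := S) A).hom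
  ev_injective := localStalkEval_injective
  ev_germ U s A B hA hB := (localStalkEval_germ U A hA s).trans
    ((s.2.1 ⟨A, hA⟩ ⟨B, hB⟩).trans (localStalkEval_germ U B hB s).symm)
  exists_finset U A hA := by
    obtain ⟨t, ht, ht'⟩ := exists_finset_localPts U.2 hA
    exact ⟨t, fun x hx => (range_localStalkEval A).ge (ht x hx),
      fun B hB => ht' B fun x hx => (range_localStalkEval B).le (hB x hx)⟩
  separates A B h := Subtype.ext (LocalSubring.toSubring_injective
    ((range_localStalkEval A).symm.trans (h.trans (range_localStalkEval B))))

theorem localModel_pt (A : LocalPts S) : (localModel hS).pt A = A.1 :=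
  LocalSubring.toSubring_injective (range_localStalkEval A)

end LocalSpace

/-! ### The Riemann variety is modelled on its field -/

section Riemann

variable (F K : Type u) [Field F] [Field K] [Algebra F K]

theorem exists_finset_sigmaPts {U : Set (SigmaPts F K)} (hU : IsOpen U) {v : SigmaPts F K}
    (hv : v ∈ U) : ∃ t : Finset K, (∀ x ∈ t, x ∈ v.1) ∧
      ∀ w : SigmaPts F K, (∀ x ∈ t, x ∈ w.1) → w ∈ U := by
  classical
  induction hU with
  | basic s hs =>
    obtain ⟨_, ⟨t, rfl⟩, rfl⟩ := hs
    refine ⟨t, fun x hx => hv x (Algebra.subset_adjoin hx), fun w hw x hx => ?_⟩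
    induction hx using Algebra.adjoin_induction with
    | mem z hz => exact hw z hz
    | algebraMap r => exact w.2 r
    | add a b _ _ ha hb => exact add_mem ha hb
    | mul a b _ _ ha hb => exact mul_mem ha hb
  | univ => exact ⟨∅, fun _ h => absurd h (Finset.notMem_empty _), fun _ _ => trivial⟩
  | inter s t _ _ hs ht =>
    obtain ⟨a, ha, ha'⟩ := hs hv.1
    obtain ⟨b, hb, hb'⟩ := ht hv.2
    exact ⟨a ∪ b, fun x hx => (Finset.mem_union.mp hx).elim (ha x) (hb x), fun B hB =>
      ⟨ha' B fun x hx => hB x (Finset.mem_union_left _ hx),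
        hb' B fun x hx => hB x (Finset.mem_union_right _ hx)⟩⟩
  | sUnion T _ ih =>
    obtain ⟨s, hs, hAs⟩ := hv
    obtain ⟨a, ha, ha'⟩ := ih s hs hAs
    exact ⟨a, ha, fun B hB => ⟨s, hs, ha' B hB⟩⟩

variable {F K}

/-- The value of a germ on the Riemann variety. -/
def sigmaEv (v : sigmaTop F K) : ((sigmaPresheaf F K).stalk v : CommRingCat.{u}) →+* K :=
  v.1.subtype.comp (stalkEval v).hom

theorem sigmaEv_germ (U : Opens (sigmaTop F K)) (v : sigmaTop F K) (hv : v ∈ U)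
    (s : sigmaSections F K U) : sigmaEv v ((sigmaPresheaf F K).germ U v hv s) = s.1 ⟨v, hv⟩ :=
  stalkEval_germ_apply U v hv s

theorem range_sigmaEv (v : sigmaTop F K) : (sigmaEv v).range = v.1.toSubring := by
  refine le_antisymm ?_ fun x hx => ?_
  · rintro _ ⟨a, rfl⟩
    exact (stalkEval v a).2
  · exact ⟨_, sigmaEv_germ (openOfElem x) v hx ⟨fun _ => x, fun _ _ => rfl, fun B => B.2⟩⟩

variable (F K)

/-- The Riemann variety of `K` is modelled on `K`. -/
def sigmaModel : FieldModel K (sigmaLRS F K) where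
  ev v := sigmaEv (F := F) (K := K) v
  ev_injective v a b h := by
    obtain ⟨U, hU, s, rfl⟩ := (sigmaPresheaf F K).exists_germ_eq a
    obtain ⟨V, hV, t, rfl⟩ := (sigmaPresheaf F K).exists_germ_eq b
    have h' : s.1 ⟨v, hU⟩ = t.1 ⟨v, hV⟩ :=
      (sigmaEv_germ U v hU s).symm.trans (h.trans (sigmaEv_germ V v hV t))
    refine TopCat.Presheaf.germ_ext (sigmaPresheaf F K) (U ⊓ V) ⟨hU, hV⟩ (homOfLE inf_le_left)
      (homOfLE inf_le_right) (Subtype.ext (funext fun B => ?_))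
    exact (s.2.1 ⟨B.1, B.2.1⟩ ⟨v, hU⟩).trans (h'.trans (t.2.1 ⟨v, hV⟩ ⟨B.1, B.2.2⟩))
  ev_germ U s A B hA hB := (sigmaEv_germ U A hA s).trans
    ((s.2.1 ⟨A, hA⟩ ⟨B, hB⟩).trans (sigmaEv_germ U B hB s).symm)
  exists_finset U A hA := by
    obtain ⟨t, ht, ht'⟩ := exists_finset_sigmaPts F K U.2 hA
    exact ⟨t, fun x hx => (range_sigmaEv A).ge (ht x hx),
      fun B hB => ht' B fun x hx => (range_sigmaEv B).le (hB x hx)⟩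
  separates A B h := Subtype.ext (ValuationSubring.toSubring_injective
    ((range_sigmaEv A).symm.trans (h.trans (range_sigmaEv B))))

theorem sigmaModel_pt (v : SigmaPts F K) :
    (sigmaModel F K).pt v = v.1.toLocalSubring :=
  LocalSubring.toSubring_injective (range_sigmaEv (F := F) (K := K) v)

end Riemann

/-! ### The spectrum of a domain is modelled on every field containing it -/

section SpecModel

variable (A K : Type u) [CommRing A] [Field K] [Algebra A K] [FaithfulSMul A K]

open AlgebraicGeometry.StructureSheaf

variable {A} in
/-- The inclusion into `K` of the localization of `A` at `p`. -/
def specEv (p : PrimeSpectrum A) : ((Spec.structureSheaf A).presheaf.stalk p : CommRingCat.{u}) →+* K :=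
  IsLocalization.lift (M := p.asIdeal.primeCompl) (g := algebraMap A K) fun b => by
    refine IsUnit.mk0 _ fun h => b.2 ?_
    rw [(FaithfulSMul.algebraMap_injective A K) (h.trans (map_zero _).symm)]
    exact zero_mem _

variable {A}

theorem specEv_toStalk (p : PrimeSpectrum A) (a : A) :
    specEv K p (toStalk A p a) = algebraMap A K a := IsLocalization.lift_eq _ a

theorem mem_range_specEv (p : PrimeSpectrum A) {x : K} :
    x ∈ (specEv K p).range ↔ ∃ a b : A, b ∉ p.asIdeal ∧ x = algebraMap A K a / algebraMap A K b := by
  have hb0 : ∀ b ∉ p.asIdeal, algebraMap A K b ≠ 0 := fun b hb h => hb (by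
    rw [(FaithfulSMul.algebraMap_injective A K) (h.trans (map_zero _).symm)]
    exact zero_mem _)
  constructor
  · rintro ⟨t, rfl⟩
    obtain ⟨a, b, rfl⟩ := IsLocalization.exists_mk'_eq p.asIdeal.primeCompl t
    refine ⟨a, b, b.2, ?_⟩
    rw [eq_div_iff (hb0 _ b.2), ← specEv_toStalk K p a, ← specEv_toStalk K p b]
    exact ((specEv K p).map_mul _ _).symm.trans
      (congrArg (specEv K p) (IsLocalization.mk'_spec _ a b))
  · rintro ⟨a, b, hb, rfl⟩
    refine ⟨IsLocalization.mk' _ a (⟨b, hb⟩ : p.asIdeal.primeCompl), ?_⟩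
    rw [eq_div_iff (hb0 _ hb), ← specEv_toStalk K p a, ← specEv_toStalk K p b]
    exact ((specEv K p).map_mul _ _).symm.trans (congrArg (specEv K p)
      (IsLocalization.mk'_spec _ a (⟨b, hb⟩ : p.asIdeal.primeCompl)))

/-- Over the localization of `A`, inverses detect the prime; this separates points. -/
theorem inv_mem_range_specEv (p : PrimeSpectrum A) {b : A} (hb : b ≠ 0) :
    (algebraMap A K b)⁻¹ ∈ (specEv K p).range ↔ b ∉ p.asIdeal := by
  have inj := FaithfulSMul.algebraMap_injective A K
  have hb0 : algebraMap A K b ≠ 0 := fun h => hb (inj (h.trans (map_zero _).symm))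
  rw [mem_range_specEv]
  constructor
  · rintro ⟨a, c, hc, h⟩ hbp
    have hc0 : algebraMap A K c ≠ 0 := fun h => hc (by
      rw [inj (h.trans (map_zero _).symm)]; exact zero_mem _)
    rw [inv_eq_iff_eq_inv, inv_div, eq_div_iff_mul_eq (fun h0 => hb0 (by
      rw [h, h0, div_zero])), ← map_mul] at h
    rw [← inj h] at hc
    exact hc (Ideal.mul_mem_right _ _ hbp)
  · exact fun h => ⟨1, b, h, by rw [map_one, one_div]⟩

theorem specEv_specializes {p q : PrimeSpectrum A} (h : p ⤳ q) (t) :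
    specEv K p ((Spec.structureSheaf A).presheaf.stalkSpecializes h t) = specEv K q t := by
  have : (specEv K p).comp ((Spec.structureSheaf A).presheaf.stalkSpecializes h).hom = specEv K q := by
    refine IsLocalization.ringHom_ext q.asIdeal.primeCompl (RingHom.ext fun a => ?_)
    have := ConcreteCategory.congr_hom (toStalk_stalkSpecializes h) a
    refine (congrArg (specEv K p) this).trans ?_
    exact (specEv_toStalk K p a).trans (specEv_toStalk K q a).symm
  exact RingHom.congr_fun this t

theorem specEv_injective (p : PrimeSpectrum A) : Function.Injective (specEv K p) := by
  refine (injective_iff_map_eq_zero _).mpr fun t ht => ?_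
  obtain ⟨a, b, rfl⟩ := IsLocalization.exists_mk'_eq p.asIdeal.primeCompl t
  have h1 : algebraMap A K a = 0 := by
    refine (specEv_toStalk K p a).symm.trans ?_
    refine (congrArg (specEv K p) (IsLocalization.mk'_spec _ a b)).symm.trans ?_
    refine ((specEv K p).map_mul _ _).trans ?_
    exact mul_eq_zero_of_left ht _
  rw [(FaithfulSMul.algebraMap_injective A K) (h1.trans (map_zero _).symm)]
  exact IsLocalization.mk'_zero b

theorem specEv_germ {p q : PrimeSpectrum.Top A} (h : q ⤳ p) (U : Opens (PrimeSpectrum.Top A))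
    (s : (Spec.structureSheaf A).presheaf.obj (op U)) (hp : p ∈ U) :
    specEv K p ((Spec.structureSheaf A).presheaf.germ U p hp s) =
      specEv K q ((Spec.structureSheaf A).presheaf.germ U q (h.mem_open U.2 hp) s) := by
  refine (specEv_specializes K h _).symm.trans ?_
  exact congrArg (specEv K q) (ConcreteCategory.congr_hom
    (TopCat.Presheaf.germ_stalkSpecializes (Spec.structureSheaf A).presheaf hp h) s)

theorem bot_specializes [IsDomain A] (p : PrimeSpectrum A) : (⊥ : PrimeSpectrum A) ⤳ p :=
  (PrimeSpectrum.le_iff_specializes _ _).mp bot_le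

variable (A) in
/-- The spectrum of a subring `A` of `K` is modelled on `K`, by the localizations of `A`. -/
def specModel [IsDomain A] : FieldModel K (Spec.locallyRingedSpaceObj (CommRingCat.of A)) where
  ev p := specEv (A := A) K p
  ev_injective p := specEv_injective (A := A) K p
  ev_germ U s p q hp hq := (specEv_germ K (bot_specializes p) U s hp).trans
    (specEv_germ K (bot_specializes q) U s hq).symm
  exists_finset U p hp := by
    obtain ⟨_, ⟨b, rfl⟩, hpb, hbU⟩ :=
      PrimeSpectrum.isTopologicalBasis_basic_opens.exists_subset_of_mem_open hp U.2
    have hb : b ≠ 0 := fun h => hpb (h ▸ zero_mem _)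
    refine ⟨{(algebraMap A K b)⁻¹}, fun x hx => ?_, fun q hq => hbU ?_⟩
    · rw [Finset.mem_singleton.mp hx]
      exact (inv_mem_range_specEv K p hb).mpr hpb
    · exact (inv_mem_range_specEv K q hb).mp (hq _ (Finset.mem_singleton_self _))
  separates p q h := by
    refine PrimeSpectrum.ext (Ideal.ext fun b => ?_)
    by_cases hb : b = 0
    · rw [hb]; exact ⟨fun _ => zero_mem _, fun _ => zero_mem _⟩
    exact not_iff_not.mp ((inv_mem_range_specEv K p hb).symm.trans
      ((Subring.ext_iff.mp h _).trans (inv_mem_range_specEv K q hb)))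

end SpecModel

/-! ### Localizations of subalgebras -/

section Localizations

variable {F K : Type u} [Field F] [Field K] [Algebra F K] (A : Subalgebra F K)

/-- The localization of `A` at a prime, as a local subring of `K`. -/
def locAt (p : PrimeSpectrum A) : LocalSubring K := (specModel A K).pt p

variable {A}

theorem mem_locAt {p : PrimeSpectrum A} {x : K} :
    x ∈ (locAt A p).toSubring ↔ ∃ a b : A, b ∉ p.asIdeal ∧ x = a / b :=
  mem_range_specEv K p

theorem le_locAt (p : PrimeSpectrum A) {x : K} (hx : x ∈ A) : x ∈ (locAt A p).toSubring :=
  mem_locAt.mpr ⟨⟨x, hx⟩, 1, fun h => p.2.ne_top ((Ideal.eq_top_iff_one _).mpr h), (div_one _).symm⟩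

theorem inv_mem_locAt {p : PrimeSpectrum A} {b : A} (hb : b ≠ 0) :
    (b : K)⁻¹ ∈ (locAt A p).toSubring ↔ b ∉ p.asIdeal :=
  inv_mem_range_specEv K p hb

/-- A local subring dominates at most one localization of `A`: the prime consists of the `b ∈ A` which
are not invertible in `O`. -/
theorem eq_of_locAt_le {O : LocalSubring K} {p q : PrimeSpectrum A} (hp : locAt A p ≤ O)
    (hq : locAt A q ≤ O) : p = q := by
  have key : ∀ r, locAt A r ≤ O → ∀ b : A, b ≠ 0 → ((b : K)⁻¹ ∈ O.toSubring ↔ b ∉ r.asIdeal) :=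
    fun r hr b hb => by
      rw [← inv_mem_locAt hb]
      exact ⟨fun h => (localSubring_le_iff.mp hr).2 _ (le_locAt r b.2) h, fun h => hr.1 h⟩
  refine PrimeSpectrum.ext (Ideal.ext fun b => ?_)
  by_cases hb : b = 0
  · rw [hb]; exact ⟨fun _ => zero_mem _, fun _ => zero_mem _⟩
  exact not_iff_not.mp ((key p hp b hb).symm.trans (key q hq b hb))

/-- Every local ring containing `A` dominates a localization of `A`. -/
theorem exists_locAt_le {O : LocalSubring K} (h : ∀ x ∈ A, x ∈ O.toSubring) :
    ∃ p, locAt A p ≤ O := by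
  let i : A →+* O.toSubring :=
    { toFun := fun a => ⟨a, h a a.2⟩
      map_one' := rfl
      map_mul' := fun _ _ => rfl
      map_zero' := rfl
      map_add' := fun _ _ => rfl }
  let p : PrimeSpectrum A := ⟨(IsLocalRing.maximalIdeal O.toSubring).comap i, inferInstance⟩
  have hp : ∀ b : A, b ∉ p.asIdeal → (b : K)⁻¹ ∈ O.toSubring := fun b hb => by
    have : IsUnit (i b) := by
      by_contra h'
      exact hb h'
    obtain ⟨c, hc⟩ := this.exists_right_inv
    have h1 : (b : K) * (c : K) = 1 := congrArg Subtype.val hc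
    rw [← eq_inv_of_mul_eq_one_right h1]
    exact c.2
  refine ⟨p, localSubring_le_iff.mpr ⟨fun x hx => ?_, fun x hx hx' => ?_⟩⟩
  · obtain ⟨a, b, hb, rfl⟩ := mem_locAt.mp hx
    rw [div_eq_mul_inv]
    exact mul_mem (h a a.2) (hp b hb)
  · obtain ⟨a, b, hb, rfl⟩ := mem_locAt.mp hx
    by_cases ha : (a : K) = 0
    · rw [ha, zero_div, inv_zero]; exact zero_mem _
    have hb0 : (b : K) ≠ 0 := fun h0 => hb (by rw [show b = 0 from Subtype.ext h0]; exact zero_mem _)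
    refine mem_locAt.mpr ⟨b, a, fun hap => ?_, by rw [inv_div]⟩
    have hu : i a * ⟨(a : K)⁻¹, by
        have := mul_mem hx' (hp b hb)
        rwa [inv_div, div_mul_eq_mul_div, mul_inv_cancel₀ hb0, one_div] at this⟩ = 1 :=
      Subtype.ext (mul_inv_cancel₀ ha)
    exact (IsLocalRing.mem_maximalIdeal _).mp hap (IsUnit.of_mul_eq_one _ hu)

theorem isOpen_forall_mem {Z : LocallyRingedSpace.{u}} (M : FieldModel K Z)
    (hM : ∀ (z : Z) (a : F), algebraMap F K a ∈ (M.pt z).toSubring) (hA : A.FG) :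
    IsOpen {z : Z | ∀ x ∈ A, x ∈ (M.pt z).toSubring} := by
  obtain ⟨t, rfl⟩ := hA
  have : {z : Z | ∀ x ∈ Algebra.adjoin F (t : Set K), x ∈ (M.pt z).toSubring} =
      ⋂ x ∈ t, {z : Z | x ∈ (M.pt z).toSubring} := by
    ext z
    simp only [Set.mem_iInter]
    refine ⟨fun h x hx => h x (Algebra.subset_adjoin hx), fun h x hx => ?_⟩
    induction hx using Algebra.adjoin_induction with
    | mem z hz => exact h z hz
    | algebraMap r => exact hM z r
    | add a b _ _ ha hb => exact add_mem ha hb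
    | mul a b _ _ ha hb => exact mul_mem ha hb
  rw [this]
  exact isOpen_biInter_finset fun x _ => M.isOpen_mem x

end Localizations

/-! ### Birational morphisms which are open immersions -/

section OpenImmersion

variable {K : Type u} [Field K] {Y Z : LocallyRingedSpace.{u}} {M' : FieldModel K Y}
  {M : FieldModel K Z}

theorem FieldModel.IsBirational.isIso_stalkMap {g : Y ⟶ Z} (hg : IsBirational M' M g) (y : Y)
    (h : M.pt (g.base y) = M'.pt y) : IsIso (g.stalkMap y) := by
  refine (ConcreteCategory.isIso_iff_bijective _).mpr ⟨fun a b hab => ?_, fun b => ?_⟩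
  · refine M.ev_injective _ ?_
    rw [← hg, ← hg]
    exact congrArg _ hab
  · obtain ⟨a, ha⟩ : M'.ev y b ∈ (M.pt (g.base y)).toSubring := by rw [h]; exact M'.ev_mem_pt y b
    exact ⟨a, M'.ev_injective y ((hg y a).trans ha)⟩

theorem FieldModel.IsBirational.isOpenImmersion {g : Y ⟶ Z} (hg : IsBirational M' M g)
    (h : ∀ y, M.pt (g.base y) = M'.pt y)
    (hopen : IsOpen {z | ∃ y, M.pt z = M'.pt y}) : LocallyRingedSpace.IsOpenImmersion g := by
  -- it suffices that `g` is an isomorphism on stalks and an open embedding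
  have : ∀ y, IsIso (g.stalkMap y) := fun y => hg.isIso_stalkMap y (h y)
  refine LocallyRingedSpace.IsOpenImmersion.of_stalk_iso g
    (.of_continuous_injective_isOpenMap g.base.hom.continuous (fun y y' e => ?_) fun U hU => ?_)
  · refine M'.pt_injective ?_
    rw [← h, ← h]
    exact congrArg M.pt e
  · refine isOpen_iff_forall_mem_open.mpr ?_
    rintro _ ⟨y, hy, rfl⟩
    obtain ⟨t, ht, ht'⟩ := M'.exists_finset ⟨U, hU⟩ y hy
    refine ⟨{z | ∃ y, M.pt z = M'.pt y} ∩ ⋂ x ∈ t, {z | x ∈ (M.pt z).toSubring}, ?_,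
      hopen.inter (isOpen_biInter_finset fun x _ => M.isOpen_mem x), ⟨y, h y⟩, ?_⟩
    · rintro z ⟨⟨y', hy'⟩, hz⟩
      refine ⟨y', ht' y' fun x hx => ?_, M.pt_injective ((h y').trans hy'.symm)⟩
      have := Set.mem_iInter₂.mp hz x hx
      rw [Set.mem_ofPred_eq, hy'] at this
      exact this
    · exact Set.mem_iInter₂.mpr fun x hx =>
        (congrArg LocalSubring.toSubring (h y)).ge (ht x hx)

end OpenImmersion

/-! ### Structure morphisms -/

section Over

variable (F : Type u) [Field F] {Y Z : LocallyRingedSpace.{u}}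

/-- The base `Spec F`. -/
abbrev baseLRS : LocallyRingedSpace.{u} := Spec.toLocallyRingedSpace.obj (op (CommRingCat.of F))

variable {F}

/-- The homomorphism from `F` to the ring of global sections defined by a morphism to `Spec F`. -/
def constants (h : Z ⟶ baseLRS F) : CommRingCat.of F ⟶ LocallyRingedSpace.Γ.obj (op Z) :=
  toSpecΓ (CommRingCat.of F) ≫ LocallyRingedSpace.Γ.map h.op

theorem constants_comp (g : Y ⟶ Z) (h : Z ⟶ baseLRS F) :
    constants (g ≫ h) = constants h ≫ LocallyRingedSpace.Γ.map g.op := by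
  simp only [constants, op_comp, Functor.map_comp, Category.assoc]

theorem constants_toΓSpec (c : CommRingCat.of F ⟶ LocallyRingedSpace.Γ.obj (op Z)) :
    constants (Z.toΓSpec ≫ Spec.locallyRingedSpaceMap c) = c := by
  refine (constants_comp Z.toΓSpec (Spec.toLocallyRingedSpace.map c.op)).trans ?_
  refine (congrArg (· ≫ LocallyRingedSpace.Γ.map Z.toΓSpec.op) (Spec_Γ_naturality c).symm).trans ?_
  exact (Category.assoc _ _ _).trans
    ((congrArg (c ≫ ·) (LocallyRingedSpace.Γ_Spec_left_triangle Z)).trans (Category.comp_id c))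

theorem toΓSpec_constants (h : Z ⟶ baseLRS F) :
    Z.toΓSpec ≫ Spec.locallyRingedSpaceMap (constants h) = h := by
  have hn : h ≫ (baseLRS F).toΓSpec = Z.toΓSpec ≫
      Spec.locallyRingedSpaceMap (LocallyRingedSpace.Γ.map h.op) := identityToΓSpec.naturality h
  rw [constants, Spec.locallyRingedSpaceMap_comp, ← Category.assoc, ← hn, Category.assoc]
  exact (congrArg (h ≫ ·) (ΓSpec.right_triangle (CommRingCat.of F))).trans (Category.comp_id h)

variable {K : Type u} [Field K] [Algebra F K]

/-- The structure morphism `h` of `Z` is the one given by the inclusion of `F` into `K`. -/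
def FieldModel.IsOver (M : FieldModel K Z) (h : Z ⟶ baseLRS F) : Prop :=
  ∀ (a : F) (z : Z), M.ev z (Z.presheaf.germ ⊤ z trivial (constants h a)) = algebraMap F K a

namespace FieldModel

variable {M : FieldModel K Z} {M' : FieldModel K Y}

theorem IsOver.eq {h h' : Z ⟶ baseLRS F} (H : M.IsOver h) (H' : M.IsOver h') : h = h' := by
  have : constants h = constants h' := CommRingCat.hom_ext (RingHom.ext fun a =>
    M.section_ext _ _ fun z hz => (H a z).trans (H' a z).symm)
  rw [← toΓSpec_constants h, this, toΓSpec_constants]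

theorem IsOver.comp {h : Z ⟶ baseLRS F} (H : M.IsOver h) {g : Y ⟶ Z} (hg : IsBirational M' M g) :
    M'.IsOver (g ≫ h) := by
  intro a y
  have h1 : constants (g ≫ h) a = g.c.app (op ⊤) (constants h a) :=
    ConcreteCategory.congr_hom (constants_comp g h) a
  rw [h1, ← H a (g.base y), ← hg]
  exact congrArg _ (LocallyRingedSpace.stalkMap_germ_apply g ⊤ y trivial _).symm

theorem IsOver.algebraMap_mem {h : Z ⟶ baseLRS F} (H : M.IsOver h) (z : Z) (a : F) :
    algebraMap F K a ∈ (M.pt z).toSubring := ⟨_, H a z⟩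

end FieldModel

variable (F K) in
theorem sigmaModel_isOver : (sigmaModel F K).IsOver (sigmaOver F K).hom := by
  intro a v
  have h1 : constants (Z := sigmaLRS F K) (sigmaOver F K).hom = sigmaConst F K :=
    constants_toΓSpec (Z := sigmaLRS F K) (sigmaConst F K)
  refine (congrArg (fun c : CommRingCat.of F ⟶ LocallyRingedSpace.Γ.obj (op (sigmaLRS F K)) =>
    sigmaEv v ((sigmaPresheaf F K).germ ⊤ v trivial (c a))) h1).trans ?_
  exact sigmaEv_germ ⊤ v trivial _

theorem specModel_isOver (A : Type u) [CommRing A] [IsDomain A] [Algebra A K] [FaithfulSMul A K]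
    [Algebra F A] [IsScalarTower F A K] : (specModel A K).IsOver
      (Spec.locallyRingedSpaceMap (CommRingCat.ofHom (algebraMap F A))) := by
  intro a p
  have h1 : constants (Spec.locallyRingedSpaceMap (CommRingCat.ofHom (algebraMap F A))) a =
      toSpecΓ (CommRingCat.of A) (algebraMap F A a) :=
    (ConcreteCategory.congr_hom (Spec_Γ_naturality (CommRingCat.ofHom (algebraMap F A))) a).symm
  rw [h1, IsScalarTower.algebraMap_apply F A K, ← specEv_toStalk K p]
  rfl

section Local

variable {S : Set (LocalSubring K)} (hS : wholeField K ∈ S)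
  (hF : ∀ A ∈ S, ∀ a : F, algebraMap F K a ∈ A.toSubring)

/-- The constants, as global sections of the space of the members of `S`. -/
def localConst : CommRingCat.of F ⟶ LocallyRingedSpace.Γ.obj (op (localSpace hS)) :=
  CommRingCat.ofHom (S := (localPresheaf S).obj (op ⊤))
    { toFun := fun a => ⟨fun _ => algebraMap F K a, fun _ _ => rfl, fun A => hF _ A.1.2 a⟩
      map_one' := Subtype.ext (funext fun _ => map_one _)
      map_mul' := fun _ _ => Subtype.ext (funext fun _ => map_mul _ _ _)
      map_zero' := Subtype.ext (funext fun _ => map_zero _)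
      map_add' := fun _ _ => Subtype.ext (funext fun _ => map_add _ _ _) }

/-- The structure morphism of the space of the members of `S`. -/
def localStructure : localSpace hS ⟶ baseLRS F :=
  (localSpace hS).toΓSpec ≫ Spec.locallyRingedSpaceMap (localConst hS hF)

theorem localModel_isOver : (localModel hS).IsOver (localStructure hS hF) := by
  intro a A
  rw [localStructure, constants_toΓSpec]
  exact localStalkEval_germ ⊤ A trivial _

end Local

end Over

/-! ### The variety glued from subalgebras of its function field -/

/-- The affine charts of a variety with function field `K`: a finite nonempty set of finitely
generated subalgebras with fraction field `K`, such that a local subring of `K` dominates at most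
one localization of the charts. -/
structure AffineCharts (F K : Type u) [Field F] [Field K] [Algebra F K] where
  charts : Set (Subalgebra F K)
  finite : charts.Finite
  nonempty : charts.Nonempty
  fg : ∀ A ∈ charts, A.FG
  exists_div : ∀ A ∈ charts, ∀ x : K, ∃ a ∈ A, ∃ b ∈ A, b ≠ 0 ∧ x = a / b
  unique : ∀ (O : LocalSubring K), ∀ A ∈ charts, ∀ B ∈ charts, ∀ (p : PrimeSpectrum A)
    (q : PrimeSpectrum B), locAt A p ≤ O → locAt B q ≤ O → locAt A p = locAt B q

namespace AffineCharts

variable {F K : Type u} [Field F] [Field K] [Algebra F K] (M : AffineCharts F K)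

/-- The localizations of the charts, which are the local rings of the variety. -/
def points : Set (LocalSubring K) := {P | ∃ A ∈ M.charts, ∃ p : PrimeSpectrum A, P = locAt A p}

theorem eq_of_le {O P Q : LocalSubring K} (hP : P ∈ M.points) (hQ : Q ∈ M.points) (h : P ≤ O)
    (h' : Q ≤ O) : P = Q := by
  obtain ⟨A, hA, p, rfl⟩ := hP
  obtain ⟨B, hB, q, rfl⟩ := hQ
  exact M.unique O A hA B hB p q h h'

theorem algebraMap_mem {P : LocalSubring K} (hP : P ∈ M.points) (a : F) :
    algebraMap F K a ∈ P.toSubring := by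
  obtain ⟨A, _, p, rfl⟩ := hP
  exact le_locAt p (A.algebraMap_mem a)

theorem wholeField_mem_points : wholeField K ∈ M.points := by
  obtain ⟨A, hA⟩ := M.nonempty
  refine ⟨A, hA, ⊥, LocalSubring.toSubring_injective (Subring.ext fun x => ?_)⟩
  refine ⟨fun _ => ?_, fun _ => trivial⟩
  obtain ⟨a, ha, b, hb, hb0, rfl⟩ := M.exists_div A hA x
  exact mem_locAt.mpr ⟨⟨a, ha⟩, ⟨b, hb⟩, fun h => hb0 (congrArg Subtype.val h), rfl⟩

/-- The variety, as a locally ringed space. -/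
def space : LocallyRingedSpace.{u} := localSpace M.wholeField_mem_points

/-- The variety is modelled on `K`. -/
def model : FieldModel K M.space := localModel M.wholeField_mem_points

theorem model_pt (z : M.space) : M.model.pt z = (show LocalPts M.points from z).1 :=
  localModel_pt M.wholeField_mem_points z

theorem pt_mem (z : M.space) : M.model.pt z ∈ M.points := by
  rw [model_pt]; exact (show LocalPts M.points from z).2

theorem exists_pt_eq {P : LocalSubring K} (hP : P ∈ M.points) : ∃ z, M.model.pt z = P :=
  ⟨(⟨P, hP⟩ : LocalPts M.points), M.model_pt _⟩

theorem mem_model_pt (z : M.space) (a : F) : algebraMap F K a ∈ (M.model.pt z).toSubring :=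
  M.algebraMap_mem (M.pt_mem z) a

/-- The structure morphism to `Spec F`. -/
def structureMap : M.space ⟶ baseLRS F :=
  localStructure M.wholeField_mem_points fun _ h => M.algebraMap_mem h

theorem model_isOver : M.model.IsOver M.structureMap :=
  localModel_isOver M.wholeField_mem_points fun _ h => M.algebraMap_mem h

variable {Y : LocallyRingedSpace.{u}} {M' : FieldModel K Y}

variable {M} in
/-- Birational morphisms to the variety are unique, because a local ring dominates at most one point
of it. -/
theorem hom_ext {g g' : Y ⟶ M.space} (hg : FieldModel.IsBirational M' M.model g)
    (hg' : FieldModel.IsBirational M' M.model g') : g = g' :=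
  hg.hom_ext hg' fun y => M.model.pt_injective
    (M.eq_of_le (M.pt_mem _) (M.pt_mem _) (hg.pt_le y) (hg'.pt_le y))

/-- A space modelled on `K` maps to the variety as soon as each of its local rings dominates a point of
the variety. -/
theorem exists_hom (M' : FieldModel K Y) (hF : ∀ y (a : F), algebraMap F K a ∈ (M'.pt y).toSubring)
    (h : ∀ y, ∃ P ∈ M.points, P ≤ M'.pt y) :
    ∃ g : Y ⟶ M.space, FieldModel.IsBirational M' M.model g := by
  have h' : ∀ y, ∃ z : M.space, M.model.pt z ≤ M'.pt y := fun y => by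
    obtain ⟨P, hP, hP'⟩ := h y
    obtain ⟨z, rfl⟩ := M.exists_pt_eq hP
    exact ⟨z, hP'⟩
  choose f hf using h'
  obtain ⟨g, hg, -⟩ := FieldModel.exists_isBirational M' M.model f hf fun x =>
    isOpen_iff_forall_mem_open.mpr fun y hy => by
      obtain ⟨A, hA, p, hp⟩ := M.pt_mem (f y)
      have hx : x ∈ (locAt A p).toSubring := hp ▸ hy
      obtain ⟨a, b, hb, rfl⟩ := mem_locAt.mp hx
      have hb0 : b ≠ 0 := fun h => hb (h ▸ zero_mem _)
      have hpy : locAt A p ≤ M'.pt y := hp ▸ hf y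
      refine ⟨{y | ∀ x ∈ A, x ∈ (M'.pt y).toSubring} ∩ {y | (b : K)⁻¹ ∈ (M'.pt y).toSubring},
        ?_, (isOpen_forall_mem M' hF (M.fg A hA)).inter (M'.isOpen_mem _),
        fun x hx => hpy.1 (le_locAt p hx), hpy.1 ((inv_mem_locAt hb0).mpr hb)⟩
      rintro w ⟨hw, hbw⟩
      obtain ⟨q, hq⟩ := exists_locAt_le hw
      have e : M.model.pt (f w) = locAt A q := M.eq_of_le (M.pt_mem _) ⟨A, hA, q, rfl⟩ (hf w) hq
      change _ ∈ (M.model.pt (f w)).toSubring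
      rw [e, div_eq_mul_inv]
      exact mul_mem (le_locAt q a.2) ((localSubring_le_iff.mp hq).2 _ (le_locAt q b.2) hbw)
  exact ⟨g, hg⟩

/-- The spectra of the charts are open in the variety. -/
theorem exists_chart {A : Subalgebra F K} (hA : A ∈ M.charts) :
    ∃ c : Spec.locallyRingedSpaceObj (CommRingCat.of A) ⟶ M.space,
      FieldModel.IsBirational (specModel A K) M.model c ∧
        (∀ p, M.model.pt (c.base p) = locAt A p) ∧ LocallyRingedSpace.IsOpenImmersion c := by
  obtain ⟨c, hc⟩ := M.exists_hom (specModel A K)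
    (fun p a => le_locAt (A := A) p (A.algebraMap_mem a)) fun p => ⟨locAt A p, ⟨A, hA, p, rfl⟩, le_rfl⟩
  have hpt : ∀ p, M.model.pt (c.base p) = locAt A p := fun p =>
    M.eq_of_le (M.pt_mem _) ⟨A, hA, p, rfl⟩ (hc.pt_le p) le_rfl
  refine ⟨c, hc, hpt, hc.isOpenImmersion hpt ?_⟩
  have : {z : M.space | ∃ p, M.model.pt z = (specModel A K).pt p} =
      {z : M.space | ∀ x ∈ A, x ∈ (M.model.pt z).toSubring} := by
    ext z
    constructor
    · rintro ⟨p, hp⟩ x hx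
      rw [hp]
      exact le_locAt (A := A) p hx
    · intro h
      obtain ⟨p, hp⟩ := exists_locAt_le h
      exact ⟨p, M.eq_of_le (M.pt_mem z) ⟨A, hA, p, rfl⟩ le_rfl hp⟩
  rw [this]
  exact isOpen_forall_mem M.model M.mem_model_pt (M.fg A hA)

/-- The variety, as a scheme. -/
def scheme : Scheme.{u} := LocallyRingedSpace.IsOpenImmersion.scheme M.space fun z => by
  obtain ⟨A, hA, p, hp⟩ := M.pt_mem z
  obtain ⟨c, -, hc, hc'⟩ := M.exists_chart hA
  exact ⟨CommRingCat.of A, c, ⟨p, M.model.pt_injective ((hc p).trans hp.symm)⟩, hc'⟩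

/-- The structure morphism of the scheme. -/
def toSpec : M.scheme ⟶ Spec (CommRingCat.of F) := ⟨M.structureMap⟩

/-- The open immersion of a chart. -/
def chart (A : M.charts) : Spec (CommRingCat.of A.1) ⟶ M.scheme := ⟨(M.exists_chart A.2).choose⟩

theorem chart_isBirational (A : M.charts) :
    FieldModel.IsBirational (specModel A.1 K) M.model (M.chart A).toLRSHom :=
  (M.exists_chart A.2).choose_spec.1

theorem pt_chart (A : M.charts) (p : PrimeSpectrum A.1) :
    M.model.pt ((M.chart A).toLRSHom.base p) = locAt A.1 p :=
  (M.exists_chart A.2).choose_spec.2.1 p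

instance (A : M.charts) : IsOpenImmersion (M.chart A) := (M.exists_chart A.2).choose_spec.2.2

theorem chart_toSpec (A : M.charts) :
    M.chart A ≫ M.toSpec = Spec.map (CommRingCat.ofHom (algebraMap F A.1)) :=
  congrArg (fun h => Scheme.Hom.mk h) ((M.model_isOver.comp (M.chart_isBirational A)).eq
    (specModel_isOver (F := F) (K := K) A.1))

theorem exists_chart_eq (z : M.scheme) : ∃ (A : M.charts) (p : PrimeSpectrum A.1), M.chart A p = z := by
  obtain ⟨A, hA, p, hp⟩ := M.pt_mem z
  exact ⟨⟨A, hA⟩, p, M.model.pt_injective ((M.pt_chart ⟨A, hA⟩ p).trans hp.symm)⟩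

/-- The open cover by the charts. -/
def openCover : M.scheme.OpenCover :=
  Scheme.Cover.mkOfCovers M.charts (fun A => Spec (CommRingCat.of A.1)) M.chart
    (fun z => (M.exists_chart_eq z)) inferInstance

instance : LocallyOfFiniteType M.toSpec := by
  have : IsZariskiLocalAtSource (@LocallyOfFiniteType.{u}) :=
    HasRingHomProperty.instIsZariskiLocalAtSource (Q := RingHom.FiniteType)
  refine IsZariskiLocalAtSource.of_openCover (P := @LocallyOfFiniteType.{u}) M.openCover
    fun (A : M.charts) => ?_
  refine (congrArg LocallyOfFiniteType (M.chart_toSpec A)).mpr ?_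
  refine (HasRingHomProperty.Spec_iff (P := @LocallyOfFiniteType.{u})).mpr
    (RingHom.finiteType_algebraMap.mpr ?_)
  exact A.1.fg_iff_finiteType.mp (M.fg A.1 A.2)

instance : CompactSpace M.scheme := by
  have : Finite M.charts := M.finite
  refine isCompact_univ_iff.mp ?_
  have : (Set.univ : Set M.scheme) = ⋃ A : M.charts, Set.range (M.chart A) := by
    refine (Set.eq_univ_of_forall fun z => ?_).symm
    obtain ⟨A, p, rfl⟩ := M.exists_chart_eq z
    exact Set.mem_iUnion.mpr ⟨A, p, rfl⟩
  rw [this]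
  exact isCompact_iUnion fun A => isCompact_range (M.chart A).continuous

instance : QuasiCompact M.toSpec :=
  have : IsLocallyNoetherian M.scheme := LocallyOfFiniteType.isLocallyNoetherian M.toSpec
  have : IsNoetherian M.scheme := {}
  inferInstance

theorem isDomain_localSections (U : Opens (localTop M.points)) [hU : Nonempty U] :
    IsDomain (localSections U) := by
  have : Nontrivial (localSections U) := by
    obtain ⟨z⟩ := hU
    exact ⟨0, 1, fun h => zero_ne_one (congrFun (congrArg Subtype.val h) z)⟩
  have : NoZeroDivisors (localSections U) := ⟨fun {a b} h => by
    obtain ⟨z⟩ := hU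
    have key : ∀ s : localSections U, s.1 z = 0 → s = 0 := fun s hs =>
      Subtype.ext (funext fun w => (s.2.1 w z).trans hs)
    exact (mul_eq_zero.mp (congrFun (congrArg Subtype.val h) z)).imp (key a) (key b)⟩
  exact NoZeroDivisors.to_isDomain _

instance : IsIntegral M.scheme where
  nonempty := ⟨(⟨_, M.wholeField_mem_points⟩ : LocalPts M.points)⟩
  component_integral U hU := M.isDomain_localSections U (hU := hU)

instance : QuasiSeparated M.toSpec := by
  have : IsLocallyNoetherian M.scheme := LocallyOfFiniteType.isLocallyNoetherian M.toSpec
  infer_instance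

/-! ### Separatedness -/

section Separated

variable {R E : Type u} [CommRing R] [IsLocalRing R] [Field E] (i : R →+* E)
  (hi : Function.Injective i)

open StructureSheaf

theorem eq_top_of_closedPoint_mem (V : Opens (PrimeSpectrum R))
    (h : IsLocalRing.closedPoint R ∈ V) : V = ⊤ :=
  top_le_iff.mp fun y _ => (IsLocalRing.specializes_closedPoint y).mem_open V.2 h

/-- On the spectrum of a local ring `R`, the pull-back of a germ at the image of the closed point is a
global section, hence an element of `R`. -/
theorem _root_.RiemannVariety.FieldModel.exists_graph_of_closedPoint {Z : LocallyRingedSpace.{u}}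
    (N : FieldModel K Z) (g : Spec.locallyRingedSpaceObj (CommRingCat.of R) ⟶ Z) {x : K}
    (hx : x ∈ (N.pt (g.base (IsLocalRing.closedPoint R))).toSubring) :
    ∃ r : R, ∀ y : PrimeSpectrum R, (x, toStalk R y r) ∈ N.graph g y := by
  obtain ⟨t, ht⟩ := N.mem_pt_iff_graph.mp hx
  obtain ⟨V, hV, σ, -, hσ⟩ := N.graph_open ht
  obtain rfl := eq_top_of_closedPoint_mem V hV
  obtain ⟨r, hr⟩ := (ConcreteCategory.bijective_of_isIso (toSpecΓ (CommRingCat.of R))).2 σ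
  refine ⟨r, fun y => ?_⟩
  have := hσ y trivial
  rw [← hr] at this
  exact this

include hi in
/-- Let `f : Spec E ⟶ Z`. For every extension of `f` to a morphism from `Spec R`, the local ring of `Z`
at the image of the closed point is dominated by one and the same local ring `O`, which consists of
the `x` whose pull-back to `E` is defined and lies in `R`. -/
theorem _root_.RiemannVariety.FieldModel.exists_dominates {Z : LocallyRingedSpace.{u}}
    (N : FieldModel K Z) (f : Spec.locallyRingedSpaceObj (CommRingCat.of E) ⟶ Z) :
    ∃ O : LocalSubring K, ∀ g : Spec.locallyRingedSpaceObj (CommRingCat.of R) ⟶ Z,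
      Spec.locallyRingedSpaceMap (CommRingCat.ofHom i) ≫ g = f →
        N.pt (g.base (IsLocalRing.closedPoint R)) ≤ O := by
  let o : PrimeSpectrum E := ⊥
  let Y := Spec.locallyRingedSpaceObj (CommRingCat.of E)
  let j : R →+* (Y.presheaf.stalk o : CommRingCat.{u}) := (toStalk E o).hom.comp i
  have hj : Function.Injective j := by
    have := Y.isLocalRing o
    exact (show E →+* (Y.presheaf.stalk o : CommRingCat.{u}) from (toStalk E o).hom).injective.comp hi
  -- the elements of `K` whose pull-back to `E` is defined and lies in `R`
  let T : Subring K := ((N.graph f o).comap ((RingHom.id K).prodMap j)).map (RingHom.fst K R)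
  have hT : ∀ x, x ∈ T ↔ ∃ r, (x, j r) ∈ N.graph f o := fun x =>
    ⟨fun ⟨⟨x', r⟩, h, e⟩ => ⟨r, by subst e; exact h⟩, fun ⟨r, h⟩ => ⟨(x, r), h, rfl⟩⟩
  have hinv : ∀ x r, (x, j r) ∈ N.graph f o → IsUnit r → x⁻¹ ∈ T := by
    intro x r h hr
    obtain ⟨s, hs⟩ := hr.exists_right_inv
    obtain ⟨hx0, t, ht⟩ := N.graph_local h (hr.map j)
    have h1 : (x * x⁻¹, j r * t) ∈ N.graph f o := mul_mem h ht
    rw [mul_inv_cancel₀ hx0] at h1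
    have h2 : j r * t = 1 := N.graph_functional h1 (one_mem _)
    have h3 : j r * j s = 1 := by rw [← map_mul, hs, map_one]
    have h4 : t = j s := (hr.map j).mul_left_cancel (h2.trans h3.symm)
    exact (hT _).mpr ⟨s, h4 ▸ ht⟩
  have hloc : IsLocalRing T := isLocalRing_of_inv_mem T fun x hx => by
    obtain ⟨r, hr⟩ := (hT x).mp hx
    have h1 : (1 - x, j (1 - r)) ∈ N.graph f o := by
      rw [map_sub, map_one]
      exact sub_mem (one_mem (N.graph f o)) hr
    exact (IsLocalRing.isUnit_or_isUnit_one_sub_self r).imp (hinv x r hr) (hinv _ _ h1)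
  refine ⟨⟨T⟩, fun g hg => ?_⟩
  have key : ∀ x ∈ (N.pt (g.base (IsLocalRing.closedPoint R))).toSubring, ∃ r : R,
      (x, toStalk R (IsLocalRing.closedPoint R) r) ∈ N.graph g (IsLocalRing.closedPoint R) ∧
        (x, j r) ∈ N.graph f o := by
    intro x hx
    obtain ⟨r, hr⟩ := N.exists_graph_of_closedPoint g hx
    refine ⟨r, hr _, ?_⟩
    subst hg
    refine (N.graph_comp _ _ _).mpr ⟨_, hr _, ?_⟩
    exact ConcreteCategory.congr_hom (stalkMap_toStalk (CommRingCat.ofHom i) o) r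
  refine localSubring_le_iff.mpr ⟨fun x hx => ?_, fun x hx hx' => ?_⟩
  · obtain ⟨r, -, hr⟩ := key x hx
    exact (hT x).mpr ⟨r, hr⟩
  · obtain ⟨r, hr, hr'⟩ := key x hx
    obtain ⟨s, hs⟩ := (hT _).mp hx'
    by_cases hx0 : x = 0
    · rw [hx0, inv_zero]; exact zero_mem _
    have h1 : (x * x⁻¹, j r * j s) ∈ N.graph f o := mul_mem hr' hs
    rw [mul_inv_cancel₀ hx0, ← map_mul] at h1
    have h2 : r * s = 1 := hj ((N.graph_functional h1 (one_mem _)).trans (map_one j).symm)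
    have hu : IsUnit (toStalk R (IsLocalRing.closedPoint R) r) :=
      (IsUnit.of_mul_eq_one s h2).map (toStalk R (IsLocalRing.closedPoint R)).hom
    exact N.mem_pt_iff_graph.mpr (N.graph_local hr hu).2

include hi in
/-- Two morphisms from `Spec R` which agree on `Spec E` send the closed point to the same point of the
variety, by `FieldModel.exists_dominates`; hence they factor through the same chart. -/
theorem lift_unique (l l' : Spec (CommRingCat.of R) ⟶ M.scheme)
    (h : Spec.map (CommRingCat.ofHom i) ≫ l = Spec.map (CommRingCat.ofHom i) ≫ l') : l = l' := by
  obtain ⟨O, hO⟩ := M.model.exists_dominates i hi (Spec.map (CommRingCat.ofHom i) ≫ l).toLRSHom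
  have hx : l (IsLocalRing.closedPoint R) = l' (IsLocalRing.closedPoint R) :=
    M.model.pt_injective (M.eq_of_le (M.pt_mem _) (M.pt_mem _) (hO l.toLRSHom rfl)
      (hO l'.toLRSHom (congrArg Scheme.Hom.toLRSHom h.symm)))
  obtain ⟨A, p, hp⟩ := M.exists_chart_eq (l (IsLocalRing.closedPoint R))
  have hr : ∀ k : Spec (CommRingCat.of R) ⟶ M.scheme, k (IsLocalRing.closedPoint R) = M.chart A p →
      Set.range k ⊆ Set.range (M.chart A) := by
    rintro k hk _ ⟨y, rfl⟩
    have := eq_top_of_closedPoint_mem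
      ((Opens.map k.base).obj ⟨_, (M.chart A).isOpenEmbedding.isOpen_range⟩)
      ⟨p, hk.symm⟩
    exact this.ge (Set.mem_univ y)
  have h1 := hr l hp.symm
  have h2 := hr l' (hx.symm.trans hp.symm)
  rw [← IsOpenImmersion.lift_fac (M.chart A) l h1, ← IsOpenImmersion.lift_fac (M.chart A) l' h2] at h ⊢
  congr 1
  generalize IsOpenImmersion.lift (M.chart A) l h1 = k at h
  generalize IsOpenImmersion.lift (M.chart A) l' h2 = k' at h
  rw [← Category.assoc, ← Category.assoc, cancel_mono] at h
  obtain ⟨φ, rfl⟩ := Spec.map_surjective k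
  obtain ⟨φ', rfl⟩ := Spec.map_surjective k'
  rw [← Spec.map_comp, ← Spec.map_comp, Spec.map_inj] at h
  refine congrArg Spec.map (CommRingCat.hom_ext (RingHom.ext fun a => hi ?_))
  exact ConcreteCategory.congr_hom h a

end Separated

instance : IsSeparated M.toSpec :=
  IsSeparated.of_valuativeCriterion _ fun S => ⟨fun l l' => by
    refine CommSq.LiftStruct.ext ?_
    exact M.lift_unique (algebraMap S.R S.K) (IsFractionRing.injective S.R S.K) l.l l'.l
      (l.fac_left.trans l'.fac_left.symm)⟩

/-- The variety with the given charts. -/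
def variety : Var F :=
  ⟨Over.mk M.toSpec, inferInstanceAs (IsIntegral M.scheme), inferInstanceAs (IsSeparated M.toSpec),
    inferInstanceAs (LocallyOfFiniteType M.toSpec), inferInstanceAs (QuasiCompact M.toSpec)⟩

/-! ### Transition morphisms -/

section Transition

variable (M N : AffineCharts F K)

/-- The order by refinement: `N ≤ M` if every local ring of `N` dominates a local ring of `M`. Then `N`
maps to `M`. -/
instance : Preorder (AffineCharts F K) where
  le N M := ∀ P ∈ N.points, ∃ Q ∈ M.points, Q ≤ P
  le_refl M P hP := ⟨P, hP, le_rfl⟩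
  le_trans _ _ _ h h' P hP :=
    let ⟨Q, hQ, hQP⟩ := h P hP
    let ⟨R, hR, hRQ⟩ := h' Q hQ
    ⟨R, hR, hRQ.trans hQP⟩

variable {M N}

theorem exists_transition (h : N ≤ M) :
    ∃ g : N.space ⟶ M.space, FieldModel.IsBirational N.model M.model g :=
  M.exists_hom N.model N.mem_model_pt fun z => h _ (N.pt_mem z)

/-- The birational morphism from a finer variety to a coarser one. -/
def transition (h : N ≤ M) : N.space ⟶ M.space := (exists_transition h).choose

theorem transition_isBirational (h : N ≤ M) :
    FieldModel.IsBirational N.model M.model (transition h) := (exists_transition h).choose_spec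

theorem transition_structureMap (h : N ≤ M) : transition h ≫ M.structureMap = N.structureMap :=
  (M.model_isOver.comp (transition_isBirational h)).eq N.model_isOver

/-- Varieties with function field `K` and the birational morphisms between them. -/
def toVar : AffineCharts F K ⥤ Var F where
  obj := variety
  map {N M} h := ObjectProperty.homMk (Over.homMk (⟨transition h.le⟩ : N.scheme ⟶ M.scheme)
    (congrArg (fun h => Scheme.Hom.mk h) (transition_structureMap h.le)))
  map_id M := by
    refine ObjectProperty.hom_ext _ (Over.OverMorphism.ext (congrArg (fun h => Scheme.Hom.mk h) ?_))
    exact hom_ext (transition_isBirational le_rfl) FieldModel.isBirational_id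
  map_comp h h' := by
    refine ObjectProperty.hom_ext _ (Over.OverMorphism.ext (congrArg (fun h => Scheme.Hom.mk h) ?_))
    exact hom_ext (transition_isBirational (h.le.trans h'.le))
      ((transition_isBirational h'.le).comp (transition_isBirational h.le))

variable (M) in
/-- The generic point, with local ring `K`. -/
def genericPt : M.space := (⟨_, M.wholeField_mem_points⟩ : LocalPts M.points)

variable (M) in
theorem closure_genericPt : closure {M.genericPt} = Set.univ := by
  refine Set.eq_univ_of_forall fun z => mem_closure_iff.mpr fun U hU hz => ?_
  exact ⟨_, wholeField_mem M.wholeField_mem_points hU hz, rfl⟩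

variable (M) in
theorem pt_genericPt : M.model.pt M.genericPt = wholeField K := M.model_pt _

theorem transition_genericPt (h : N ≤ M) : (transition h).base N.genericPt = M.genericPt :=
  M.model.pt_injective (M.eq_of_le (M.pt_mem _) (M.pt_mem _)
    ((transition_isBirational h).pt_le _) (by rw [pt_genericPt, pt_genericPt]))

variable (M) in
theorem genericPoint_scheme : genericPoint M.scheme = M.genericPt :=
  ((genericPoint_spec M.scheme).eq (show IsGenericPoint (α := M.scheme) M.genericPt ⊤ from
    M.closure_genericPt))

theorem isBirationalHom_toVar (h : N ⟶ M) : IsBirationalHom (toVar.map h) := by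
  constructor
  · refine ⟨dense_iff_closure_eq.mpr (Set.univ_subset_iff.mp ?_)⟩
    refine M.closure_genericPt.ge.trans (closure_mono (Set.singleton_subset_iff.mpr ?_))
    exact ⟨N.genericPt, transition_genericPt h.le⟩
  · have : IsIso ((transition h.le).stalkMap N.genericPt) :=
      (transition_isBirational h.le).isIso_stalkMap _ (by
        rw [transition_genericPt, pt_genericPt, pt_genericPt])
    have key : ∀ x : N.scheme, x = N.genericPt →
        IsIso ((⟨transition h.le⟩ : N.scheme ⟶ M.scheme).stalkMap x) := by
      rintro _ rfl
      exact this
    exact key _ N.genericPoint_scheme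

end Transition

end AffineCharts

/-! ### Limits of varieties -/

section Limits

variable {F K : Type u} [Field F] [Field K] [Algebra F K] {Y Z : LocallyRingedSpace.{u}}

theorem FieldModel.IsBirational.mem_graph_comp {X : LocallyRingedSpace.{u}} {M' : FieldModel K Y}
    {M : FieldModel K Z} {g : Y ⟶ Z} (hg : IsBirational M' M g) (q : X ⟶ Y) {w : X} {x : K} {t} :
    (x, t) ∈ M.graph (q ≫ g) w ↔
      (x, t) ∈ M'.graph q w ∧ x ∈ (M.pt (g.base (q.base w))).toSubring := by
  rw [M.graph_comp]
  constructor
  · rintro ⟨t', ht', rfl⟩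
    obtain ⟨rfl, hx⟩ := hg.mem_graph.mp ht'
    exact ⟨M'.mem_graph.mpr ⟨t', rfl, rfl⟩, hx⟩
  · rintro ⟨h, hx⟩
    obtain ⟨a, rfl, rfl⟩ := M'.mem_graph.mp h
    exact ⟨a, hg.mem_graph.mpr ⟨rfl, hx⟩, rfl⟩

/-- The space `Z` modelled on `K` is the set-theoretic limit of the varieties in `J`: each local ring of
`Z` dominates a point of each member of `J` and is the union of the points obtained in this way, and
each compatible system of points of the members of `J` has a union of this kind. -/
structure IsDominatedLimit (N : FieldModel K Z) (J : Set (AffineCharts F K)) : Prop where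
  exists_le : ∀ z, ∀ M ∈ J, ∃ P ∈ M.points, P ≤ N.pt z
  exists_mem : ∀ z, ∀ x ∈ (N.pt z).toSubring,
    ∃ M ∈ J, ∃ P ∈ M.points, P ≤ N.pt z ∧ x ∈ P.toSubring
  exists_pt : ∀ P : J → LocalSubring K, (∀ M, P M ∈ M.1.points) → Antitone P →
    ∃ z, ∀ x, x ∈ (N.pt z).toSubring ↔ ∃ M, x ∈ (P M).toSubring

variable {N : FieldModel K Z} {J : Set (AffineCharts F K)}

namespace IsDominatedLimit

section Lift

variable (H : IsDominatedLimit N J) [Nonempty J] [IsCodirectedOrder J]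
  {g : ∀ M : J, Z ⟶ M.1.space} (hg : ∀ M, FieldModel.IsBirational N M.1.model (g M))
  (q : ∀ M : J, Y ⟶ M.1.space)
  (hq : ∀ ⦃M M' : J⦄ (h : M ≤ M'), q M ≫ AffineCharts.transition h = q M')
include H hg

omit [Nonempty J] [IsCodirectedOrder J] in
/-- The graph of a morphism to the limit is the union of the graphs of its components. -/
theorem mem_graph_iff (m : Y ⟶ Z) {y : Y} {x : K} {t} :
    (x, t) ∈ N.graph m y ↔ ∃ M : J, (x, t) ∈ M.1.model.graph (m ≫ g M) y := by
  constructor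
  · intro h
    obtain ⟨M, hM, P, hP, hPz, hx⟩ := H.exists_mem (m.base y) x (N.mem_pt_iff_graph.mpr ⟨t, h⟩)
    refine ⟨⟨M, hM⟩, (hg ⟨M, hM⟩).mem_graph_comp m |>.mpr ⟨h, ?_⟩⟩
    rwa [M.eq_of_le (M.pt_mem _) hP ((hg ⟨M, hM⟩).pt_le _) hPz]
  · rintro ⟨M, hM⟩
    exact ((hg M).mem_graph_comp m |>.mp hM).1

include hq

/-- A compatible family of morphisms to the members of `J` factors through the limit; the graph of the
factorization is the union of the graphs of the family. -/
theorem exists_lift : ∃ m : Y ⟶ Z, ∀ M, m ≫ g M = q M := by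
  have hle : ∀ ⦃M M' : J⦄, M ≤ M' → ∀ y, M'.1.model.graph (q M') y ≤ M.1.model.graph (q M) y := by
    rintro M M' h y ⟨x, t⟩ hx
    rw [← hq h] at hx
    exact ((AffineCharts.transition_isBirational h).mem_graph_comp (q M) |>.mp hx).1
  have hpt : ∀ y, Antitone fun M : J => M.1.model.pt ((q M).base y) := by
    intro y M M' h
    change M'.1.model.pt ((q M').base y) ≤ _
    rw [← hq h]
    exact (AffineCharts.transition_isBirational h).pt_le _
  choose f hf using fun y => H.exists_pt _ (fun M => M.1.pt_mem ((q M).base y)) (hpt y)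
  have hfle : ∀ y (M : J), M.1.model.pt ((q M).base y) ≤ N.pt (f y) := fun y M =>
    localSubring_le_iff.mpr ⟨fun x hx => (hf y x).mpr ⟨M, hx⟩, fun x hx hx' => by
      obtain ⟨M', hM'⟩ := (hf y _).mp hx'
      obtain ⟨M'', h1, h2⟩ := exists_le_le M M'
      exact (localSubring_le_iff.mp (hpt y h1)).2 x hx ((hpt y h2).1 hM')⟩
  have hdir : ∀ y, Directed (· ≤ ·) fun M : J => M.1.model.graph (q M) y := fun y M M' =>
    let ⟨M'', h1, h2⟩ := exists_le_le M M'
    ⟨M'', hle h1 y, hle h2 y⟩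
  let R : ∀ y : Y, Subring (K × (Y.presheaf.stalk y : CommRingCat.{u})) := fun y =>
    ⨆ M : J, M.1.model.graph (q M) y
  have hR : ∀ y x t, (x, t) ∈ R y ↔ ∃ M : J, (x, t) ∈ M.1.model.graph (q M) y := fun y x t =>
    Subring.mem_iSup_of_directed (hdir y)
  have hG : N.IsGraph f R :=
    { mem_pt_iff := fun y x => by
        rw [hf]
        constructor
        · rintro ⟨M, hM⟩
          obtain ⟨t, ht⟩ := M.1.model.mem_pt_iff_graph.mp hM
          exact ⟨t, (hR y x t).mpr ⟨M, ht⟩⟩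
        · rintro ⟨t, ht⟩
          obtain ⟨M, hM⟩ := (hR y x t).mp ht
          exact ⟨M, M.1.model.mem_pt_iff_graph.mpr ⟨t, hM⟩⟩
      eq_zero := fun y t ht => by
        obtain ⟨M, hM⟩ := (hR y 0 t).mp ht
        exact M.1.model.graph_functional hM (zero_mem (M.1.model.graph (q M) y))
      inv_mem := fun y x t ht hu => by
        obtain ⟨M, hM⟩ := (hR y x t).mp ht
        obtain ⟨-, t', ht'⟩ := M.1.model.graph_local hM hu
        exact ⟨t', (hR y _ t').mpr ⟨M, ht'⟩⟩
      isOpen := fun y x t ht => by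
        obtain ⟨M, hM⟩ := (hR y x t).mp ht
        obtain ⟨V, hV, σ, hσ, hVσ⟩ := M.1.model.graph_open hM
        exact ⟨V, hV, σ, hσ, fun z hz => (hR z x _).mpr ⟨M, hVσ z hz⟩⟩ }
  refine ⟨hG.lift, fun M => M.1.model.hom_ext fun y => Subring.ext fun ⟨x, t⟩ => ?_⟩
  rw [(hg M).mem_graph_comp, hG.graph_lift]
  have e : M.1.model.pt ((g M).base (hG.lift.base y)) = M.1.model.pt ((q M).base y) :=
    M.1.eq_of_le (M.1.pt_mem _) (M.1.pt_mem _) ((hg M).pt_le _) (hfle y M)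
  rw [e]
  constructor
  · rintro ⟨hx, hx'⟩
    obtain ⟨t', ht'⟩ := M.1.model.mem_pt_iff_graph.mp hx'
    rwa [hG.functional hx ((hR y x t').mpr ⟨M, ht'⟩)]
  · exact fun h => ⟨(hR y x t).mpr ⟨M, h⟩, M.1.model.mem_pt_iff_graph.mpr ⟨t, h⟩⟩

end Lift

theorem isProVariety (H : IsDominatedLimit N J) [Nonempty J] [IsCodirectedOrder J]
    {h : Z ⟶ baseLRS F} (hh : N.IsOver h) : isProVariety F (Over.mk h) := by
  choose g hg using fun M : J => M.1.exists_hom N hh.algebraMap_mem fun z => H.exists_le z M.1 M.2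
  let D : J ⥤ Var F := (Subtype.mono_coe (· ∈ J)).functor ⋙ AffineCharts.toVar
  have hgh : ∀ M : J, g M ≫ M.1.structureMap = h := fun M => (M.1.model_isOver.comp (hg M)).eq hh
  let c : CategoryTheory.Limits.Cone (D ⋙ varToLRS F) :=
    { pt := Over.mk h
      π :=
        { app := fun M => Over.homMk (V := (varToLRS F).obj (D.obj M)) (g M) (hgh M)
          naturality := fun M M' i => Over.OverMorphism.ext (by
            refine (Category.id_comp _).trans ?_
            exact AffineCharts.hom_ext (hg M')
              ((AffineCharts.transition_isBirational i.le).comp (hg M))) } }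
  refine ⟨J, inferInstance, inferInstance, D, c, fun M M' i => AffineCharts.isBirationalHom_toVar
    ((Subtype.mono_coe (· ∈ J)).functor.map i),
    ⟨?_⟩, ⟨Iso.refl _⟩⟩
  have hs : ∀ s : CategoryTheory.Limits.Cone (D ⋙ varToLRS F), ∃ m : s.pt ⟶ Over.mk h,
      ∀ M : J, m ≫ c.π.app M = s.π.app M := fun s => by
    let q : ∀ M : J, s.pt.left ⟶ M.1.space := fun M => (s.π.app M).left
    have hq : ∀ ⦃M M' : J⦄ (i : M ≤ M'), q M ≫ AffineCharts.transition i = q M' := fun M M' i =>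
      congrArg Over.Hom.left (s.w (homOfLE i))
    obtain ⟨m, hm⟩ := H.exists_lift hg q hq
    obtain ⟨M₀⟩ := ‹Nonempty J›
    refine ⟨Over.homMk m ?_, fun M => Over.OverMorphism.ext (hm M)⟩
    have h1 : (s.π.app M₀).left ≫ M₀.1.structureMap = s.pt.hom := Over.w (s.π.app M₀)
    refine (congrArg (m ≫ ·) (hgh M₀).symm).trans ?_
    refine (Category.assoc _ _ _).symm.trans ?_
    exact (congrArg (· ≫ M₀.1.structureMap) (hm M₀)).trans h1
  choose lift hlift using hs
  refine ⟨lift, hlift, fun s m hm => Over.OverMorphism.ext ?_⟩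
  refine N.hom_ext fun y => Subring.ext fun ⟨x, t⟩ => ?_
  rw [H.mem_graph_iff hg, H.mem_graph_iff hg]
  refine exists_congr fun M => ?_
  have : m.left ≫ g M = (lift s).left ≫ g M :=
    congrArg Over.Hom.left ((hm M).trans (hlift s M).symm)
  rw [this]

end IsDominatedLimit

end Limits

/-! ### Spectra and Riemann varieties as limits of varieties -/

section Systems

variable {F K : Type u} [Field F] [Field K] [Algebra F K]

theorem exists_div_of_adjoin_eq_top {T : Set K} (hT : IntermediateField.adjoin F T = ⊤)
    {A : Subalgebra F K} (hA : T ⊆ A) (x : K) : ∃ a ∈ A, ∃ b ∈ A, b ≠ 0 ∧ x = a / b := by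
  obtain ⟨a, ha, b, hb, e⟩ := IntermediateField.mem_adjoin_iff_div.mp
    (hT ▸ IntermediateField.mem_top : x ∈ _)
  have hle : Algebra.adjoin F T ≤ A := Algebra.adjoin_le hA
  by_cases h0 : b = 0
  · exact ⟨0, zero_mem A, 1, one_mem A, one_ne_zero, by rw [e, h0, div_zero, div_one]⟩
  · exact ⟨a, hle ha, b, hle hb, h0, e⟩

section Affine

/-- An affine variety, with a single chart. -/
def affineModel (A : Subalgebra F K) (hA : A.FG) (hK : ∀ x : K, ∃ a ∈ A, ∃ b ∈ A, b ≠ 0 ∧ x = a / b) :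
    AffineCharts F K where
  charts := {A}
  finite := Set.finite_singleton A
  nonempty := Set.singleton_nonempty A
  fg := by rintro _ rfl; exact hA
  exists_div := by rintro _ rfl; exact hK
  unique := by
    rintro O _ rfl _ rfl p q hp hq
    rw [eq_of_locAt_le hp hq]

variable (F K) in
/-- The affine varieties with function field `K`. -/
def affineModels : Set (AffineCharts F K) := {M | ∃ A, M.charts = {A}}

theorem exists_affineModel (hfg : (⊤ : IntermediateField F K).FG) (A : Subalgebra F K) (hA : A.FG) :
    ∃ M ∈ affineModels F K, ∃ B, M.charts = {B} ∧ A ≤ B := by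
  obtain ⟨t, ht⟩ := hfg
  refine ⟨affineModel (Algebra.adjoin F (t : Set K) ⊔ A) (Subalgebra.FG.sup ⟨t, rfl⟩ hA)
    (exists_div_of_adjoin_eq_top ht fun x hx => ?_), ⟨_, rfl⟩, _, rfl, le_sup_right⟩
  exact (le_sup_left : Algebra.adjoin F (t : Set K) ≤ _) (Algebra.subset_adjoin hx)

theorem affineModel_exists_le {M : AffineCharts F K} {A : Subalgebra F K} (hA : M.charts = {A})
    {O : LocalSubring K} (hO : ∀ x ∈ A, x ∈ O.toSubring) : ∃ P ∈ M.points, P ≤ O := by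
  obtain ⟨p, hp⟩ := exists_locAt_le hO
  exact ⟨_, ⟨A, hA ▸ rfl, p, rfl⟩, hp⟩

theorem affineModel_mem {M : AffineCharts F K} {A : Subalgebra F K} (hA : M.charts = {A})
    {P : LocalSubring K} (hP : P ∈ M.points) {x : K} (hx : x ∈ A) : x ∈ P.toSubring := by
  obtain ⟨B, hB, p, rfl⟩ := hP
  rw [hA] at hB
  obtain rfl : B = A := hB
  exact le_locAt p hx

theorem isProVariety_spec (hfg : (⊤ : IntermediateField F K).FG) : isProVariety F
    (Over.mk (Spec.locallyRingedSpaceMap (CommRingCat.ofHom (algebraMap F K)))) := by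
  have hpt : ∀ (z : PrimeSpectrum K) (x : K), x ∈ ((specModel K K).pt z).toSubring := fun z x =>
    ⟨_, specEv_toStalk K z x⟩
  have hx : ∀ x : K, ∃ M : affineModels F K, ∀ P ∈ M.1.points, x ∈ P.toSubring := fun x => by
    obtain ⟨M, hM, B, hB, hle⟩ := exists_affineModel hfg (Algebra.adjoin F {x}) ⟨{x}, by simp⟩
    exact ⟨⟨M, hM⟩, fun P hP =>
      affineModel_mem hB hP (hle (Algebra.self_mem_adjoin_singleton F x))⟩
  have : Nonempty (affineModels F K) := ⟨(hx 0).choose⟩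
  have : IsCodirectedOrder (affineModels F K) := ⟨by
    rintro ⟨M, A, hA⟩ ⟨N, B, hB⟩
    obtain ⟨Q, hQ, C, hC, hle⟩ := exists_affineModel hfg (A ⊔ B)
      ((M.fg A (hA ▸ rfl)).sup (N.fg B (hB ▸ rfl)))
    refine ⟨⟨Q, hQ⟩, fun P hP => affineModel_exists_le hA fun x hx => ?_,
      fun P hP => affineModel_exists_le hB fun x hx => ?_⟩
    · exact affineModel_mem hC hP (hle ((le_sup_left : A ≤ A ⊔ B) hx))
    · exact affineModel_mem hC hP (hle ((le_sup_right : B ≤ A ⊔ B) hx))⟩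
  have H : IsDominatedLimit (specModel K K) (affineModels F K) :=
    { exists_le := fun z M ⟨A, hA⟩ => affineModel_exists_le hA fun x _ => hpt z x
      exists_mem := fun z x _ => by
        obtain ⟨M, hM⟩ := hx x
        obtain ⟨A, hA⟩ := M.2
        obtain ⟨P, hP, hPz⟩ := affineModel_exists_le hA fun x _ => hpt z x
        exact ⟨M.1, M.2, P, hP, hPz, hM P hP⟩
      exists_pt := fun P hP _ =>
        -- the union of a compatible system is all of `K`, the local ring of the only point
        ⟨(⊥ : PrimeSpectrum K), fun x => ⟨fun _ => by
        obtain ⟨M, hM⟩ := hx x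
        exact ⟨M, hM _ (hP M)⟩, fun _ => hpt _ x⟩⟩ }
  exact H.isProVariety (specModel_isOver K)

end Affine

section Projective

open Pointwise

/-- The algebra `F[S/s]` generated by the quotients of the elements of `S` by `s`. -/
def ratios (F : Type u) {K : Type u} [Field F] [Field K] [Algebra F K] (S : Finset K) (s : K) :
    Subalgebra F K :=
  Algebra.adjoin F ((· / s) '' (S : Set K))

theorem div_mem_ratios {S : Finset K} {u : K} (hu : u ∈ S) (s : K) : u / s ∈ ratios F S s :=
  Algebra.subset_adjoin ⟨u, hu, rfl⟩

theorem ratios_le {S : Finset K} {s : K} {O : LocalSubring K}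
    (hF : ∀ a : F, algebraMap F K a ∈ O.toSubring) (h : ∀ u ∈ S, u / s ∈ O.toSubring) :
    ∀ x ∈ ratios F S s, x ∈ O.toSubring := by
  intro x hx
  induction hx using Algebra.adjoin_induction with
  | mem z hz => obtain ⟨u, hu, rfl⟩ := hz; exact h u hu
  | algebraMap r => exact hF r
  | add a b _ _ ha hb => exact add_mem ha hb
  | mul a b _ _ ha hb => exact mul_mem ha hb

/-- Localizations of two of the algebras `F[S/s]` dominated by the same local ring are equal, which is
proved one inequality at a time: since `s / t` lies in `O`, the element `t / s` is a unit of the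
localization of `F[S/s]`, which thus contains `F[S/t]`. -/
theorem ratios_locAt_le {S : Finset K} {s t : K} (hs : s ∈ S) (ht : t ∈ S) (hs0 : s ≠ 0)
    {O : LocalSubring K} {p : PrimeSpectrum (ratios F S s)} {q : PrimeSpectrum (ratios F S t)}
    (hp : locAt _ p ≤ O) (hq : locAt _ q ≤ O) : locAt _ q ≤ locAt _ p := by
  have hst : s / t ∈ (locAt _ p).toSubring := by
    rw [← inv_div]
    refine (localSubring_le_iff.mp hp).2 _ (le_locAt p (div_mem_ratios ht s)) ?_
    rw [inv_div]
    exact hq.1 (le_locAt q (div_mem_ratios hs t))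
  have hle : ∀ x ∈ ratios F S t, x ∈ (locAt _ p).toSubring :=
    ratios_le (fun a => le_locAt p (algebraMap_mem _ a)) fun u hu => by
      have := mul_mem (le_locAt p (div_mem_ratios (F := F) hu s)) hst
      rwa [div_mul_div_cancel₀ hs0] at this
  obtain ⟨q', hq'⟩ := exists_locAt_le hle
  rwa [eq_of_locAt_le hq (hq'.trans hp)]

variable (F) in
/-- The elements of `S` are the homogeneous coordinates of a projective model of `K`: they are nonzero
and their quotients generate `K`. -/
structure IsCoordinates (S : Finset K) : Prop where
  nonempty : S.Nonempty
  zero_notMem : 0 ∉ S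
  adjoin_eq_top : ∀ s ∈ S, IntermediateField.adjoin F ((· / s) '' (S : Set K)) = ⊤

theorem IsCoordinates.ne_zero {S : Finset K} (hS : IsCoordinates F S) {s : K} (hs : s ∈ S) : s ≠ 0 :=
  fun h => hS.zero_notMem (h ▸ hs)

/-- The projective model with homogeneous coordinates `S`: the closure of the image of the generic
point in the projective space with coordinates indexed by `S`. -/
def projectiveModel (S : Finset K) (hS : IsCoordinates F S) : AffineCharts F K where
  charts := ratios F S '' (S : Set K)
  finite := S.finite_toSet.image _
  nonempty := hS.nonempty.to_set.image _
  fg := by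
    classical
    rintro _ ⟨s, _, rfl⟩
    exact ⟨S.image (· / s), by rw [Finset.coe_image]; rfl⟩
  exists_div := by
    rintro _ ⟨s, hs, rfl⟩ x
    exact exists_div_of_adjoin_eq_top (hS.adjoin_eq_top s hs) Algebra.subset_adjoin x
  unique := by
    rintro O _ ⟨s, hs, rfl⟩ _ ⟨t, ht, rfl⟩ p q hp hq
    exact le_antisymm (ratios_locAt_le ht hs (hS.ne_zero ht) hq hp)
      (ratios_locAt_le hs ht (hS.ne_zero hs) hp hq)

theorem projectiveModel_exists_le {S : Finset K} (hS : IsCoordinates F S) {O : LocalSubring K}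
    (hF : ∀ a : F, algebraMap F K a ∈ O.toSubring) {s : K} (hs : s ∈ S)
    (h : ∀ u ∈ S, u / s ∈ O.toSubring) : ∃ P ∈ (projectiveModel S hS).points, P ≤ O := by
  obtain ⟨p, hp⟩ := exists_locAt_le (ratios_le hF h)
  exact ⟨_, ⟨_, ⟨s, hs, rfl⟩, p, rfl⟩, hp⟩

theorem projectiveModel_exists_div_mem {S : Finset K} (hS : IsCoordinates F S) {P : LocalSubring K}
    (hP : P ∈ (projectiveModel S hS).points) : ∃ s ∈ S, ∀ u ∈ S, u / s ∈ P.toSubring := by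
  obtain ⟨_, ⟨s, hs, rfl⟩, p, rfl⟩ := hP
  exact ⟨s, hs, fun u hu => le_locAt p (div_mem_ratios hu s)⟩

theorem IsCoordinates.mul [DecidableEq K] {S T : Finset K} (hS : IsCoordinates F S)
    (hT : T.Nonempty) (hT0 : 0 ∉ T) : IsCoordinates F (S * T) where
  nonempty := hS.nonempty.mul hT
  zero_notMem h := by
    obtain ⟨s, hs, t, ht, h⟩ := Finset.mem_mul.mp h
    exact (mul_eq_zero.mp h).elim (hS.ne_zero hs) fun h => hT0 (h ▸ ht)
  adjoin_eq_top x hx := by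
    obtain ⟨s, hs, t, ht, rfl⟩ := Finset.mem_mul.mp hx
    refine top_le_iff.mp ((hS.adjoin_eq_top s hs).ge.trans (IntermediateField.adjoin.mono _ _ _ ?_))
    rintro _ ⟨u, hu, rfl⟩
    exact ⟨u * t, Finset.mul_mem_mul hu ht, mul_div_mul_right _ _ fun h => hT0 (h ▸ ht)⟩

/-- The model with coordinates `S * T`, the Segre embedding of the join of the models of `S` and `T`,
refines the model of `S`. -/
theorem projectiveModel_mul_le [DecidableEq K] {S T : Finset K} (hS : IsCoordinates F S)
    (hT0 : 0 ∉ T) (hST : IsCoordinates F (S * T)) :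
    projectiveModel (S * T) hST ≤ projectiveModel S hS := by
  intro P hP
  obtain ⟨x, hx, h⟩ := projectiveModel_exists_div_mem hST hP
  obtain ⟨s, hs, t, ht, rfl⟩ := Finset.mem_mul.mp hx
  refine projectiveModel_exists_le hS (fun a => AffineCharts.algebraMap_mem _ hP a) hs fun u hu => ?_
  rw [← mul_div_mul_right u s fun h => hT0 (h ▸ ht)]
  exact h _ (Finset.mul_mem_mul hu ht)

theorem exists_isCoordinates (hfg : (⊤ : IntermediateField F K).FG) :
    ∃ S : Finset K, IsCoordinates F S := by
  classical
  obtain ⟨t, ht⟩ := hfg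
  -- the presence of `1` among the coordinates makes each of them a quotient of two coordinates
  refine ⟨insert 1 (t.erase 0), ⟨Finset.insert_nonempty _ _, by simp, fun s hs => ?_⟩⟩
  refine top_le_iff.mp (ht.ge.trans (IntermediateField.adjoin_le_iff.mpr fun x hx => ?_))
  have h0 : s ≠ 0 := by
    rintro rfl
    simp at hs
  have h1 : ∀ u ∈ insert 1 (t.erase 0), u / s ∈
      IntermediateField.adjoin F ((· / s) '' ((insert 1 (t.erase 0) : Finset K) : Set K)) :=
    fun u hu => IntermediateField.subset_adjoin _ _ ⟨u, hu, rfl⟩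
  by_cases hx0 : x = 0
  · rw [hx0]; exact zero_mem _
  have h2 := div_mem (h1 x (Finset.mem_insert_of_mem (Finset.mem_erase.mpr ⟨hx0, hx⟩)))
    (h1 1 (Finset.mem_insert_self _ _))
  rwa [div_div_div_cancel_right₀ h0, div_one] at h2

variable (F K) in
/-- The projective models of `K`. -/
def projectiveModels : Set (AffineCharts F K) := {M | ∃ S hS, M = projectiveModel S hS}

/-- For each `x` there is a projective model on which `x` has no point of indeterminacy: multiply the
coordinates of any model by `{1, x}`. -/
theorem exists_mem_or_inv_mem (hfg : (⊤ : IntermediateField F K).FG) (x : K) :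
    ∃ M : projectiveModels F K, ∀ P ∈ M.1.points, x ∈ P.toSubring ∨ x⁻¹ ∈ P.toSubring := by
  classical
  obtain ⟨S, hS⟩ := exists_isCoordinates hfg
  by_cases h0 : x = 0
  · exact ⟨⟨_, S, hS, rfl⟩, fun P _ => Or.inl (h0 ▸ zero_mem _)⟩
  have hT : IsCoordinates F (S * {1, x}) :=
    hS.mul (Finset.insert_nonempty _ _) (by simp [Ne.symm h0])
  refine ⟨⟨_, _, hT, rfl⟩, fun P hP => ?_⟩
  obtain ⟨y, hy, h⟩ := projectiveModel_exists_div_mem hT hP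
  obtain ⟨s, hs, t, ht, rfl⟩ := Finset.mem_mul.mp hy
  have hs0 := hS.ne_zero hs
  rcases Finset.mem_insert.mp ht with rfl | ht
  · left
    have := h (s * x) (Finset.mul_mem_mul hs (by simp))
    rwa [mul_div_mul_left _ _ hs0, div_one] at this
  · right
    rw [Finset.mem_singleton] at ht
    subst ht
    have := h (s * 1) (Finset.mul_mem_mul hs (by simp))
    rwa [mul_div_mul_left _ _ hs0, one_div] at this

/-- The centre of a valuation on a projective model: it lies on the chart of a coordinate of largest
value. -/
theorem projectiveModels_exists_le (v : SigmaPts F K) {M : AffineCharts F K}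
    (hM : M ∈ projectiveModels F K) : ∃ P ∈ M.points, P ≤ (sigmaModel F K).pt v := by
  rw [sigmaModel_pt]
  obtain ⟨S, hS, rfl⟩ := hM
  obtain ⟨s, hs, hmax⟩ := S.exists_max_image v.1.valuation hS.nonempty
  refine projectiveModel_exists_le hS v.2 hs fun u hu => ?_
  refine (v.1.valuation_le_one_iff _).mp ?_
  rw [map_div₀]
  exact div_le_one_of_le₀ (hmax u hu) zero_le

theorem isProVariety_sigma (hfg : (⊤ : IntermediateField F K).FG) :
    isProVariety F (sigmaOver F K) := by
  classical
  have : Nonempty (projectiveModels F K) := ⟨(exists_mem_or_inv_mem hfg 0).choose⟩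
  have hdir : IsCodirectedOrder (projectiveModels F K) := ⟨by
    rintro ⟨_, S, hS, rfl⟩ ⟨_, T, hT, rfl⟩
    have h := hS.mul hT.nonempty hT.zero_notMem
    refine ⟨⟨_, _, h, rfl⟩, projectiveModel_mul_le hS hT.zero_notMem h, ?_⟩
    have h' : IsCoordinates F (T * S) := mul_comm S T ▸ h
    have e : projectiveModel (S * T) h = projectiveModel (T * S) h' := by
      congr 1
      exact mul_comm S T
    change projectiveModel (S * T) h ≤ projectiveModel T hT
    rw [e]
    exact projectiveModel_mul_le hT hS.zero_notMem h'⟩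
  have H : IsDominatedLimit (sigmaModel F K) (projectiveModels F K) :=
    { exists_le := fun v M hM => projectiveModels_exists_le v hM
      exists_mem := fun v x hx => by
        obtain ⟨M, hM⟩ := exists_mem_or_inv_mem hfg x
        obtain ⟨P, hP, hPv⟩ := projectiveModels_exists_le v M.2
        refine ⟨M, M.2, P, hP, hPv, (hM P hP).elim id fun h => ?_⟩
        rw [← inv_inv x]
        exact (localSubring_le_iff.mp hPv).2 _ h (by rwa [inv_inv])
      exists_pt := fun P hP hanti => by
        have hd : Directed (· ≤ ·) fun M => (P M).toSubring := fun M M' =>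
          let ⟨M'', h1, h2⟩ := exists_le_le M M'
          ⟨M'', (hanti h1).1, (hanti h2).1⟩
        have hmem : ∀ x, x ∈ (⨆ M, (P M).toSubring) ↔ ∃ M, x ∈ (P M).toSubring := fun x =>
          Subring.mem_iSup_of_directed hd
        let O : ValuationSubring K :=
          { (⨆ M, (P M).toSubring) with
            mem_or_inv_mem' := fun x => by
              obtain ⟨M, hM⟩ := exists_mem_or_inv_mem hfg x
              exact (hM _ (hP M)).imp (fun h => (hmem _).mpr ⟨M, h⟩) fun h => (hmem _).mpr ⟨M, h⟩ }
        obtain ⟨M₀⟩ := this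
        let v : SigmaPts F K := ⟨O, fun a => (hmem _).mpr ⟨M₀, AffineCharts.algebraMap_mem _ (hP M₀) a⟩⟩
        refine ⟨v, fun x => ?_⟩
        rw [sigmaModel_pt]
        exact hmem x }
  exact H.isProVariety (sigmaModel_isOver F K)

end Projective

end Systems

/-! ### Graphs of places -/

section PlaceGraph

variable {F K L : Type u} [Field F] [Field K] [Field L] [Algebra F K] [Algebra F L]

theorem eq_infty_of_extAdd {K : Type*} [Field K] {x z : OnePoint K}
    (h : extAdd x ∞ = some z ∨ extAdd ∞ x = some z) : z = ∞ := by
  rcases x with _ | a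
  · exact h.elim (fun h => absurd h.symm (Option.some_ne_none _))
      fun h => absurd h.symm (Option.some_ne_none _)
  · exact h.elim (fun h => (Option.some_injective _ h).symm) fun h => (Option.some_injective _ h).symm

theorem eq_infty_of_extMul {K : Type*} [Field K] {x z : OnePoint K}
    (h : extMul x ∞ = some z ∨ extMul ∞ x = some z) : z = ∞ := by
  rcases x with _ | a
  · exact h.elim (fun h => (Option.some_injective _ h).symm) fun h => (Option.some_injective _ h).symm
  · by_cases ha : a = 0
    · exact h.elim (fun h => absurd (h.symm.trans (if_pos ha)) (Option.some_ne_none _))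
        fun h => absurd (h.symm.trans (if_pos ha)) (Option.some_ne_none _)
    · exact h.elim (fun h => (Option.some_injective _ ((if_neg ha).symm.trans h)).symm)
        fun h => (Option.some_injective _ ((if_neg ha).symm.trans h)).symm

/-- The subring `G` of `K × L` has the properties of the graph of an `F`-place, that is, of the set of
the pairs `(x, a)` such that `x` has the finite value `a`. -/
structure IsPlaceGraph (F : Type u) [Field F] [Algebra F K] [Algebra F L] (G : Subring (K × L)) :
    Prop where
  functional : ∀ x a b, (x, a) ∈ G → (x, b) ∈ G → a = b
  inv_mem : ∀ x a, (x, a) ∈ G → a ≠ 0 → (x⁻¹, a⁻¹) ∈ G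
  total : ∀ x, (∃ a, (x, a) ∈ G) ∨ ∃ a, (x⁻¹, a) ∈ G
  algebraMap_mem : ∀ a : F, (algebraMap F K a, algebraMap F L a) ∈ G

namespace IsPlaceGraph

variable {G : Subring (K × L)} (h : IsPlaceGraph F G)
include h

theorem inv_mem_of_forall {x : K} (hx : ∀ a, (x, a) ∉ G) : x ≠ 0 ∧ (x⁻¹, (0 : L)) ∈ G := by
  refine ⟨fun h0 => hx 0 (h0 ▸ zero_mem G), ?_⟩
  obtain ⟨a, ha⟩ := (h.total x).resolve_left fun ⟨a, ha⟩ => hx a ha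
  by_cases ha0 : a = 0
  · rwa [ha0] at ha
  · have := h.inv_mem _ _ ha ha0
    rw [inv_inv] at this
    exact absurd this (hx _)

theorem not_mem_mul {x y : K} {a : L} (hxa : (x, a) ∈ G) (ha : a ≠ 0) (hy : ∀ b, (y, b) ∉ G) (c : L) :
    (x * y, c) ∉ G := fun hc => by
  have h1 := h.inv_mem _ _ hxa ha
  have hx : x ≠ 0 := fun h0 => ha (h.functional 0 a 0 (h0 ▸ hxa) (zero_mem G))
  have h2 : (x⁻¹ * (x * y), a⁻¹ * c) ∈ G := mul_mem h1 hc
  rw [inv_mul_cancel_left₀ hx] at h2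
  exact hy _ h2

theorem exists_place : ∃ f : FPlace F K L, ∀ (x : K) (a : L),
    f.toPlace (x : OnePoint K) = (a : OnePoint L) ↔ (x, a) ∈ G := by
  classical
  let v : OnePoint K → OnePoint L := fun x => match x with
    | OnePoint.some x => if h : ∃ a, (x, a) ∈ G then ((h.choose : L) : OnePoint L) else ∞
    | ∞ => ∞
  have hv : ∀ (x : K) (a : L), v x = (a : OnePoint L) ↔ (x, a) ∈ G := fun x a => by
    change (if h : ∃ a, (x, a) ∈ G then ((h.choose : L) : OnePoint L) else ∞) = _ ↔ _
    split_ifs with hx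
    · rw [OnePoint.coe_eq_coe]
      exact ⟨fun e => e ▸ hx.choose_spec, fun ha => h.functional x _ _ hx.choose_spec ha⟩
    · exact ⟨fun e => absurd e.symm (OnePoint.coe_ne_infty _), fun ha => absurd ⟨a, ha⟩ hx⟩
  have hv' : ∀ x : K, v x = ∞ ↔ ∀ a, (x, a) ∉ G := fun x => by
    constructor
    · intro hx a ha
      exact OnePoint.coe_ne_infty a (((hv x a).mpr ha).symm.trans hx)
    · intro hx
      rcases e : v x with _ | a
      · rfl
      · exact absurd ((hv x a).mp e) (hx a)
  refine ⟨{ toFun := v, map_one' := (hv 1 1).mpr (one_mem G), map_add' := ?_, map_mul' := ?_,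
            map_algebraMap' := fun a => (hv _ _).mpr (h.algebraMap_mem a) }, hv⟩
  · intro x y z w hz hw
    rcases x with _ | x
    · rw [eq_infty_of_extAdd (Or.inr hz)]
      exact (eq_infty_of_extAdd (Or.inr hw)).symm
    rcases y with _ | y
    · rw [eq_infty_of_extAdd (Or.inl hz)]
      exact (eq_infty_of_extAdd (Or.inl hw)).symm
    obtain rfl := Option.some_injective _ hz
    change extAdd (v (x : OnePoint K)) (v (y : OnePoint K)) = some w at hw
    rcases hx : v (x : OnePoint K) with _ | a <;> rcases hy : v (y : OnePoint K) with _ | b <;>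
      rw [hx, hy] at hw
    · exact absurd hw.symm (Option.some_ne_none _)
    · obtain rfl := Option.some_injective _ hw
      refine (hv' _).mpr fun c hc => (hv' x).mp hx (c - b) ?_
      have := sub_mem hc ((hv y b).mp hy)
      rwa [Prod.mk_sub_mk, add_sub_cancel_right] at this
    · obtain rfl := Option.some_injective _ hw
      refine (hv' _).mpr fun c hc => (hv' y).mp hy (c - a) ?_
      have := sub_mem hc ((hv x a).mp hx)
      rwa [Prod.mk_sub_mk, add_sub_cancel_left] at this
    · obtain rfl := Option.some_injective _ hw
      exact (hv _ _).mpr (add_mem ((hv x a).mp hx) ((hv y b).mp hy))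
  · intro x y z w hz hw
    rcases x with _ | x
    · rw [eq_infty_of_extMul (Or.inr hz)]
      exact (eq_infty_of_extMul (Or.inr hw)).symm
    rcases y with _ | y
    · rw [eq_infty_of_extMul (Or.inl hz)]
      exact (eq_infty_of_extMul (Or.inl hw)).symm
    obtain rfl := Option.some_injective _ hz
    change extMul (v (x : OnePoint K)) (v (y : OnePoint K)) = some w at hw
    rcases hx : v (x : OnePoint K) with _ | a <;> rcases hy : v (y : OnePoint K) with _ | b <;>
      rw [hx, hy] at hw
    · obtain rfl := Option.some_injective _ hw
      refine (hv' _).mpr fun c hc => ?_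
      obtain ⟨hx0, hxi⟩ := h.inv_mem_of_forall ((hv' x).mp hx)
      have : (x⁻¹ * (x * y), 0 * c) ∈ G := mul_mem hxi hc
      rw [inv_mul_cancel_left₀ hx0] at this
      exact (hv' y).mp hy _ this
    · rw [eq_infty_of_extMul (Or.inr hw)]
      refine (hv' _).mpr fun c hc => h.not_mem_mul ((hv y b).mp hy) ?_ ((hv' x).mp hx) c (by
        rwa [mul_comm])
      rintro rfl
      exact absurd (hw.symm.trans (if_pos rfl)) (Option.some_ne_none _)
    · rw [eq_infty_of_extMul (Or.inl hw)]
      refine (hv' _).mpr (h.not_mem_mul ((hv x a).mp hx) ?_ ((hv' y).mp hy))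
      rintro rfl
      exact absurd (hw.symm.trans (if_pos rfl)) (Option.some_ne_none _)
    · obtain rfl := Option.some_injective _ hw
      exact (hv _ _).mpr (mul_mem ((hv x a).mp hx) ((hv y b).mp hy))

end IsPlaceGraph

theorem FPlace.ext_of_forall {f f' : FPlace F K L} (h : ∀ (x : K) (a : L),
    f.toPlace (x : OnePoint K) = (a : OnePoint L) ↔ f'.toPlace (x : OnePoint K) = (a : OnePoint L)) :
    f = f' := by
  refine FPlace.ext (funext fun x => ?_)
  rcases x with _ | x
  · exact f.map_infty.trans f'.map_infty.symm
  rcases e : f'.toPlace (x : OnePoint K) with _ | a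
  · rcases e' : f.toPlace (x : OnePoint K) with _ | b
    · exact e'.trans e.symm
    · exact absurd (((h x b).mp e').symm.trans e) (OnePoint.coe_ne_infty b)
  · exact ((h x a).mpr e).trans e.symm

end PlaceGraph

/-! ### Morphisms to Riemann varieties -/

section Morphisms

variable {F K L : Type u} [Field F] [Field K] [Field L] [Algebra F K] [Algebra F L]

open StructureSheaf

theorem FieldModel.pt_le_of_graph_le {Y Z : LocallyRingedSpace.{u}} (M : FieldModel K Z)
    {g g' : Y ⟶ Z} {y : Y} (h : M.graph g y ≤ M.graph g' y) :
    M.pt (g.base y) ≤ M.pt (g'.base y) := by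
  refine localSubring_le_iff.mpr ⟨fun x hx => ?_, fun x hx hx' => ?_⟩
  · obtain ⟨t, ht⟩ := M.mem_pt_iff_graph.mp hx
    exact M.mem_pt_iff_graph.mpr ⟨t, h ht⟩
  · by_cases h0 : x = 0
    · rw [h0, inv_zero]; exact zero_mem _
    obtain ⟨t, ht⟩ := M.mem_pt_iff_graph.mp hx
    obtain ⟨t', ht'⟩ := M.mem_pt_iff_graph.mp hx'
    have h1 : (x * x⁻¹, t * t') ∈ M.graph g' y := mul_mem (h ht) ht'
    rw [mul_inv_cancel₀ h0] at h1
    have h2 : t * t' = 1 := M.graph_functional h1 (one_mem (M.graph g' y))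
    exact M.mem_pt_iff_graph.mpr (M.graph_local ht (IsUnit.of_mul_eq_one t' h2)).2

/-- An inclusion between graphs of morphisms to a Riemann variety is an equality, because valuation
rings are maximal for domination. -/
theorem sigma_graph_eq_of_le {Y : LocallyRingedSpace.{u}} {g g' : Y ⟶ sigmaLRS F K} {y : Y}
    (h : (sigmaModel F K).graph g y ≤ (sigmaModel F K).graph g' y) :
    (sigmaModel F K).graph g y = (sigmaModel F K).graph g' y := by
  refine le_antisymm h ?_
  rintro ⟨x, t⟩ hx
  have h1 := (sigmaModel F K).pt_le_of_graph_le h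
  have h2 : (sigmaModel F K).pt (g'.base y) ≤ (sigmaModel F K).pt (g.base y) := by
    have e := sigmaModel_pt (F := F) (K := K) (g.base y)
    rw [e] at h1 ⊢
    exact ValuationSubring.isMax_toLocalSubring _ h1
  obtain ⟨t', ht'⟩ := (sigmaModel F K).mem_pt_iff_graph.mp
    (h2.1 ((sigmaModel F K).mem_pt_iff_graph.mpr ⟨t, hx⟩))
  rwa [(sigmaModel F K).graph_functional hx (h ht')]

/-- The graph of `λ^*` consists of the pairs `(x, λ(x))`. -/
theorem mem_graph_pull (f : FPlace F K L) {w : SigmaPts F L} {x : K}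
    {t : ((sigmaLRS F L).presheaf.stalk w : CommRingCat.{u})} :
    (x, t) ∈ (sigmaModel F K).graph f.pullLRS w ↔
      f.toPlace (x : OnePoint K) = ((sigmaModel F L).ev w t : OnePoint L) := by
  have key : ∀ a, f.toPlace ((sigmaModel F K).ev (f.pullLRS.base w) a : OnePoint K) =
      ((sigmaModel F L).ev w (f.pullLRS.stalkMap w a) : OnePoint L) := f.stalkMap_pull w
  constructor
  · intro h
    obtain ⟨a, rfl, rfl⟩ := (sigmaModel F K).mem_graph.mp h
    exact key a
  · intro h
    obtain ⟨a, ha⟩ : x ∈ ((sigmaModel F K).pt (f.pullLRS.base w)).toSubring := by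
      have e := sigmaModel_pt (F := F) (K := K) (f.pullPt w)
      refine (congrArg LocalSubring.toSubring e).ge ?_
      refine ⟨_, ?_, h⟩
      exact (congrArg LocalSubring.toSubring (sigmaModel_pt F L w)).le ((sigmaModel F L).ev_mem_pt w t)
    refine (sigmaModel F K).mem_graph.mpr ⟨a, ha, (sigmaModel F L).ev_injective w ?_⟩
    refine OnePoint.coe_injective ((key a).symm.trans (Eq.trans ?_ h))
    rw [ha]

/-- The spectrum of a field, as a locally ringed space. -/
abbrev specLRS (L : Type u) [Field L] : LocallyRingedSpace.{u} :=
  Spec.locallyRingedSpaceObj (CommRingCat.of L)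

/-- The point of the spectrum of a field. -/
def specPt (L : Type u) [Field L] : specLRS L := (⊥ : PrimeSpectrum L)

theorem eq_specPt (p : specLRS L) : p = specPt L :=
  Subsingleton.elim (α := PrimeSpectrum L) p _

theorem specModel_ev_surjective (a : L) : ∃ t, (specModel L L).ev (specPt L) t = a :=
  ⟨_, specEv_toStalk L (⊥ : PrimeSpectrum L) a⟩

variable (F L) in
theorem genLRS_isBirational : FieldModel.IsBirational (specModel L L) (sigmaModel F L) (genLRS F L) := by
  intro p a
  obtain ⟨U, hU, s, rfl⟩ := (sigmaPresheaf F L).exists_germ_eq (x := (genPt F L : sigmaTop F L)) a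
  have hU' : genPt F L ∈ U := hU
  refine Eq.trans ?_ (sigmaEv_germ U (genPt F L : sigmaTop F L) hU s).symm
  refine (congrArg ((specModel L L).ev p)
    (LocallyRingedSpace.stalkMap_germ_apply (genLRS F L) U p hU s)).trans ?_
  refine Eq.trans ?_ ((specEv_toStalk L p _).trans (genValue_eq hU' s))
  exact congrArg (specEv L p) (ConcreteCategory.congr_hom
    (algebraMap_germ ((Opens.map (genBase F L)).obj U) p hU) (genValue F L s))

theorem pt_genPt (x : L) : x ∈ ((sigmaModel F L).pt (genPt F L : SigmaPts F L)).toSubring :=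
  (congrArg LocalSubring.toSubring (sigmaModel_pt F L (genPt F L))).ge trivial

/-- The graph at the only point of a morphism from `Spec L`, with the stalk of `Spec L` identified
with `L`. -/
def residueGraph (g : specLRS L ⟶ sigmaLRS F K) : Subring (K × L) :=
  ((sigmaModel F K).graph g (specPt L)).map
    ((RingHom.id K).prodMap ((specModel L L).ev (specPt L)))

omit [Algebra F L] in
theorem mem_residueGraph {g : specLRS L ⟶ sigmaLRS F K} {x : K} {t} :
    (x, (specModel L L).ev (specPt L) t) ∈ residueGraph g ↔
      (x, t) ∈ (sigmaModel F K).graph g (specPt L) := by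
  constructor
  · rintro ⟨⟨x', t'⟩, h, e⟩
    obtain rfl : x' = x := congrArg Prod.fst e
    rwa [← (specModel L L).ev_injective _ (congrArg Prod.snd e)]
  · exact fun h => ⟨_, h, rfl⟩

omit [Algebra F L] in
theorem residueGraph_injective {g g' : specLRS L ⟶ sigmaLRS F K}
    (h : residueGraph g = residueGraph g') : g = g' := by
  refine (sigmaModel F K).hom_ext fun y => ?_
  obtain rfl := eq_specPt y
  refine Subring.ext fun ⟨x, t⟩ => ?_
  rw [← mem_residueGraph, ← mem_residueGraph, h]

theorem mem_residueGraph_genLRS_comp (ψ : sigmaLRS F L ⟶ sigmaLRS F K) {x : K}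
    {t : ((sigmaLRS F L).presheaf.stalk (genPt F L : SigmaPts F L) : CommRingCat.{u})} :
    (x, (sigmaModel F L).ev (genPt F L : SigmaPts F L) t) ∈ residueGraph (genLRS F L ≫ ψ) ↔
      (x, t) ∈ (sigmaModel F K).graph ψ (genPt F L : SigmaPts F L) := by
  have e := genLRS_isBirational F L (specPt L) t
  refine (congrArg (fun a => (x, a) ∈ residueGraph (genLRS F L ≫ ψ)) e).to_iff.symm.trans ?_
  rw [mem_residueGraph, (sigmaModel F K).graph_comp]
  constructor
  · rintro ⟨t', ht', h⟩
    have : t' = t := by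
      refine (sigmaModel F L).ev_injective _ ?_
      rw [← genLRS_isBirational F L (specPt L) t', ← genLRS_isBirational F L (specPt L) t, h]
    rwa [this] at ht'
  · exact fun h => ⟨t, h, rfl⟩

theorem mem_residueGraph_pull (f : FPlace F K L) {x : K} {a : L} :
    (x, a) ∈ residueGraph (genLRS F L ≫ f.pullLRS) ↔ f.toPlace (x : OnePoint K) = (a : OnePoint L) := by
  obtain ⟨t, rfl⟩ := pt_genPt (F := F) a
  exact (mem_residueGraph_genLRS_comp f.pullLRS).trans (mem_graph_pull f)

/-- A morphism `Σ_L ⟶ Σ_K` which agrees with `λ^*` at the generic point is `λ^*`. Germs at `w` extend to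
germs at the generic point with the same value, so the graph of `ψ` at `w` is contained in that of
`λ^*`. -/
theorem eq_pull {ψ : sigmaLRS F L ⟶ sigmaLRS F K} {f : FPlace F K L}
    (h : genLRS F L ≫ ψ = genLRS F L ≫ f.pullLRS) : ψ = f.pullLRS := by
  refine (sigmaModel F K).hom_ext fun w => sigma_graph_eq_of_le ?_
  rintro ⟨x, t⟩ hx
  refine (mem_graph_pull (w := w) f).mpr ((mem_residueGraph_pull f).mp ?_)
  obtain ⟨V, hV, σ, rfl, hσ⟩ := (sigmaModel F K).graph_open hx
  have hg : (genPt F L : SigmaPts F L) ∈ V := genPt_mem V.2 hV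
  have h1 := (mem_residueGraph_genLRS_comp ψ).mpr (hσ _ hg)
  rw [h] at h1
  have e : (sigmaModel F L).ev w ((sigmaLRS F L).presheaf.germ V w hV σ) =
    (sigmaModel F L).ev (genPt F L : SigmaPts F L) ((sigmaLRS F L).presheaf.germ V _ hg σ) :=
    (sigmaModel F L).ev_germ V σ _ _ hV hg
  exact (congrArg (fun a => (x, a) ∈ residueGraph (genLRS F L ≫ f.pullLRS)) e).mpr h1

theorem FieldModel.IsOver.mem_graph {Y Z : LocallyRingedSpace.{u}} {M : FieldModel K Z}
    {h : Z ⟶ baseLRS F} (H : M.IsOver h) (g : Y ⟶ Z) (y : Y) (a : F) :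
    (algebraMap F K a, Y.presheaf.germ ⊤ y trivial (constants (g ≫ h) a)) ∈ M.graph g y := by
  have h1 : constants (g ≫ h) a = g.c.app (op ⊤) (constants h a) :=
    ConcreteCategory.congr_hom (constants_comp g h) a
  rw [h1]
  exact M.mem_graph.mpr ⟨_, H a (g.base y), LocallyRingedSpace.stalkMap_germ_apply g ⊤ y trivial _⟩

theorem isPlaceGraph_residueGraph (g : specLRS L ⟶ sigmaLRS F K)
    (hg : g ≫ (sigmaOver F K).hom =
      Spec.locallyRingedSpaceMap (CommRingCat.ofHom (algebraMap F L))) :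
    IsPlaceGraph F (residueGraph g) where
  functional x a b ha hb := by
    obtain ⟨t, rfl⟩ := specModel_ev_surjective a
    obtain ⟨t', rfl⟩ := specModel_ev_surjective b
    rw [(sigmaModel F K).graph_functional (mem_residueGraph.mp ha) (mem_residueGraph.mp hb)]
  inv_mem x a ha h0 := by
    obtain ⟨t, rfl⟩ := specModel_ev_surjective a
    obtain ⟨t', ht'⟩ := specModel_ev_surjective ((specModel L L).ev (specPt L) t)⁻¹
    have h1 : t * t' = 1 := (specModel L L).ev_injective _ (by
      rw [map_mul, ht', mul_inv_cancel₀ h0, map_one])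
    have hx := mem_residueGraph.mp ha
    obtain ⟨hx0, s, hs⟩ := (sigmaModel F K).graph_local hx (IsUnit.of_mul_eq_one t' h1)
    have h2 : (x * x⁻¹, t * s) ∈ (sigmaModel F K).graph g (specPt L) := mul_mem hx hs
    rw [mul_inv_cancel₀ hx0] at h2
    have h3 : t * s = 1 := (sigmaModel F K).graph_functional h2 (one_mem _)
    have h4 : s = t' := (IsUnit.of_mul_eq_one t' h1).mul_left_cancel (h3.trans h1.symm)
    rw [← ht', ← h4]
    exact mem_residueGraph.mpr hs
  total x := by
    have e := sigmaModel_pt (F := F) (K := K) (g.base (specPt L))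
    have key : ∀ y, y ∈ (show SigmaPts F K from g.base (specPt L)).1 →
        ∃ a, (y, a) ∈ residueGraph g := fun y hy => by
      obtain ⟨t, ht⟩ := (sigmaModel F K).mem_pt_iff_graph.mp
        ((congrArg LocalSubring.toSubring e).ge hy)
      exact ⟨_, mem_residueGraph.mpr ht⟩
    exact ((show SigmaPts F K from g.base (specPt L)).1.mem_or_inv_mem x).imp (key x) (key _)
  algebraMap_mem a := by
    have h1 := mem_residueGraph.mpr ((sigmaModel_isOver F K).mem_graph g (specPt L) a)
    have h2 := (specModel_isOver (F := F) (K := L) L) a (specPt L)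
    rw [← hg] at h2
    exact (congrArg (fun b => (algebraMap F K a, b) ∈ residueGraph g) h2).mp h1

/-- The `F`-places from `K` to `L` are the `F`-morphisms from `Spec L` to `Σ_K`. -/
theorem genOver_pull_bijective : Function.Bijective fun f : FPlace F K L => genOver F L ≫ f.pull := by
  have hl : ∀ f : FPlace F K L, (genOver F L ≫ f.pull).left = genLRS F L ≫ f.pullLRS := fun _ => rfl
  constructor
  · intro f f' h
    have h1 : genLRS F L ≫ f.pullLRS = genLRS F L ≫ f'.pullLRS := congrArg Over.Hom.left h
    refine FPlace.ext_of_forall fun x a => ?_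
    rw [← mem_residueGraph_pull, ← mem_residueGraph_pull, h1]
  · intro g
    obtain ⟨f, hf⟩ := (isPlaceGraph_residueGraph g.left (Over.w g)).exists_place
    refine ⟨f, Over.OverMorphism.ext (residueGraph_injective (Subring.ext fun ⟨x, a⟩ => ?_))⟩
    exact (mem_residueGraph_pull f).trans (hf x a)

theorem pull_bijective :
    Function.Bijective (FPlace.pull : FPlace F K L → (sigmaOver F L ⟶ sigmaOver F K)) := by
  constructor
  · intro f f' h
    exact genOver_pull_bijective.1 (congrArg (genOver F L ≫ ·) h)
  · intro ψ
    obtain ⟨f, hf⟩ := genOver_pull_bijective.2 (genOver F L ≫ ψ)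
    exact ⟨f, Over.OverMorphism.ext (eq_pull (congrArg Over.Hom.left hf.symm)).symm⟩

theorem genOver_comp_bijective :
    Function.Bijective fun ψ : sigmaOver F L ⟶ sigmaOver F K => genOver F L ≫ ψ :=
  (Function.Bijective.of_comp_iff _ pull_bijective).mp genOver_pull_bijective

end Morphisms

/-! ### Full faithfulness -/

section Functors

variable (F : Type u) [Field F]

instance : (sigmaFunctor F).Faithful where
  map_injective h := Quiver.Hom.unop_inj (pull_bijective.1 h)

instance : (sigmaFunctor F).Full where
  map_surjective g :=
    let ⟨f, hf⟩ := pull_bijective.2 g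
    ⟨Quiver.Hom.op f, hf⟩

instance : (specFunctor F).Faithful where
  map_injective h := Quiver.Hom.unop_inj (AlgHom.coe_ringHom_injective
    (congrArg (fun φ => CommRingCat.Hom.hom (Quiver.Hom.unop φ))
      (Spec.toLocallyRingedSpace.map_injective (congrArg Over.Hom.left h))))

instance : (specFunctor F).Full where
  map_surjective {K L} g := by
    obtain ⟨φ, hφ⟩ := Spec.toLocallyRingedSpace.map_surjective
      (X := op (CommRingCat.of K.unop.ext)) (Y := op (CommRingCat.of L.unop.ext)) g.left
    have h : CommRingCat.ofHom (algebraMap F L.unop.ext) ≫ φ.unop =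
        CommRingCat.ofHom (algebraMap F K.unop.ext) := by
      refine Quiver.Hom.op_inj (Spec.toLocallyRingedSpace.map_injective ?_)
      refine (Spec.toLocallyRingedSpace.map_comp φ
        (CommRingCat.ofHom (algebraMap F L.unop.ext)).op).trans ?_
      rw [hφ]
      exact Over.w g
    let f : L.unop ⟶ K.unop :=
      { φ.unop.hom with commutes' := fun a => ConcreteCategory.congr_hom h a }
    exact ⟨f.op, Over.OverMorphism.ext hφ⟩

end Functors

end RiemannVariety

end

theorem mainTheorem6 (F : Type u) [Field F] :
    ∃ (hSpec : ∀ K, RiemannVariety.isProVariety F ((RiemannVariety.specFunctor F).obj K))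
      (hSigma : ∀ K, RiemannVariety.isProVariety F ((RiemannVariety.sigmaFunctor F).obj K)),
      let spec : (RiemannVariety.FieldCat F)ᵒᵖ ⥤ RiemannVariety.VarHat F :=
        (RiemannVariety.isProVariety F).lift (RiemannVariety.specFunctor F) hSpec
      let sigma : (RiemannVariety.PlaceCat F)ᵒᵖ ⥤ RiemannVariety.VarHat F :=
        (RiemannVariety.isProVariety F).lift (RiemannVariety.sigmaFunctor F) hSigma
      (spec.Full ∧ spec.Faithful) ∧ (sigma.Full ∧ sigma.Faithful) ∧
        ∀ K L : RiemannVariety.FunctionField F,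
          Function.Bijective fun ψ : sigma.obj (op ⟨L⟩) ⟶ sigma.obj (op ⟨K⟩) =>
            (ObjectProperty.homMk (RiemannVariety.eta F L) :
              spec.obj (op ⟨L⟩) ⟶ sigma.obj (op ⟨L⟩)) ≫ ψ := by
  refine ⟨fun K => RiemannVariety.isProVariety_spec K.unop.ext.fg,
    fun K => RiemannVariety.isProVariety_sigma K.unop.ext.fg,
    ⟨ObjectProperty.instFullFullSubcategoryLift _ _ _,
      ObjectProperty.instFaithfulFullSubcategoryLift _ _ _⟩,
    ⟨ObjectProperty.instFullFullSubcategoryLift _ _ _,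
      ObjectProperty.instFaithfulFullSubcategoryLift _ _ _⟩, fun K L => ?_⟩
  have h := RiemannVariety.genOver_comp_bijective (F := F) (K := K) (L := L)
  refine ⟨fun ψ ψ' e => ObjectProperty.hom_ext _ (h.1 (congrArg (fun φ => φ.hom) e)), fun g => ?_⟩
  obtain ⟨ψ, hψ⟩ := h.2 g.hom
  exact ⟨ObjectProperty.homMk ψ, ObjectProperty.hom_ext _ hψ⟩
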